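/- **Relative Hecke integral formula.** Let $E/F$ be an extension of number fields of degree $n$. For a number field $k$ let $S_k$ be its set of archimedean places and, for $\sigma\in S_k$, $n_\sigma=[k_\sigma:\mathbb R]$; for an extension $k'/k$ and $\tau\mid\sigma$ let $n_{\tau|\sigma}=[k'_\tau:k_\sigma]$. Fix compatible embeddings $F_\sigma\subset E_\tau\subset\mathbb C$ for $\sigma\in S_F$, $\tau\mid\sigma$; $|\cdot|$ is the usual absolute value of $\mathbb C$ and $\|\cdot\|$ the Euclidean norm of $\mathbb C^n$. *Tori, units, measures.* Put $T_k=\prod_{\sigma\in S_k}\mathbb R_{>0}$ with Haar measure $d^\times t_k=\prod_\sigma d^\times t_\sigma$, where $d^\times t_\sigma=dt/t$ for $\sigma$ real and $2\,dt/t$ for $\sigma$ complex. Let $T_{k'/k}$ be the kernel of $N_{k'/k}:T_{k'}\to T_k$, $(t_\tau)\mapsto(\prod_{\tau|\sigma}t_\tau^{n_{\tau|\sigma}})_\sigma$, with the Haar measure $d^\times t_{k'/k}$ for which the induced measure on $T_{k'}/T_{k'/k}\simeq T_k$ is $d^\times t_k$. Let $U_k\subset T_{k/\mathbb Q}$ be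 the image of $\mathcal O_k^\times$ under $u\mapsto(|\sigma(u)|)_\sigma$ and $U_{k'/k}\subset T_{k'/k}$ the image of $\{u\in\mathcal O_{k'}^\times: N_{k'/k}(u)=1\}$. Let $R_k=\mathrm{vol}(T_{k/\mathbb Q}/U_k)$, $R_{k'/k}=\mathrm{vol}(T_{k'/k}/U_{k'/k})$, let $w_k$ be the number of roots of unity in $k$, and $$\Gamma_{k'/k}(s)=\int_{T_{k'/k}}\prod_{\sigma\in S_k}\Big(\sum_{\tau|\sigma}t_\tau^2\Big)^{-[k':k]n_\sigma s/2}d^\times t_{k'/k},\qquad c_{E/F}(s)=R_{E/F}\,\frac{w_ER_E^{-1}\Gamma_{E/\mathbb Q}(s)}{w_FR_F^{-1}\Gamma_{F/\mathbb Q}(ns)}.$$ *Heegner object.* Let $G(\mathbb R)=\prod_{\sigma\in S_F}GL_n(F_\sigma)$, let $K=\prod_\sigma K_\sigma$ with $K_\sigma=O(n)$ or $U(n)$ according as $\sigma$ is real or complex, and let $\mathfrak h_F^n=G(\mathbb R)/F_\infty^\times K$. Let $w=(w_1,\dots,w_n)$ be a basis of $E$ over $F$. Identify $\prod_{\tau|\sigma}E_\tau\simeq\prod_{\tau|\sigma}F_\sigma^{n_{\tau|\sigma}}\simeq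 F_\sigma^n$, using $x+iy\mapsto(y,x)$ when $n_{\tau|\sigma}=2$ and any ordering of the factors. Let $W\in G(\mathbb R)$ be the element whose component $W_\sigma$ has as $i$-th row the image of $w_i$, let $I(t)\in G(\mathbb R)$, $t\in T_{E/F}$, be given by componentwise multiplication by $t$ on $F_\infty^n\simeq E_\infty$, and put $\varpi(t)=[WI(t)]$. Let $$\Delta_w=N_{F_\infty/\mathbb R}\big((\det W)^2\big),\qquad\text{so}\quad |\Delta_w|=\prod_{\sigma\in S_F}|\det W_\sigma|^{2n_\sigma}.$$ Let $\mathfrak A$ be a fractional $\mathcal O_E$-ideal, $L=\{x\in F^n:\sum_i x_iw_i\in\mathfrak A\}$ and $\Gamma_L=\{\gamma\in SL_n(F):L\gamma=L\}$. Then $\varpi$ induces $\overline\varpi:T_{E/F}/U_{E/F}\to\Gamma_L\backslash\mathfrak h_F^n$. *Eisenstein series.* Let $\mathfrak a\subset F$ be a fractional $\mathcal O_F$-ideal with $1\in\mathfrak a$ (an anti-integral ideal), let $\mathfrak a\hookrightarrow L$ be a split injective $\mathcal O_F$-homomorphism, let $e\in L$ be the image of $1$ and $P=\{\gamma\in\Gamma_L:\mathfrak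 a e\gamma=\mathfrak a e\}$. Put $$E_{\mathfrak a\hookrightarrow L}(z,s)=\sum_{\gamma\in P\backslash\Gamma_L}\mathrm{Det}(\gamma z)^s,\qquad \mathrm{Det}([g])=\prod_{\sigma\in S_F}\frac{|\det g_\sigma|^{n_\sigma}}{\|eg_\sigma\|^{nn_\sigma}};$$ this is a function on $\Gamma_L\backslash\mathfrak h_F^n$. *Zeta functions.* For an anti-integral ideal $\mathfrak b$ of $F$ let $\mathfrak A_{\mathfrak b}=\{x\in\mathfrak A\setminus\{0\}:Fx\cap\mathfrak A=\mathfrak bx\}$. For an ideal class $\mathscr A$ of $F$ put $$\zeta_{E/F,\mathscr A}(\mathfrak A^{-1},s)=N(\mathfrak A)^s\sum_{\substack{\mathfrak b\in\mathscr A\\ \text{anti-integral}}}\ \sum_{x\in\mathcal O_E^\times\backslash\mathfrak A_{\mathfrak b}}|N_{E/\mathbb Q}(x)|^{-s},$$ and let $\zeta_F(\mathfrak a^{-1},s)=\sum_{\mathfrak c}N(\mathfrak c)^{-s}$, the sum being over the nonzero integral ideals $\mathfrak c$ of $F$ in the ideal class of $\mathfrak a^{-1}$. **Theorem.** Let $\mathrm{Re}\,s>1$.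 The series $E_{\mathfrak a\hookrightarrow L}(z,s)$ (for every $z\in\mathfrak h_F^n$) and the series defining $\zeta_{E/F,[\mathfrak a]}(\mathfrak A^{-1},s)$ and $\zeta_F(\mathfrak a^{-1},ns)$ converge absolutely, $E_{\mathfrak a\hookrightarrow L}(\overline\varpi(t),s)$ is integrable over $T_{E/F}/U_{E/F}$, and $$\int_{T_{E/F}/U_{E/F}}E_{\mathfrak a\hookrightarrow L}(\overline\varpi(t),s)\,d^\times t_{E/F}=|\Delta_w|^{s/2}\,c_{E/F}(s)\sum_{x\in\mathcal O_E^\times\backslash\mathfrak A_{\mathfrak a}}\frac1{|N_{E/\mathbb Q}(x)|^s}.$$ Moreover $$\zeta_F(\mathfrak a^{-1},ns)\int_{T_{E/F}/U_{E/F}}E_{\mathfrak a\hookrightarrow L}(\overline\varpi(t),s)\,d^\times t_{E/F}=|\Delta_w|^{s/2}\,c_{E/F}(s)\,\frac{N(\mathfrak A)^{-s}}{N(\mathfrak a)^{-ns}}\,\zeta_{E/F,[\mathfrak a]}(\mathfrak A^{-1},s),$$ so that, whenever $\zeta_F(\mathfrak a^{-1},ns)\ne0$, $$\int_{T_{E/F}/U_{E/F}}E_{\mathfrak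 a\hookrightarrow L}(\overline\varpi(t),s)\,d^\times t_{E/F}=|\Delta_w|^{s/2}\,c_{E/F}(s)\,\frac{N(\mathfrak A)^{-s}}{N(\mathfrak a)^{-ns}}\,\frac{\zeta_{E/F,[\mathfrak a]}(\mathfrak A^{-1},s)}{\zeta_F(\mathfrak a^{-1},ns)}.$$ -/

import Mathlib

open NumberField MeasureTheory
open scoped nonZeroDivisors ENNReal Matrix

namespace RelHecke

set_option linter.unusedSectionVars false

noncomputable section

/-! ### The groups `T_k`, `T_{k'/k}` and their Haar measures -/

section Tori

variable (k k' : Type*) [Field k] [NumberField k] [Field k'] [NumberField k'] [Algebra k k']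

/-- The multiplicative group of positive real numbers. -/
abbrev PosReal : Type := {x : ℝ // 0 < x}

/-- `T_k = ∏_{σ} ℝ_{>0}`, the product over the archimedean places of `k`. -/
abbrev T : Type _ := InfinitePlace k → PosReal

variable {k} in
/-- The archimedean places of `k'` above the place `σ` of `k`. -/
abbrev Above (σ : InfinitePlace k) : Type _ :=
  {τ : InfinitePlace k' // τ.comap (algebraMap k k') = σ}

instance (σ : InfinitePlace k) : Fintype (Above k' σ) := Fintype.ofFinite _

variable {k'} in
/-- The local degree `n_{τ|σ} = [k'_τ : k_σ]`, where `σ` is the place of `k` below `τ`. -/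
def relDeg (τ : InfinitePlace k') : ℕ := (τ.comap (algebraMap k k')).inertiaDeg τ

/-- The norm homomorphism `T_{k'} → T_k`, `(t_τ)_τ ↦ (∏_{τ|σ} t_τ ^ n_{τ|σ})_σ`. -/
def normT : T k' →* T k where
  toFun t := fun σ => ∏ τ : Above k' σ, t τ.1 ^ relDeg k τ.1
  map_one' := by ext σ; simp
  map_mul' s t := by
    funext σ
    simp only [Pi.mul_apply, mul_pow, Finset.prod_mul_distrib]

/-- `T_{k'/k}`, the kernel of the norm `T_{k'} → T_k`. -/
abbrev TRel : Subgroup (T k') := (normT k k').ker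

/-- The measure `dt / t` on `ℝ_{>0}`. -/
def haarPos : Measure PosReal :=
  (volume.withDensity fun x : ℝ => ENNReal.ofReal x⁻¹).comap Subtype.val

/-- The Haar measure `d^× t_k` on `T_k`: the product over the places `σ` of `dt / t` for `σ` real
and of `dt² / t² = 2 dt / t` for `σ` complex. -/
def haarT : Measure (T k) := Measure.pi fun σ => (σ.mult : ℝ≥0∞) • haarPos

lemma sum_relDeg (σ : InfinitePlace k) :
    ∑ τ : Above k' σ, relDeg k τ.1 = Module.finrank k k' := by
  classical
  rw [← InfinitePlace.sum_inertiaDeg_eq_finrank k k' σ]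
  have key : ∀ τ : InfinitePlace k', τ ∈ (σ.placesOver k').toFinset ↔
      τ.comap (algebraMap k k') = σ := by
    intro τ
    rw [Set.mem_toFinset]
    constructor
    · intro h
      have h' : τ.LiesOver σ := h
      exact InfinitePlace.LiesOver.comap_eq τ σ
    · rintro rfl
      change τ.LiesOver _
      exact ⟨rfl⟩
  refine Finset.sum_bij' (fun τ _ => τ.1) (fun τ h => ⟨τ, (key τ).1 h⟩) ?_ ?_ ?_ ?_ ?_
  · rintro τ _
    exact (key _).2 τ.2
  · simp
  · simp
  · simp
  · rintro ⟨τ, rfl⟩ _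
    rfl

/-- The section `(u_σ)_σ ↦ (u_σ ^ (1 / [k' : k]))_τ` of the norm `T_{k'} → T_k`. -/
def rootT : T k →* T k' where
  toFun u := fun τ => ⟨(u (τ.comap (algebraMap k k')) : ℝ) ^ (Module.finrank k k' : ℝ)⁻¹,
    Real.rpow_pos_of_pos (u _).2 _⟩
  map_one' := by ext τ; simp
  map_mul' u v := by
    ext τ
    simpa using Real.mul_rpow (u _).2.le (v _).2.le

lemma normT_rootT (u : T k) : normT k k' (rootT k k' u) = u := by
  funext σ
  have h1 : ∀ τ : Above k' σ, rootT k k' u τ.1 =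
      (⟨(u σ : ℝ) ^ (Module.finrank k k' : ℝ)⁻¹, Real.rpow_pos_of_pos (u σ).2 _⟩ : PosReal) := by
    rintro ⟨τ, rfl⟩
    rfl
  change ∏ τ : Above k' σ, rootT k k' u τ.1 ^ relDeg k τ.1 = u σ
  rw [Finset.prod_congr rfl fun τ _ => by rw [h1 τ], Finset.prod_pow_eq_pow_sum,
    sum_relDeg]
  have : FiniteDimensional k k' := Module.Finite.of_restrictScalars_finite ℚ k k'
  ext
  exact Real.rpow_inv_natCast_pow (u σ).2.le (Module.finrank_pos.ne')

/-- The projection `T_{k'} → T_{k'/k}`, `t ↦ t / rootT (N t)`; together with the norm it gives an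
isomorphism `T_{k'} ≃ T_{k'/k} × T_k`. -/
def toTRel : T k' →* TRel k k' where
  toFun t := ⟨t * (rootT k k' (normT k k' t))⁻¹, by
    simp [MonoidHom.mem_ker, map_mul, map_inv, normT_rootT]⟩
  map_one' := by ext; simp
  map_mul' s t := by
    apply Subtype.ext
    simp only [map_mul, mul_inv, Subgroup.coe_mul]
    exact mul_mul_mul_comm _ _ _ _

/-- A set of finite non-zero volume in `T_k`. -/
def boxT : Set (T k) := {u | ∀ σ, (u σ : ℝ) ∈ Set.Icc 1 (Real.exp 1)}

/-- The Haar measure `d^× t_{k'/k}` on `T_{k'/k}`, normalized so that the induced measure on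
`T_{k'} / T_{k'/k} ≃ T_k` is `d^× t_k`, see `lintegral_haarTRel`. Because of the decomposition
`T_{k'} ≃ T_{k'/k} × T_k`, the volume of `A ⊆ T_{k'/k}` is
`vol {t ∈ T_{k'} | toTRel t ∈ A, N t ∈ B} / vol B` for any `B ⊆ T_k` of finite non-zero volume. -/
def haarTRel : Measure (TRel k k') :=
  (haarT k (boxT k))⁻¹ • ((haarT k').restrict (normT k k' ⁻¹' boxT k)).map (toTRel k k')

lemma haarPos_eq_map_exp :
    haarPos = (volume : Measure ℝ).map fun x => (⟨Real.exp x, Real.exp_pos x⟩ : PosReal) := by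
  have hm : Measurable fun x : ℝ => (⟨Real.exp x, Real.exp_pos x⟩ : PosReal) :=
    Real.measurable_exp.subtype_mk
  have he : MeasurableEmbedding (Subtype.val : PosReal → ℝ) :=
    MeasurableEmbedding.subtype_coe measurableSet_Ioi
  ext A hA
  rw [haarPos, he.comap_apply, withDensity_apply _ (he.measurableSet_image.2 hA),
    Measure.map_apply hm hA]
  have hS : MeasurableSet ((fun x : ℝ => (⟨Real.exp x, Real.exp_pos x⟩ : PosReal)) ⁻¹' A) := hm hA
  have hi : (Subtype.val '' A : Set ℝ) =
      Real.exp '' ((fun x : ℝ => (⟨Real.exp x, Real.exp_pos x⟩ : PosReal)) ⁻¹' A) := by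
    ext y
    constructor
    · rintro ⟨⟨y, hy⟩, h, rfl⟩
      refine ⟨Real.log y, ?_, Real.exp_log hy⟩
      simpa [Real.exp_log hy] using h
    · rintro ⟨x, h, rfl⟩
      exact ⟨_, h, rfl⟩
  rw [hi, lintegral_image_eq_lintegral_abs_deriv_mul hS
    (fun x _ => (Real.hasDerivAt_exp x).hasDerivWithinAt) Real.exp_injective.injOn]
  have : ∀ x : ℝ, ENNReal.ofReal |Real.exp x| * ENNReal.ofReal (Real.exp x)⁻¹ = 1 := by
    intro x
    rw [← ENNReal.ofReal_mul (abs_nonneg _), abs_of_pos (Real.exp_pos x),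
      mul_inv_cancel₀ (Real.exp_pos x).ne', ENNReal.ofReal_one]
  simp only [this, lintegral_one, Measure.restrict_apply_univ]

instance : MeasurableMul₂ PosReal where
  measurable_mul := by
    apply Measurable.subtype_mk
    fun_prop

instance : MeasurableInv PosReal where
  measurable_inv := by
    apply Measurable.subtype_mk
    fun_prop

/-- The exponential map as a measurable equivalence. -/
def expPos : ℝ ≃ᵐ PosReal where
  toFun x := ⟨Real.exp x, Real.exp_pos x⟩
  invFun y := Real.log y
  left_inv x := Real.log_exp x
  right_inv y := Subtype.ext (Real.exp_log y.2)
  measurable_toFun := Real.measurable_exp.subtype_mk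
  measurable_invFun := Real.measurable_log.comp measurable_subtype_coe

lemma haarPos_eq : haarPos = (volume : Measure ℝ).map expPos := haarPos_eq_map_exp

instance : SigmaFinite haarPos := by
  rw [haarPos_eq]
  exact expPos.sigmaFinite_map

instance : haarPos.IsMulLeftInvariant where
  map_mul_left_eq_self g := by
    obtain ⟨c, rfl⟩ := expPos.surjective g
    rw [haarPos_eq, Measure.map_map (measurable_const_mul _) expPos.measurable]
    have : (fun x => expPos c * x) ∘ expPos = expPos ∘ fun x => c + x := by
      funext x
      exact Subtype.ext (Real.exp_add c x).symm
    rw [this, ← Measure.map_map expPos.measurable (measurable_const_add c),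
      map_add_left_eq_self]

instance : haarPos.IsInvInvariant where
  inv_eq_self := by
    rw [Measure.inv, haarPos_eq, Measure.map_map measurable_inv expPos.measurable]
    have : Inv.inv ∘ expPos = expPos ∘ Neg.neg := by
      funext x
      exact Subtype.ext (Real.exp_neg x).symm
    rw [this, ← Measure.map_map expPos.measurable measurable_neg]
    congr 1
    exact Measure.map_neg_eq_self _

lemma haarPos_Icc : haarPos {x : PosReal | (x : ℝ) ∈ Set.Icc 1 (Real.exp 1)} = 1 := by
  rw [haarPos_eq, expPos.map_apply]
  have : expPos ⁻¹' {x : PosReal | (x : ℝ) ∈ Set.Icc 1 (Real.exp 1)} = Set.Icc 0 1 := by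
    ext x
    change (1 ≤ Real.exp x ∧ Real.exp x ≤ Real.exp 1) ↔ _
    simp [Real.one_le_exp_iff]
  rw [this]
  simp

instance (n : ℕ) : SigmaFinite ((n : ℝ≥0∞) • haarPos) := by
  have : ((n : ℝ≥0∞) • haarPos) = (n : NNReal) • haarPos := by
    ext A _
    simp [ENNReal.smul_def]
  rw [this]
  infer_instance

instance (n : ℕ) : ((n : ℝ≥0∞) • haarPos).IsInvInvariant where
  inv_eq_self := by
    rw [Measure.inv, Measure.map_smul]
    congr 1
    exact Measure.map_inv_eq_self _

instance : SigmaFinite (haarT k) := by unfold haarT; infer_instance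

instance : (haarT k).IsMulLeftInvariant := by unfold haarT; infer_instance

instance : (haarT k).IsInvInvariant := by unfold haarT; infer_instance

lemma haarT_boxT : haarT k (boxT k) = ∏ σ : InfinitePlace k, (σ.mult : ℝ≥0∞) := by
  have : boxT k = Set.pi Set.univ fun _ => {x : PosReal | (x : ℝ) ∈ Set.Icc 1 (Real.exp 1)} := by
    ext u
    simp [boxT]
  rw [this, haarT, Measure.pi_pi]
  simp only [Measure.smul_apply, haarPos_Icc, smul_eq_mul, mul_one]

lemma measurable_normT : Measurable (normT k k') := by
  rw [measurable_pi_iff]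
  intro σ
  change Measurable fun t : T k' => ∏ τ : Above k' σ, t τ.1 ^ relDeg k τ.1
  exact Finset.measurable_prod _ fun τ _ => (measurable_pi_apply _).pow_const _

lemma measurable_rootT : Measurable (rootT k k') := by
  rw [measurable_pi_iff]
  intro τ
  apply Measurable.subtype_mk
  exact (measurable_subtype_coe.comp (measurable_pi_apply _)).pow_const _

lemma measurable_toTRel : Measurable (toTRel k k') := by
  apply Measurable.subtype_mk
  exact measurable_id.mul ((measurable_rootT k k').comp (measurable_normT k k')).inv

/-- The normalization of the Haar measure on `T_{k'/k}`: integrating over `T_{k'}` amounts to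
integrating over the fibres `rootT u * T_{k'/k}` of the norm `T_{k'} → T_k` and then over `T_k`. -/
theorem lintegral_haarTRel (φ : T k' → ℝ≥0∞) (hφ : Measurable φ) :
    ∫⁻ t, φ t ∂haarT k' =
      ∫⁻ u, ∫⁻ t : TRel k k', φ (rootT k k' u * t) ∂haarTRel k k' ∂haarT k := by
  have hN := measurable_normT k k'
  have hr := measurable_rootT k k'
  have hp := measurable_toTRel k k'
  have hB : MeasurableSet (boxT k) := by
    have : boxT k = ⋂ σ, {u : T k | (u σ : ℝ) ∈ Set.Icc 1 (Real.exp 1)} := by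
      ext u
      simp [boxT]
    rw [this]
    exact MeasurableSet.iInter fun σ =>
      (measurable_subtype_coe.comp (measurable_pi_apply σ)) measurableSet_Icc
  have hB0 : haarT k (boxT k) ≠ 0 := by
    rw [haarT_boxT, Finset.prod_ne_zero_iff]
    intro σ _
    exact_mod_cast InfinitePlace.mult_ne_zero
  have hBt : haarT k (boxT k) ≠ ∞ := by
    rw [haarT_boxT]
    exact ENNReal.prod_ne_top fun σ _ => ENNReal.natCast_ne_top _
  set b : T k → ℝ≥0∞ := (boxT k).indicator 1 with hb
  have hbm : Measurable b := measurable_one.indicator hB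
  have hm1 : Measurable fun x : T k × T k' => b (normT k k' x.2) :=
    hbm.comp (hN.comp measurable_snd)
  have step1 : ∀ u, ∫⁻ t : TRel k k', φ (rootT k k' u * t) ∂haarTRel k k' =
      (haarT k (boxT k))⁻¹ *
        ∫⁻ t, b (normT k k' t) * φ (rootT k k' (u * (normT k k' t)⁻¹) * t) ∂haarT k' := by
    intro u
    have hφu : Measurable fun t : TRel k k' => φ (rootT k k' u * t) :=
      hφ.comp (measurable_subtype_coe.const_mul _)
    rw [haarTRel, lintegral_smul_measure, smul_eq_mul, lintegral_map hφu hp,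
      ← lintegral_indicator (hN hB)]
    congr 1
    refine lintegral_congr fun t => ?_
    by_cases h : normT k k' t ∈ boxT k
    · have : rootT k k' u * (toTRel k k' t : T k') =
          rootT k k' (u * (normT k k' t)⁻¹) * t := by
        rw [map_mul, map_inv]
        change _ * (t * (rootT k k' (normT k k' t))⁻¹) = _
        rw [mul_comm t, mul_assoc]
      rw [Set.indicator_of_mem (by exact h), hb, Set.indicator_of_mem h, this]
      simp
    · rw [Set.indicator_of_notMem (by exact h), hb, Set.indicator_of_notMem h]
      simp
  have step2 : ∀ t, ∫⁻ u, b (normT k k' t) * φ (rootT k k' (u * (normT k k' t)⁻¹) * t) ∂haarT k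
      = ∫⁻ u, b (normT k k' t) * φ (rootT k k' u * t) ∂haarT k := fun t =>
    lintegral_mul_right_eq_self (μ := haarT k)
      (fun u => b (normT k k' t) * φ (rootT k k' u * t)) _
  have step3 : ∀ u, ∫⁻ t, b (normT k k' t) * φ (rootT k k' u * t) ∂haarT k' =
      ∫⁻ t, b (u⁻¹ * normT k k' t) * φ t ∂haarT k' := by
    intro u
    rw [← lintegral_mul_left_eq_self (μ := haarT k')
      (fun t => b (u⁻¹ * normT k k' t) * φ t) (rootT k k' u)]
    refine lintegral_congr fun t => ?_
    rw [map_mul, normT_rootT, inv_mul_cancel_left]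
  have step4 : ∀ t, ∫⁻ u, b (u⁻¹ * normT k k' t) * φ t ∂haarT k = haarT k (boxT k) * φ t := by
    intro t
    rw [lintegral_mul_const _ (by fun_prop)]
    congr 1
    rw [lintegral_inv_eq_self (μ := haarT k) (fun u => b (u * normT k k' t)),
      lintegral_mul_right_eq_self (μ := haarT k) b, hb, lintegral_indicator_one hB]
  have hmul : Measurable fun x : T k × T k' => rootT k k' x.1 * x.2 :=
    (hr.comp measurable_fst).mul measurable_snd
  symm
  calc _ = ∫⁻ u, (haarT k (boxT k))⁻¹ * ∫⁻ t, b (normT k k' t) *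
        φ (rootT k k' (u * (normT k k' t)⁻¹) * t) ∂haarT k' ∂haarT k := by simp_rw [step1]
    _ = (haarT k (boxT k))⁻¹ * ∫⁻ u, ∫⁻ t, b (normT k k' t) *
        φ (rootT k k' (u * (normT k k' t)⁻¹) * t) ∂haarT k' ∂haarT k :=
      lintegral_const_mul' _ _ (ENNReal.inv_ne_top.2 hB0)
    _ = (haarT k (boxT k))⁻¹ * ∫⁻ t, ∫⁻ u, b (normT k k' t) *
        φ (rootT k k' (u * (normT k k' t)⁻¹) * t) ∂haarT k ∂haarT k' := by
      rw [lintegral_lintegral_swap]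
      refine (hm1.mul (hφ.comp ?_)).aemeasurable
      exact (hr.comp (measurable_fst.mul (hN.comp measurable_snd).inv)).mul measurable_snd
    _ = (haarT k (boxT k))⁻¹ * ∫⁻ t, ∫⁻ u, b (normT k k' t) *
        φ (rootT k k' u * t) ∂haarT k ∂haarT k' := by simp_rw [step2]
    _ = (haarT k (boxT k))⁻¹ * ∫⁻ u, ∫⁻ t, b (normT k k' t) *
        φ (rootT k k' u * t) ∂haarT k' ∂haarT k := by
      rw [lintegral_lintegral_swap]
      exact ((hm1.mul (hφ.comp hmul)).comp measurable_swap).aemeasurable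
    _ = (haarT k (boxT k))⁻¹ * ∫⁻ u, ∫⁻ t, b (u⁻¹ * normT k k' t) * φ t ∂haarT k' ∂haarT k := by
      simp_rw [step3]
    _ = (haarT k (boxT k))⁻¹ * ∫⁻ t, ∫⁻ u, b (u⁻¹ * normT k k' t) * φ t ∂haarT k ∂haarT k' := by
      rw [lintegral_lintegral_swap]
      refine Measurable.aemeasurable ?_
      exact (hbm.comp (measurable_fst.inv.mul (hN.comp measurable_snd))).mul
        (hφ.comp measurable_snd)
    _ = (haarT k (boxT k))⁻¹ * ∫⁻ t, haarT k (boxT k) * φ t ∂haarT k' := by simp_rw [step4]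
    _ = ∫⁻ t, φ t ∂haarT k' := by
      rw [lintegral_const_mul' _ _ hBt, ← mul_assoc, ENNReal.inv_mul_cancel hB0 hBt, one_mul]

end Tori

/-! ### Units, regulators and gamma factors -/

section Regulators

open Classical in
/-- The measure on `G ⧸ U` induced by an invariant measure `μ` on the commutative group `G`, for a
discrete subgroup `U`: the measure of a set is the `μ`-measure of the part lying above it of a
fundamental domain of `U` in `G`. -/
def quotMeasure {G : Type*} [CommGroup G] [MeasurableSpace G] (U : Subgroup G) (μ : Measure G) :
    Measure (G ⧸ U) :=
  if h : ∃ D : Set G, IsFundamentalDomain U D μ then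
    (μ.restrict h.choose).map (QuotientGroup.mk : G → G ⧸ U)
  else 0

variable (k k' : Type*) [Field k] [NumberField k] [Field k'] [NumberField k'] [Algebra k k']

/-- The multiplicative regulator map `𝓞_k^× → T_k`, `u ↦ (|σ(u)|)_σ`. -/
def regMap : (𝓞 k)ˣ →* T k where
  toFun u := fun σ => ⟨σ (u : k), InfinitePlace.pos_iff.2 (NumberField.Units.coe_ne_zero u)⟩
  map_one' := by ext σ; simp
  map_mul' u v := by ext σ; simp

/-- `𝓞_{k'/k}^×`, the units of `k'` of relative norm `1`. -/
def relUnits : Subgroup (𝓞 k')ˣ where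
  carrier := {u | Algebra.norm k (u : k') = 1}
  one_mem' := by simp
  mul_mem' {u v} hu hv := by
    simp only [Set.mem_ofPred_eq] at hu hv ⊢
    simp [hu, hv]
  inv_mem' {u} hu := by
    simp only [Set.mem_ofPred_eq] at hu ⊢
    have h : (u : k') * ((u⁻¹ : (𝓞 k')ˣ) : k') = 1 := by
      rw [← map_mul, Units.mul_inv, map_one]
    have h' := congrArg (Algebra.norm k) h
    rwa [map_mul, hu, one_mul, map_one] at h'

/-- `U_k`, the image of `𝓞_k^×` in `T_{k/ℚ}`. -/
def unitLattice : Subgroup (TRel ℚ k) := (regMap k).range.subgroupOf (TRel ℚ k)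

/-- `U_{k'/k}`, the image of `𝓞_{k'/k}^×` in `T_{k'/k}`. -/
def relUnitLattice : Subgroup (TRel k k') :=
  ((relUnits k k').map (regMap k')).subgroupOf (TRel k k')

/-- The regulator `R_k`, the volume of `T_{k/ℚ} / U_k`. -/
def regulator : ℝ := (quotMeasure (unitLattice k) (haarTRel ℚ k)).real Set.univ

/-- The relative regulator `R_{k'/k}`, the volume of `T_{k'/k} / U_{k'/k}`. -/
def relRegulator : ℝ := (quotMeasure (relUnitLattice k k') (haarTRel k k')).real Set.univ

/-- The relative gamma factor
`Γ_{k'/k}(s) = ∫_{T_{k'/k}} ∏_σ (∑_{τ|σ} t_τ²) ^ (-[k':k] n_σ s / 2) d^× t_{k'/k}`. -/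
def relGamma (s : ℂ) : ℂ :=
  ∫ t : TRel k k', ∏ σ : InfinitePlace k,
    ((∑ τ : Above k' σ, ((t : T k') τ.1 : ℝ) ^ 2 : ℝ) : ℂ) ^
      (-(Module.finrank k k' * σ.mult * s / 2)) ∂haarTRel k k'

/-- `c_{k'/k}(s)`, the factor of Hecke's integral formula built from the regulators, the numbers
of roots of unity and the gamma factors `Γ_{k'/ℚ}(s)` and `Γ_{k/ℚ}([k':k] s)`. -/
def heckeFactor (s : ℂ) : ℂ :=
  relRegulator k k' *
    ((NumberField.Units.torsionOrder k' * (regulator k' : ℂ)⁻¹ * relGamma ℚ k' s) /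
      (NumberField.Units.torsionOrder k * (regulator k : ℂ)⁻¹ *
        relGamma ℚ k (Module.finrank k k' * s)))

end Regulators

/-! ### Partial zeta functions -/

section Zeta

variable (k : Type*) [Field k] [NumberField k]

/-- The group of (non-zero) fractional ideals of `k`. -/
abbrev FracIdeal : Type _ := (FractionalIdeal (𝓞 k)⁰ k)ˣ

variable {k}

/-- The underlying `𝓞_k`-submodule of `k` of a fractional ideal. -/
def fracSub (𝔞 : FracIdeal k) : Submodule (𝓞 k) k :=
  ((𝔞 : FractionalIdeal (𝓞 k)⁰ k) : Submodule (𝓞 k) k)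

/-- A fractional ideal is anti-integral if it contains `1`. -/
def AntiIntegral (𝔞 : FracIdeal k) : Prop := (1 : k) ∈ fracSub 𝔞

/-- The absolute norm of a fractional ideal. -/
def fracNorm (𝔞 : FracIdeal k) : ℚ :=
  FractionalIdeal.absNorm (𝔞 : FractionalIdeal (𝓞 k)⁰ k)

/-- The non-zero integral ideals in an ideal class. -/
abbrev IntegralIdealsIn (C : ClassGroup (𝓞 k)) : Type _ :=
  {𝔟 : (Ideal (𝓞 k))⁰ // ClassGroup.mk0 𝔟 = C}

/-- The term `N(𝔟)^{-s}` of the partial zeta function. -/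
def zetaTerm {C : ClassGroup (𝓞 k)} (s : ℂ) (𝔟 : IntegralIdealsIn C) : ℂ :=
  (Ideal.absNorm (𝔟.1 : Ideal (𝓞 k)) : ℂ) ^ (-s)

/-- The partial zeta function `ζ_k(𝔞, s)`, the sum of `N(𝔟)^{-s}` over the integral ideals `𝔟` in
the ideal class of `𝔞`. -/
def partialZeta (𝔞 : FracIdeal k) (s : ℂ) : ℂ :=
  ∑' 𝔟 : IntegralIdealsIn (ClassGroup.mk k 𝔞), zetaTerm s 𝔟

/-- For an `𝓞_k`-submodule `M` of a `k`-vector space and a fractional ideal `𝔞`, the set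
`M_𝔞 = {x ∈ M ∖ {0} | k x ∩ M = 𝔞 x}`. -/
def idealPart {V : Type*} [AddCommGroup V] [Module k V] [Module (𝓞 k) V]
    (M : Submodule (𝓞 k) V) (𝔞 : FracIdeal k) : Set V :=
  {x | x ∈ M ∧ x ≠ 0 ∧ {y | (∃ c : k, y = c • x) ∧ y ∈ M} = {y | ∃ c ∈ fracSub 𝔞, y = c • x}}

variable (F : Type*) [Field F] [NumberField F] {E : Type*} [Field E] [NumberField E] [Algebra F E]

/-- A fractional ideal of `E`, regarded as an `𝓞_F`-module. -/
def fracRestrict (𝔄 : FracIdeal E) : Submodule (𝓞 F) E :=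
  (fracSub 𝔄).restrictScalars (𝓞 F)

variable {F}

/-- The set `𝔄_𝔞`, for fractional ideals `𝔄` of `E` and `𝔞` of `F`. -/
abbrev partOf (𝔄 : FracIdeal E) (𝔞 : FracIdeal F) : Set E := idealPart (fracRestrict F 𝔄) 𝔞

/-- Two elements of `𝔄_𝔞` are identified if they differ by a unit of `E`. -/
def unitSetoid (𝔄 : FracIdeal E) (𝔞 : FracIdeal F) : Setoid (partOf 𝔄 𝔞) where
  r x y := ∃ u : (𝓞 E)ˣ, (u : E) * x = y
  iseqv :=
    { refl := fun x => ⟨1, by simp⟩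
      symm := by
        rintro x y ⟨u, hu⟩
        refine ⟨u⁻¹, ?_⟩
        rw [← hu]
        simp
      trans := by
        rintro x y z ⟨u, hu⟩ ⟨v, hv⟩
        refine ⟨v * u, ?_⟩
        rw [← hv, ← hu]
        simp [mul_assoc] }

/-- The quotient `𝓞_E^× \ 𝔄_𝔞`. -/
abbrev UnitOrbits (𝔄 : FracIdeal E) (𝔞 : FracIdeal F) : Type _ := Quotient (unitSetoid 𝔄 𝔞)

lemma abs_norm_unit (u : (𝓞 E)ˣ) : |Algebra.norm ℚ (u : E)| = 1 := by
  simp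

/-- The term `|N_{E/ℚ}(x)|^{-s}` for `x ∈ 𝓞_E^× \ 𝔄_𝔞`. -/
def orbitTerm {𝔄 : FracIdeal E} {𝔞 : FracIdeal F} (s : ℂ) : UnitOrbits 𝔄 𝔞 → ℂ :=
  Quotient.lift (fun x => ((|Algebra.norm ℚ (x : E)| : ℚ) : ℂ) ^ (-s)) (by
    rintro x y ⟨u, hu⟩
    rw [← hu, map_mul, abs_mul, abs_norm_unit, one_mul])

/-- The anti-integral ideals in an ideal class of `F`. -/
abbrev AntiIntegralIn (C : ClassGroup (𝓞 F)) : Type _ :=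
  {𝔟 : FracIdeal F // ClassGroup.mk F 𝔟 = C ∧ AntiIntegral 𝔟}

/-- The relative partial zeta function `ζ_{E/F,C}(𝔄⁻¹, s)`: it is `N(𝔄)^s` times the sum over the
anti-integral ideals `𝔟` in `C` of the sum of `|N_{E/ℚ}(x)|^{-s}` over `x ∈ 𝓞_E^× \ 𝔄_𝔟`. -/
def relPartialZeta (C : ClassGroup (𝓞 F)) (𝔄 : FracIdeal E) (s : ℂ) : ℂ :=
  (fracNorm 𝔄 : ℂ) ^ s * ∑' 𝔟 : AntiIntegralIn C, ∑' x : UnitOrbits 𝔄 𝔟.1, orbitTerm s x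

end Zeta

/-! ### The generalized upper half space -/

section UpperHalfSpace

/-- The completion of a number field at the archimedean place of the embedding `φ`, realized as the
closure of the image of `φ` in `ℂ` (this is `ℝ` if `φ` is real and `ℂ` otherwise). -/
abbrev locField {F : Type*} [Field F] (φ : F →+* ℂ) : Subfield ℂ := φ.fieldRange.topologicalClosure

/-- The completion map `F → F_σ`. -/
def toLoc {F : Type*} [Field F] (φ : F →+* ℂ) : F →+* locField φ :=
  φ.codRestrict _ fun x => Subfield.le_topologicalClosure _ ⟨x, rfl⟩

variable {F : Type*} [Field F] (φ : InfinitePlace F → (F →+* ℂ)) (n : ℕ)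

/-- `G(ℝ) = ∏_σ GL_n(F_σ)`. -/
abbrev GInf : Type _ := ∀ σ : InfinitePlace F, GL (Fin n) (locField (φ σ))

/-- The embedding of `GL_n(F_σ)` in `GL_n(ℂ)`. -/
def toGLC (ψ : F →+* ℂ) : GL (Fin n) (locField ψ) →* GL (Fin n) ℂ :=
  Matrix.GeneralLinearGroup.map (locField ψ).subtype

/-- The maximal compact subgroup `K = ∏_σ K_σ`; here `K_σ = GL_n(F_σ) ∩ U(n)` is `O(n)` or `U(n)`
according as `σ` is real or complex. -/
def maxCompact : Subgroup (GInf φ n) :=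
  Subgroup.pi Set.univ fun σ => (unitarySubgroup (GL (Fin n) ℂ)).comap (toGLC n (φ σ))

/-- The subgroup `F_∞^×` of scalar matrices. -/
def scalars : Subgroup (GInf φ n) :=
  Subgroup.pi Set.univ fun _ => (Matrix.GeneralLinearGroup.scalar (Fin n)).range

/-- The generalized upper half space `𝔥_F^n = G(ℝ) / F_∞^× K`. -/
abbrev UpperSpace : Type _ := GInf φ n ⧸ (scalars φ n ⊔ maxCompact φ n)

variable {n}

/-- The embedding of `SL_n(F)` in `G(ℝ)`. -/
def toGInf : Matrix.SpecialLinearGroup (Fin n) F →* GInf φ n :=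
  MonoidHom.mk' (fun γ σ => Matrix.GeneralLinearGroup.map (toLoc (φ σ)) γ.toGL) fun a b => by
    funext σ
    simp

/-- The Euclidean norm of a vector in `F_σ^n ⊆ ℂ^n`. -/
def locNorm {ψ : F →+* ℂ} (x : Fin n → locField ψ) : ℝ :=
  ‖(WithLp.toLp 2 fun i => (x i : ℂ) : EuclideanSpace ℂ (Fin n))‖

variable [NumberField F]

/-- For `g ∈ G(ℝ)` and a row vector `e ∈ F^n`,
`∏_σ |det g_σ| ^ n_σ / ‖e g_σ‖ ^ (n n_σ)`. -/
def detFun (e : Fin n → F) (g : GInf φ n) : ℝ :=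
  ∏ σ : InfinitePlace F, ‖((g σ).1.det : ℂ)‖ ^ σ.mult /
    locNorm ((toLoc (φ σ) ∘ e) ᵥ* (g σ).1) ^ (n * σ.mult)

lemma locNorm_smul {ψ : F →+* ℂ} (c : locField ψ) (x : Fin n → locField ψ) :
    locNorm (c • x) = ‖(c : ℂ)‖ * locNorm x := by
  unfold locNorm
  rw [← norm_smul]
  rfl

lemma locNorm_eq_sqrt {ψ : F →+* ℂ} (x : Fin n → locField ψ) :
    (locNorm x : ℂ) ^ 2 = (fun i => (x i : ℂ)) ⬝ᵥ star (fun i => (x i : ℂ)) := by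
  have h := inner_self_eq_norm_sq_to_K (𝕜 := ℂ)
    (WithLp.toLp 2 fun i => (x i : ℂ) : EuclideanSpace ℂ (Fin n))
  rw [EuclideanSpace.inner_eq_star_dotProduct] at h
  exact h.symm

lemma coe_vecMul {ψ : F →+* ℂ} (x : Fin n → locField ψ) (g : GL (Fin n) (locField ψ)) :
    (fun i => ((x ᵥ* g.1) i : ℂ)) = (fun i => (x i : ℂ)) ᵥ* (toGLC n ψ g).1 := by
  funext i
  simp [Matrix.vecMul, dotProduct, toGLC]

lemma locNorm_vecMul_of_unitary {ψ : F →+* ℂ} (x : Fin n → locField ψ)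
    {g : GL (Fin n) (locField ψ)} (hg : toGLC n ψ g ∈ unitarySubgroup (GL (Fin n) ℂ)) :
    locNorm (x ᵥ* g.1) = locNorm x := by
  have h1 : (toGLC n ψ g).1 * star (toGLC n ψ g).1 = 1 := by
    have := Unitary.mul_star_self_of_mem (mem_unitarySubgroup_iff.1 hg)
    exact congrArg Units.val this
  have h2 : (locNorm (x ᵥ* g.1) : ℂ) ^ 2 = (locNorm x : ℂ) ^ 2 := by
    rw [locNorm_eq_sqrt, locNorm_eq_sqrt, coe_vecMul, Matrix.star_vecMul,
      ← Matrix.dotProduct_mulVec, Matrix.mulVec_mulVec, ← Matrix.star_eq_conjTranspose, h1,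
      Matrix.one_mulVec]
  have h3 : locNorm (x ᵥ* g.1) ^ 2 = locNorm x ^ 2 := by exact_mod_cast h2
  exact (pow_left_inj₀ (norm_nonneg _) (norm_nonneg _) two_ne_zero).1 h3

lemma norm_det_of_unitary {ψ : F →+* ℂ}
    {g : GL (Fin n) (locField ψ)} (hg : toGLC n ψ g ∈ unitarySubgroup (GL (Fin n) ℂ)) :
    ‖(g.1.det : ℂ)‖ = 1 := by
  have h1 : (toGLC n ψ g).1 * star (toGLC n ψ g).1 = 1 := by
    have := Unitary.mul_star_self_of_mem (mem_unitarySubgroup_iff.1 hg)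
    exact congrArg Units.val this
  have h2 : (g.1.det : ℂ) = (toGLC n ψ g).1.det :=
    RingHom.map_det (locField ψ).subtype g.1
  have h3 := congrArg Matrix.det h1
  rw [Matrix.det_mul, Matrix.star_eq_conjTranspose, Matrix.det_conjTranspose, Matrix.det_one] at h3
  rw [h2]
  have h4 := congrArg norm h3
  rw [norm_mul, norm_star, norm_one] at h4
  nlinarith [norm_nonneg (toGLC n ψ g).1.det]

lemma detFun_mul_maxCompact (e : Fin n → F) (g k : GInf φ n) (hk : k ∈ maxCompact φ n) :
    detFun φ e (g * k) = detFun φ e g := by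
  refine Finset.prod_congr rfl fun σ _ => ?_
  have hσ : toGLC n (φ σ) (k σ) ∈ unitarySubgroup (GL (Fin n) ℂ) := hk σ (Set.mem_univ σ)
  have h1 : ((g * k) σ).1 = (g σ).1 * (k σ).1 := rfl
  rw [h1, ← Matrix.vecMul_vecMul, locNorm_vecMul_of_unitary _ hσ, Matrix.det_mul]
  simp [norm_det_of_unitary hσ]

lemma detFun_mul_scalars (e : Fin n → F) (g c : GInf φ n) (hc : c ∈ scalars φ n) :
    detFun φ e (g * c) = detFun φ e g := by
  refine Finset.prod_congr rfl fun σ _ => ?_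
  obtain ⟨a, ha⟩ := hc σ (Set.mem_univ σ)
  have h1 : ((g * c) σ).1 = (g σ).1 * (c σ).1 := rfl
  have h2 : (c σ).1 = (a : locField (φ σ)) • (1 : Matrix (Fin n) (Fin n) _) := by
    rw [← ha, Matrix.GeneralLinearGroup.coe_scalar, Matrix.scalar_apply, Matrix.smul_one_eq_diagonal]
  have ha0 : ‖((a : locField (φ σ)) : ℂ)‖ ≠ 0 := by
    rw [norm_ne_zero_iff]
    exact_mod_cast a.ne_zero
  rw [h1, h2, Matrix.mul_smul, mul_one, Matrix.vecMul_smul, locNorm_smul, Matrix.det_smul]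
  have h3 : ((a ^ n : locField (φ σ)) : ℂ) = ((a : locField (φ σ)) : ℂ) ^ n := rfl
  simp only [Fintype.card_fin, Subfield.coe_mul, h3, norm_mul, norm_pow,
    mul_pow]
  rw [← pow_mul, mul_div_mul_left _ _ (pow_ne_zero _ ha0)]

/-- The function `Det` on the upper half space attached to `e ∈ F^n`. -/
def Det (e : Fin n → F) : UpperSpace φ n → ℝ :=
  Quotient.lift (detFun φ e) (by
    intro g h hgh
    have key : scalars φ n ⊔ maxCompact φ n ≤
        ({ carrier := {z | ∀ g, detFun φ e (g * z) = detFun φ e g}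
           one_mem' := by simp
           mul_mem' := by
            intro a b ha hb g
            rw [← mul_assoc, hb, ha]
           inv_mem' := by
            intro a ha g
            rw [← ha (g * a⁻¹), inv_mul_cancel_right] } : Subgroup (GInf φ n)) :=
      sup_le (fun c hc g => detFun_mul_scalars φ e g c hc)
        (fun k hk g => detFun_mul_maxCompact φ e g k hk)
    have := key (QuotientGroup.leftRel_apply.1 hgh) g
    rw [mul_inv_cancel_left] at this
    exact this.symm)

end UpperHalfSpace

/-! ### Eisenstein series -/

section Eisenstein

variable {F : Type*} [Field F] [NumberField F] {n : ℕ}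

/-- The right multiplication `x ↦ x γ` on row vectors. -/
def rightMul (γ : Matrix.SpecialLinearGroup (Fin n) F) : (Fin n → F) →ₗ[𝓞 F] (Fin n → F) :=
  (Matrix.vecMulLinear γ.1).restrictScalars (𝓞 F)

/-- The stabilizer `{γ ∈ SL_n(F) | M γ = M}` of an `𝓞_F`-submodule `M` of `F^n`. -/
def stab (M : Submodule (𝓞 F) (Fin n → F)) : Subgroup (Matrix.SpecialLinearGroup (Fin n) F) where
  carrier := {γ | M.map (rightMul γ) = M}
  one_mem' := by
    have : rightMul (1 : Matrix.SpecialLinearGroup (Fin n) F) = LinearMap.id := by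
      ext x
      simp [rightMul]
    simp [this]
  mul_mem' {γ δ} hγ hδ := by
    have : rightMul (γ * δ) = rightMul δ ∘ₗ rightMul γ := by
      apply LinearMap.ext
      intro x
      change x ᵥ* (γ * δ).1 = (x ᵥ* γ.1) ᵥ* δ.1
      rw [Matrix.vecMul_vecMul, Matrix.SpecialLinearGroup.coe_mul]
    simp only [Set.mem_ofPred_eq] at hγ hδ ⊢
    rw [this, Submodule.map_comp, hγ, hδ]
  inv_mem' {γ} hγ := by
    have : rightMul γ⁻¹ ∘ₗ rightMul γ = LinearMap.id := by
      apply LinearMap.ext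
      intro x
      change (x ᵥ* γ.1) ᵥ* (γ⁻¹).1 = x
      rw [Matrix.vecMul_vecMul, ← Matrix.SpecialLinearGroup.coe_mul, mul_inv_cancel,
        Matrix.SpecialLinearGroup.coe_one, Matrix.vecMul_one]
    simp only [Set.mem_ofPred_eq] at hγ ⊢
    conv_lhs => rw [← hγ]
    rw [← Submodule.map_comp, this, Submodule.map_id]

/-- A parabolic datum `𝔞 ↪ L`: an anti-integral ideal `𝔞` of `F` and a split injective
`𝓞_F`-homomorphism `𝔞 → L`. -/
structure ParabolicDatum (L : Submodule (𝓞 F) (Fin n → F)) where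
  /-- the ideal `𝔞` -/
  ideal : FracIdeal F
  one_mem : AntiIntegral ideal
  /-- the homomorphism `𝔞 → L` -/
  hom : fracSub ideal →ₗ[𝓞 F] L
  split : ∃ r : L →ₗ[𝓞 F] fracSub ideal, r ∘ₗ hom = LinearMap.id

namespace ParabolicDatum

variable {L : Submodule (𝓞 F) (Fin n → F)} (D : ParabolicDatum L)

/-- The image `e ∈ L` of `1 ∈ 𝔞`. -/
def e : Fin n → F := D.hom ⟨1, D.one_mem⟩

/-- The submodule `𝔞 e` of `F^n`. -/
def line : Submodule (𝓞 F) (Fin n → F) :=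
  (fracSub D.ideal).map ((LinearMap.toSpanSingleton F (Fin n → F) D.e).restrictScalars (𝓞 F))

/-- The parabolic subgroup `P = {γ ∈ Γ_L | 𝔞 e γ = 𝔞 e}` of `Γ_L`. -/
def parabolic : Subgroup (stab L) := (stab D.line).subgroupOf (stab L)

lemma mem_line {x : Fin n → F} : x ∈ D.line ↔ ∃ a ∈ fracSub D.ideal, a • D.e = x := by
  simp [line]

lemma e_ne_zero : D.e ≠ 0 := by
  intro h
  obtain ⟨r, hr⟩ := D.split
  have h1 : D.hom ⟨1, D.one_mem⟩ = 0 := Subtype.ext h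
  have h2 := LinearMap.congr_fun hr ⟨1, D.one_mem⟩
  rw [LinearMap.comp_apply, h1, map_zero] at h2
  exact one_ne_zero (congrArg Subtype.val h2).symm

lemma exists_unit (γ : Matrix.SpecialLinearGroup (Fin n) F) (hγ : γ ∈ stab D.line) :
    ∃ u : F, D.e ᵥ* γ.1 = u • D.e ∧ |Algebra.norm ℚ u| = 1 := by
  have hγ' : D.line.map (rightMul γ) = D.line := hγ
  have he : D.e ∈ D.line := D.mem_line.2 ⟨1, D.one_mem, one_smul _ _⟩
  have h1 : rightMul γ D.e ∈ D.line := by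
    rw [← hγ']
    exact Submodule.mem_map_of_mem he
  obtain ⟨u, hu, hue⟩ := D.mem_line.1 h1
  have hue' : D.e ᵥ* γ.1 = u • D.e := hue.symm
  refine ⟨u, hue', ?_⟩
  have hinj : ∀ a b : F, a • D.e = b • D.e → a = b := fun a b h => smul_left_injective F D.e_ne_zero h
  have hsm : ∀ a : F, rightMul γ (a • D.e) = (a * u) • D.e := by
    intro a
    change (a • D.e) ᵥ* γ.1 = _
    rw [Matrix.smul_vecMul, hue', smul_smul]
  -- multiplication by `u` maps the ideal onto itself
  have hid : FractionalIdeal.spanSingleton (𝓞 F)⁰ u * (D.ideal : FractionalIdeal (𝓞 F)⁰ F) =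
      D.ideal := by
    ext x
    rw [FractionalIdeal.mem_singleton_mul]
    constructor
    · rintro ⟨a, ha, rfl⟩
      have h2 : rightMul γ (a • D.e) ∈ D.line := by
        rw [← hγ']
        exact Submodule.mem_map_of_mem (D.mem_line.2 ⟨a, ha, rfl⟩)
      rw [hsm] at h2
      obtain ⟨b, hb, hbe⟩ := D.mem_line.1 h2
      rw [mul_comm, ← hinj _ _ hbe]
      exact hb
    · intro hx
      have h2 : x • D.e ∈ D.line.map (rightMul γ) := by
        rw [hγ']
        exact D.mem_line.2 ⟨x, hx, rfl⟩
      obtain ⟨y, hy, hyx⟩ := h2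
      obtain ⟨a, ha, rfl⟩ := D.mem_line.1 hy
      rw [hsm] at hyx
      exact ⟨a, ha, by rw [mul_comm]; exact (hinj _ _ hyx).symm⟩
  have h3 : FractionalIdeal.spanSingleton (𝓞 F)⁰ u = 1 := by
    have := congrArg (· * ((D.ideal⁻¹ : FracIdeal F) : FractionalIdeal (𝓞 F)⁰ F)) hid
    simpa [mul_assoc] using this
  have h4 := congrArg FractionalIdeal.absNorm h3
  rw [FractionalIdeal.absNorm_span_singleton, map_one] at h4
  exact h4

end ParabolicDatum

variable (φ : InfinitePlace F → (F →+* ℂ))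

lemma norm_toLoc {σ : InfinitePlace F} (hφ : InfinitePlace.mk (φ σ) = σ) (x : F) :
    ‖(toLoc (φ σ) x : ℂ)‖ = σ x := by
  conv_rhs => rw [← hφ]
  rfl

lemma detFun_parabolic (hφ : ∀ σ, InfinitePlace.mk (φ σ) = σ) {L : Submodule (𝓞 F) (Fin n → F)} (D : ParabolicDatum L)
    (γ : Matrix.SpecialLinearGroup (Fin n) F) (hγ : γ ∈ stab D.line) (g : GInf φ n) :
    detFun φ D.e (toGInf φ γ * g) = detFun φ D.e g := by
  obtain ⟨u, hu, hnu⟩ := D.exists_unit γ hγ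
  have hdet : ∀ σ, ((toGInf φ γ * g) σ).1.det = (g σ).1.det := by
    intro σ
    have h1 : ((toGInf φ γ * g) σ).1 = ((toLoc (φ σ)).mapMatrix γ.1) * (g σ).1 := rfl
    rw [h1, Matrix.det_mul, ← RingHom.map_det, γ.2, map_one, one_mul]
  have hvec : ∀ σ, (toLoc (φ σ) ∘ D.e) ᵥ* ((toGInf φ γ * g) σ).1 =
      toLoc (φ σ) u • ((toLoc (φ σ) ∘ D.e) ᵥ* (g σ).1) := by
    intro σ
    have h1 : ((toGInf φ γ * g) σ).1 = γ.1.map (toLoc (φ σ)) * (g σ).1 := rfl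
    have h2 : (toLoc (φ σ) ∘ D.e) ᵥ* γ.1.map (toLoc (φ σ)) = toLoc (φ σ) ∘ (D.e ᵥ* γ.1) := by
      funext i
      exact (RingHom.map_vecMul (toLoc (φ σ)) γ.1 D.e i).symm
    rw [h1, ← Matrix.vecMul_vecMul, h2, hu, ← Matrix.smul_vecMul]
    congr 1
    funext i
    simp
  unfold detFun
  simp_rw [hdet, hvec, locNorm_smul, norm_toLoc φ (hφ _)]
  rw [Finset.prod_div_distrib, Finset.prod_div_distrib]
  congr 1
  simp_rw [mul_pow]
  rw [Finset.prod_mul_distrib]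
  have : ∏ σ : InfinitePlace F, σ u ^ (n * σ.mult) = 1 := by
    simp_rw [mul_comm n, pow_mul]
    rw [Finset.prod_pow, InfinitePlace.prod_eq_abs_norm, hnu]
    simp
  rw [this, one_mul]

variable (hφ : ∀ σ, InfinitePlace.mk (φ σ) = σ)

/-- The term `Det(γ z)^s` of the Eisenstein series, for `γ ∈ P \ Γ_L`. -/
def eisTerm {L : Submodule (𝓞 F) (Fin n → F)} (D : ParabolicDatum L) (z : UpperSpace φ n) (s : ℂ) :
    Quotient (QuotientGroup.rightRel D.parabolic) → ℂ :=
  Quotient.lift (fun γ => (Det φ D.e (toGInf φ γ.1 • z) : ℂ) ^ s) (by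
    intro γ δ h
    have h' : δ * γ⁻¹ ∈ D.parabolic := QuotientGroup.rightRel_apply.1 h
    have h2 : (δ : Matrix.SpecialLinearGroup (Fin n) F) =
        ((δ * γ⁻¹ : stab L) : Matrix.SpecialLinearGroup (Fin n) F) * γ := by simp
    have h3 : Det φ D.e (toGInf φ δ.1 • z) = Det φ D.e (toGInf φ γ.1 • z) := by
      rw [h2, map_mul, mul_smul]
      generalize toGInf φ γ.1 • z = y
      induction y using QuotientGroup.induction_on with
      | H g => exact detFun_parabolic φ hφ D _ (Subgroup.mem_subgroupOf.1 h') g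
    rw [h3])

/-- The Eisenstein series `E_{𝔞 ↪ L}(z, s) = ∑_{γ ∈ P \ Γ_L} Det(γ z)^s`. -/
def eis {L : Submodule (𝓞 F) (Fin n → F)} (D : ParabolicDatum L) (z : UpperSpace φ n) (s : ℂ) : ℂ :=
  ∑' γ, eisTerm φ hφ D z s γ

lemma eis_smul {L : Submodule (𝓞 F) (Fin n → F)} (D : ParabolicDatum L)
    (γ : stab L) (z : UpperSpace φ n) (s : ℂ) :
    eis φ hφ D (toGInf φ γ.1 • z) s = eis φ hφ D z s := by
  have hr : ∀ δ a b : stab L, QuotientGroup.rightRel D.parabolic a b ↔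
      QuotientGroup.rightRel D.parabolic (a * δ) (b * δ) := by
    intro δ a b
    rw [QuotientGroup.rightRel_apply, QuotientGroup.rightRel_apply]
    simp
  refine (Equiv.tsum_eq (Quotient.congr (Equiv.mulRight γ) (hr γ)) (eisTerm φ hφ D z s)).symm.trans
    ?_ |>.symm
  refine tsum_congr fun q => ?_
  induction q using Quotient.inductionOn with
  | h δ =>
    change (Det φ D.e (toGInf φ (δ * γ).1 • z) : ℂ) ^ s = (Det φ D.e (toGInf φ δ.1 • _) : ℂ) ^ s
    rw [Subgroup.coe_mul, map_mul, mul_smul]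

/-- The group `Γ_L` as a subgroup of `G(ℝ)`. -/
def arithGroup (L : Submodule (𝓞 F) (Fin n → F)) : Subgroup (GInf φ n) :=
  (stab L).map (toGInf φ)

/-- The quotient `Γ_L \ 𝔥_F^n`. -/
abbrev ModSpace (L : Submodule (𝓞 F) (Fin n → F)) : Type _ :=
  MulAction.orbitRel.Quotient (arithGroup φ L) (UpperSpace φ n)

/-- The Eisenstein series as a function on `Γ_L \ 𝔥_F^n`. -/
def eisMod {L : Submodule (𝓞 F) (Fin n → F)} (D : ParabolicDatum L) (z : ModSpace φ L) (s : ℂ) : ℂ :=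
  Quotient.lift (fun z => eis φ hφ D z s) (by
    rintro _ z ⟨⟨_, γ, hγ, rfl⟩, rfl⟩
    exact eis_smul φ hφ D ⟨γ, hγ⟩ z s) z

end Eisenstein

/-! ### Heegner objects -/

section Heegner

variable (F E : Type*) [Field F] [NumberField F] [Field E] [NumberField E] [Algebra F E] (n : ℕ)

/-- The choices that enter the definition of the Heegner object of an extension `E/F` of degree
`n`: embeddings `F_σ ⊆ E_τ ⊆ ℂ` for all places `τ | σ`, and an ordering of the factors of
`∏_{τ|σ} F_σ^{n_{τ|σ}} ≃ F_σ^n` for all places `σ` of `F`. -/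
structure Frame where
  embF : InfinitePlace F → (F →+* ℂ)
  mk_embF : ∀ σ, InfinitePlace.mk (embF σ) = σ
  embE : InfinitePlace E → (E →+* ℂ)
  mk_embE : ∀ τ, InfinitePlace.mk (embE τ) = τ
  compat : ∀ τ, (embE τ).comp (algebraMap F E) = embF (τ.comap (algebraMap F E))
  index : ∀ σ : InfinitePlace F, (Σ τ : Above E σ, Fin (relDeg F τ.1)) ≃ Fin n

variable {F E n}

lemma mult_mul_relDeg (τ : InfinitePlace E) :
    (τ.comap (algebraMap F E)).mult * relDeg F τ = τ.mult := by
  have : τ.LiesOver (τ.comap (algebraMap F E)) := ⟨rfl⟩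
  have h := InfinitePlace.mult_mul_finrank (τ.comap (algebraMap F E)) τ
  rwa [← InfinitePlace.inertiaDeg_eq_finrank] at h

namespace Frame

variable (fr : Frame F E n)

lemma compat' {σ : InfinitePlace F} (τ : Above E σ) (x : F) :
    fr.embE τ.1 (algebraMap F E x) = fr.embF σ x := by
  obtain ⟨τ, rfl⟩ := τ
  exact RingHom.congr_fun (fr.compat τ) x

lemma ofReal_mem (ψ : F →+* ℂ) (r : ℝ) : (r : ℂ) ∈ locField ψ := by
  have h : r ∈ closure (Set.range ((↑) : ℚ → ℝ)) := Rat.denseRange_cast r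
  refine map_mem_closure (t := (ψ.fieldRange : Set ℂ)) Complex.continuous_ofReal h ?_
  rintro _ ⟨q, rfl⟩
  exact ⟨(q : F), by simp⟩

lemma locField_real {σ : InfinitePlace F} (h : σ.IsReal) (x : locField (fr.embF σ)) :
    ((x : ℂ)).im = 0 := by
  have hr : ComplexEmbedding.IsReal (fr.embF σ) :=
    InfinitePlace.isReal_of_mk_isReal (by rwa [fr.mk_embF])
  have hc : IsClosed {z : ℂ | z.im = 0} := isClosed_eq Complex.continuous_im continuous_const
  refine closure_minimal (s := ((fr.embF σ).fieldRange : Set ℂ)) ?_ hc x.2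
  rintro _ ⟨y, rfl⟩
  exact Complex.conj_eq_iff_im.1 (RingHom.congr_fun hr y)

lemma locField_complex {σ : InfinitePlace F} (h : σ.IsComplex) (z : ℂ) :
    z ∈ locField (fr.embF σ) := by
  rcases Complex.subfield_eq_of_closed
    (Subfield.isClosed_topologicalClosure (fr.embF σ).fieldRange) with h' | h'
  · exfalso
    have hr : ComplexEmbedding.IsReal (fr.embF σ) := by
      ext y
      have hy : fr.embF σ y ∈ locField (fr.embF σ) :=
        Subfield.le_topologicalClosure _ ⟨y, rfl⟩
      rw [locField, h'] at hy
      obtain ⟨r, hr⟩ := hy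
      change (starRingEnd ℂ) (fr.embF σ y) = fr.embF σ y
      rw [← hr]
      exact Complex.conj_ofReal r
    have h2 : (InfinitePlace.mk (fr.embF σ)).IsReal := InfinitePlace.isReal_mk_iff.2 hr
    rw [fr.mk_embF] at h2
    exact InfinitePlace.not_isReal_iff_isComplex.2 h h2
  · rw [locField, h']
    trivial

lemma relDeg_cases {σ : InfinitePlace F} (τ : Above E σ) :
    (relDeg F τ.1 = 1 ∧ (σ.IsReal → τ.1.IsReal)) ∨ (relDeg F τ.1 = 2 ∧ σ.IsReal) := by
  obtain ⟨τ, rfl⟩ := τ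
  have h := mult_mul_relDeg (F := F) τ
  simp only
  rcases (τ.comap (algebraMap F E)).isReal_or_isComplex with h1 | h1 <;>
    rcases τ.isReal_or_isComplex with h2 | h2
  · rw [h1.mult_eq_one, h2.mult_eq_one, one_mul] at h
    exact Or.inl ⟨h, fun _ => h2⟩
  · rw [h1.mult_eq_one, h2.mult_eq_two, one_mul] at h
    exact Or.inr ⟨h, h1⟩
  · exact absurd (h2.comap (algebraMap F E)) (InfinitePlace.not_isReal_iff_isComplex.2 h1)
  · rw [h1.mult_eq_two, h2.mult_eq_two] at h
    exact Or.inl ⟨by omega, fun h3 => absurd h3 (InfinitePlace.not_isReal_iff_isComplex.2 h1)⟩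

/-- The coordinate at the index `(τ, j)` of the isomorphism `E_τ ≃ F_σ^{n_{τ|σ}}`: it is the
identity if `n_{τ|σ} = 1` and `ℂ ≃ ℝ²`, `x + iy ↦ (y, x)`, if `n_{τ|σ} = 2`. -/
def coord {σ : InfinitePlace F} (p : Σ τ : Above E σ, Fin (relDeg F τ.1)) (z : ℂ) : ℂ :=
  if relDeg F p.1.1 = 1 then z else if p.2.1 = 0 then z.im else z.re

lemma coord_mem {σ : InfinitePlace F} (p : Σ τ : Above E σ, Fin (relDeg F τ.1)) (x : E) :
    coord p (fr.embE p.1.1 x) ∈ locField (fr.embF σ) := by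
  unfold coord
  split_ifs with h1
  · rcases σ.isReal_or_isComplex with hσ | hσ
    · have hτ : p.1.1.IsReal := by
        rcases relDeg_cases p.1 with h | h
        · exact h.2 hσ
        · omega
      have hr : ComplexEmbedding.IsReal (fr.embE p.1.1) :=
        InfinitePlace.isReal_of_mk_isReal (by rwa [fr.mk_embE])
      rw [← Complex.conj_eq_iff_re.1 (RingHom.congr_fun hr x)]
      exact ofReal_mem _ _
    · exact fr.locField_complex hσ _
  · exact ofReal_mem _ _
  · exact ofReal_mem _ _

/-- The coordinates are `F_σ`-linear. -/
lemma coord_sum {σ : InfinitePlace F} (p : Σ τ : Above E σ, Fin (relDeg F τ.1))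
    (c : Fin n → locField (fr.embF σ)) (z : Fin n → ℂ) :
    coord p (∑ i, (c i : ℂ) * z i) = ∑ i, (c i : ℂ) * coord p (z i) := by
  unfold coord
  rcases relDeg_cases p.1 with h | h
  · simp [h.1]
  · have hc : ∀ i, (c i : ℂ).im = 0 := fun i => fr.locField_real h.2 (c i)
    rw [if_neg (by omega)]
    simp_rw [if_neg (show ¬ relDeg F p.1.1 = 1 by omega)]
    split_ifs
    · apply Complex.ext <;> simp [Complex.re_sum, Complex.im_sum, Complex.mul_im, Complex.mul_re, hc]
    · apply Complex.ext <;> simp [Complex.re_sum, Complex.im_sum, Complex.mul_im, Complex.mul_re, hc]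

lemma eq_zero_of_coord {σ : InfinitePlace F} (τ : Above E σ) (z : ℂ)
    (h : ∀ j : Fin (relDeg F τ.1), coord ⟨τ, j⟩ z = 0) : z = 0 := by
  unfold coord at h
  rcases relDeg_cases τ with h1 | h1
  · have := h ⟨0, by omega⟩
    simpa [h1.1] using this
  · have h2 := h ⟨0, by omega⟩
    have h3 := h ⟨1, by omega⟩
    simp only [h1.1] at h2 h3
    norm_num at h2 h3
    exact Complex.ext h3 h2

/-- The coordinates of `a z` and `a z'` have the same Hermitian product as those of `z` and `z'`,
up to the factor `|a|²`. -/
lemma sum_coord_mul {σ : InfinitePlace F} (τ : Above E σ) (a z z' : ℂ) :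
    ∑ j : Fin (relDeg F τ.1), coord ⟨τ, j⟩ (a * z) * star (coord ⟨τ, j⟩ (a * z')) =
      (‖a‖ ^ 2 : ℝ) * ∑ j : Fin (relDeg F τ.1), coord ⟨τ, j⟩ z * star (coord ⟨τ, j⟩ z') := by
  have ha : ((‖a‖ ^ 2 : ℝ) : ℂ) = a * star a := by
    rw [Complex.star_def, Complex.mul_conj, Complex.normSq_eq_norm_sq]
  unfold coord
  rcases relDeg_cases τ with h1 | h1
  · simp only [h1.1, if_true, Finset.sum_const, Finset.card_univ, Fintype.card_fin, one_smul, ha,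
      star_mul']
    ring
  · simp only [h1.1, OfNat.ofNat_ne_one, if_false]
    have hs : ∀ f : ℕ → ℂ, ∑ j : Fin (relDeg F τ.1), f j = f 0 + f 1 := by
      intro f
      rw [Fin.sum_univ_eq_sum_range f, h1.1, Finset.sum_range_succ, Finset.sum_range_one]
    rw [hs fun j => (if j = 0 then ((a * z).im : ℂ) else ((a * z).re : ℂ)) *
        star (if j = 0 then ((a * z').im : ℂ) else ((a * z').re : ℂ)),
      hs fun j => (if j = 0 then (z.im : ℂ) else (z.re : ℂ)) *
        star (if j = 0 then (z'.im : ℂ) else (z'.re : ℂ)), ← Complex.normSq_eq_norm_sq,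
        Complex.normSq_apply]
    simp only [if_true, one_ne_zero, if_false, Complex.star_def, Complex.conj_ofReal,
      Complex.mul_im, Complex.mul_re]
    push_cast
    ring

/-- The matrix `W_σ`, whose `i`-th row is the image of `w_i` under
`E → ∏_{τ|σ} E_τ ≃ F_σ^n`. -/
def heegMatrix (w : Module.Basis (Fin n) F E) (σ : InfinitePlace F) :
    Matrix (Fin n) (Fin n) (locField (fr.embF σ)) :=
  Matrix.of fun i j => ⟨coord ((fr.index σ).symm j) (fr.embE ((fr.index σ).symm j).1.1 (w i)),
    fr.coord_mem _ _⟩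

lemma det_heegMatrix_ne_zero (w : Module.Basis (Fin n) F E) (σ : InfinitePlace F) :
    (fr.heegMatrix w σ).det ≠ 0 := by
  intro hdet
  obtain ⟨v, hv0, hv⟩ := Matrix.exists_vecMul_eq_zero_iff.2 hdet
  apply hv0
  -- the linear form vanishes at all places above `σ`
  have h1 : ∀ τ : Above E σ, ∑ i, (v i : ℂ) * fr.embE τ.1 (w i) = 0 := by
    intro τ
    refine eq_zero_of_coord τ _ fun j => ?_
    have h := congrArg Subtype.val (congrFun hv (fr.index σ ⟨τ, j⟩))
    rw [coord_sum]
    simpa [Matrix.vecMul, dotProduct, heegMatrix] using h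
  -- hence for all embeddings of `E` that extend the one of `F`
  have h2 : ∀ ψ : E →+* ℂ, ψ.comp (algebraMap F E) = fr.embF σ →
      ∑ i, (v i : ℂ) * ψ (w i) = 0 := by
    intro ψ hψ
    have hσ : (InfinitePlace.mk ψ).comap (algebraMap F E) = σ := by
      rw [InfinitePlace.comap_mk, hψ, fr.mk_embF]
    have h3 := h1 ⟨_, hσ⟩
    rcases InfinitePlace.mk_eq_iff.1 (fr.mk_embE (InfinitePlace.mk ψ)) with h | h
    · simpa only [h] using h3
    · have hE : ∀ x, ψ x = star (fr.embE (InfinitePlace.mk ψ) x) := fun x =>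
        (RingHom.congr_fun h x).symm
      have hreal : σ.IsReal := by
        rw [← fr.mk_embF σ, InfinitePlace.isReal_mk_iff]
        ext y
        have h4 := fr.compat' (σ := σ) ⟨_, hσ⟩ y
        have h5 : ψ (algebraMap F E y) = fr.embF σ y := RingHom.congr_fun hψ y
        change star (fr.embF σ y) = fr.embF σ y
        rw [← h4, ← hE, h5, ← h4]
      have hc : ∀ i, star (v i : ℂ) = v i := fun i =>
        Complex.conj_eq_iff_im.2 (fr.locField_real hreal (v i))
      have h4 := congrArg star h3
      simpa only [star_sum, star_mul', hc, ← hE, star_zero] using h4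
  let alg : Algebra F ℂ := (fr.embF σ).toAlgebra
  have hcard : Fintype.card (Fin n) = Fintype.card (E →ₐ[F] ℂ) := by
    rw [AlgHom.card, Module.finrank_eq_card_basis w]
  let eq := Fintype.equivOfCardEq hcard
  have hM : (Algebra.embeddingsMatrixReindex F ℂ w eq).det ≠ 0 := by
    intro h0
    have h := Algebra.discr_eq_det_embeddingsMatrixReindex_pow_two F ℂ w eq
    rw [h0, zero_pow two_ne_zero, map_eq_zero] at h
    exact Algebra.discr_not_zero_of_basis F w h
  have h6 : (fun i => (v i : ℂ)) = 0 := by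
    refine Matrix.eq_zero_of_vecMul_eq_zero hM ?_
    funext j
    have := h2 (eq j : E →+* ℂ) (by
      ext y
      exact (eq j).commutes y)
    simpa [Matrix.vecMul, dotProduct, Algebra.embeddingsMatrixReindex,
      Algebra.embeddingsMatrix] using this
  funext i
  exact Subtype.ext (congrFun h6 i)

/-- Such choices exist for every extension `E/F` of number fields of degree `n`. -/
theorem nonempty (hn : Module.finrank F E = n) : Nonempty (Frame F E n) := by
  classical
  have hE : ∀ τ : InfinitePlace E, ∃ ψ : E →+* ℂ, InfinitePlace.mk ψ = τ ∧
      ψ.comp (algebraMap F E) = (τ.comap (algebraMap F E)).embedding := by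
    intro τ
    have : τ.LiesOver (τ.comap (algebraMap F E)) := ⟨rfl⟩
    rcases InfinitePlace.LiesOver.embedding_comp_eq_or_conjugate_embedding_comp_eq τ
      (τ.comap (algebraMap F E)) with h | h
    · exact ⟨_, InfinitePlace.mk_embedding τ, h⟩
    · exact ⟨_, by rw [InfinitePlace.mk_conjugate_eq, InfinitePlace.mk_embedding], h⟩
  choose ψ hψ hψ' using hE
  refine ⟨⟨fun σ => σ.embedding, InfinitePlace.mk_embedding, ψ, hψ, hψ',
    fun σ => Fintype.equivFinOfCardEq ?_⟩⟩
  rw [Fintype.card_sigma]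
  simp only [Fintype.card_fin]
  rw [sum_relDeg, hn]

/-- The element `W` of `G(ℝ)`. -/
def W (w : Module.Basis (Fin n) F E) : GInf fr.embF n := fun σ =>
  Matrix.GeneralLinearGroup.mkOfDetNeZero _ (fr.det_heegMatrix_ne_zero w σ)

/-- The element `I(t)` of `G(ℝ)` for `t ∈ T_{E/F}`: it acts on `F_∞^n ≃ E_∞` as the componentwise
multiplication by `t`. -/
def I (t : TRel F E) : GInf fr.embF n := fun σ =>
  Matrix.GeneralLinearGroup.mkOfDetNeZero
    (Matrix.diagonal fun j => (⟨(((t : T E) ((fr.index σ).symm j).1.1 : ℝ) : ℂ),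
      ofReal_mem _ _⟩ : locField (fr.embF σ)))
    (by
      rw [Matrix.det_diagonal, Finset.prod_ne_zero_iff]
      intro j _ h
      have h' := congrArg Subtype.val h
      exact ((t : T E) ((fr.index σ).symm j).1.1).2.ne' (Complex.ofReal_eq_zero.1 h'))

/-- The Heegner object `ϖ_w : T_{E/F} → 𝔥_F^n`, `t ↦ [W I(t)]`. -/
def heegner (w : Module.Basis (Fin n) F E) (t : TRel F E) : UpperSpace fr.embF n :=
  ((fr.W w * fr.I t : GInf fr.embF n) : UpperSpace fr.embF n)

end Frame

/-- The lattice `L ⊆ F^n` corresponding to the fractional ideal `𝔄` of `E` under the isomorphism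
`F^n ≃ E`, `x ↦ ∑ x_i w_i`. -/
def latticeOf (w : Module.Basis (Fin n) F E) (𝔄 : FracIdeal E) : Submodule (𝓞 F) (Fin n → F) :=
  (fracRestrict F 𝔄).comap (w.equivFun.symm.toLinearMap.restrictScalars (𝓞 F))

/-- The matrix of the multiplication by a unit `u` of relative norm `1`, acting on row vectors. -/
def regRep (w : Module.Basis (Fin n) F E) (u : E) (hu : Algebra.norm F u = 1) :
    Matrix.SpecialLinearGroup (Fin n) F :=
  ⟨(Algebra.leftMulMatrix w u)ᵀ, by
    rw [Matrix.det_transpose, ← Algebra.norm_eq_matrix_det w, hu]⟩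

lemma regRep_apply (w : Module.Basis (Fin n) F E) (u : E) (hu : Algebra.norm F u = 1)
    (x : Fin n → F) :
    w.equivFun.symm (x ᵥ* (regRep w u hu).1) = u * w.equivFun.symm x := by
  change w.equivFun.symm (x ᵥ* (Algebra.leftMulMatrix w u)ᵀ) = _
  have h := Algebra.leftMulMatrix_mulVec_repr w u (w.equivFun.symm x)
  rw [Matrix.vecMul_transpose, LinearEquiv.symm_apply_eq]
  rw [← Module.Basis.equivFun_apply, LinearEquiv.apply_symm_apply] at h
  rw [h]
  rfl

lemma sum_regRep (w : Module.Basis (Fin n) F E) (u : E) (hu : Algebra.norm F u = 1) (i : Fin n) :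
    ∑ k, algebraMap F E ((regRep w u hu).1 i k) * w k = u * w i := by
  have h := regRep_apply w u hu (Pi.single i 1)
  rw [Matrix.single_one_vecMul, Module.Basis.equivFun_symm_apply,
    Module.Basis.equivFun_symm_apply] at h
  simpa [Algebra.smul_def, Pi.single_apply] using h

lemma regRep_mem_stab (w : Module.Basis (Fin n) F E) (𝔄 : FracIdeal E) (u : (𝓞 E)ˣ)
    (hu : Algebra.norm F (u : E) = 1) :
    regRep w (u : E) hu ∈ stab (latticeOf w 𝔄) := by
  have hmem : ∀ x, x ∈ latticeOf w 𝔄 ↔ w.equivFun.symm x ∈ fracSub 𝔄 := fun x => Iff.rfl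
  change (latticeOf w 𝔄).map (rightMul (regRep w (u : E) hu)) = latticeOf w 𝔄
  ext y
  rw [Submodule.mem_map]
  constructor
  · rintro ⟨x, hx, rfl⟩
    rw [hmem] at hx ⊢
    change w.equivFun.symm (x ᵥ* (regRep w (u : E) hu).1) ∈ _
    rw [regRep_apply]
    exact (fracSub 𝔄).smul_mem (u : 𝓞 E) hx
  · intro hy
    refine ⟨w.equivFun (((u⁻¹ : (𝓞 E)ˣ) : E) * w.equivFun.symm y), ?_, ?_⟩
    · rw [hmem, LinearEquiv.symm_apply_apply]
      exact (fracSub 𝔄).smul_mem ((u⁻¹ : (𝓞 E)ˣ) : 𝓞 E) hy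
    · apply w.equivFun.symm.injective
      change w.equivFun.symm (_ ᵥ* (regRep w (u : E) hu).1) = _
      rw [regRep_apply, LinearEquiv.symm_apply_apply, ← mul_assoc, ← map_mul, Units.mul_inv,
        map_one, one_mul]

lemma mk_eq_of_gram (φ : InfinitePlace F → (F →+* ℂ)) (a b : GInf φ n)
    (h : ∀ σ, (toGLC n (φ σ) (a σ)).1 * star (toGLC n (φ σ) (a σ)).1 =
      (toGLC n (φ σ) (b σ)).1 * star (toGLC n (φ σ) (b σ)).1) :
    (a : UpperSpace φ n) = b := by
  rw [QuotientGroup.eq]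
  refine (le_sup_right : maxCompact φ n ≤ scalars φ n ⊔ maxCompact φ n) fun σ _ => ?_
  change toGLC n (φ σ) ((a σ)⁻¹ * b σ) ∈ unitarySubgroup _
  set A := toGLC n (φ σ) (a σ)
  set B := toGLC n (φ σ) (b σ)
  have h1 : A * star A = B * star B := Units.ext (h σ)
  have h2 : (A⁻¹ * B) * star (A⁻¹ * B) = 1 := by
    have : (A⁻¹ * B) * star (A⁻¹ * B) = A⁻¹ * (B * star B) * star A⁻¹ := by
      rw [star_mul]
      group
    rw [this, ← h1]
    have : A⁻¹ * (A * star A) * star A⁻¹ = star A * star A⁻¹ := by group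
    rw [this, ← star_mul, inv_mul_cancel, star_one]
  rw [map_mul, map_inv, mem_unitarySubgroup_iff, Unitary.mem_iff]
  exact ⟨mul_eq_one_comm.1 h2, h2⟩

lemma Frame.entry_W_I (fr : Frame F E n) (w : Module.Basis (Fin n) F E) (t : TRel F E)
    (σ : InfinitePlace F) (i j : Fin n) :
    (((fr.W w * fr.I t) σ).1 i j : ℂ) =
      Frame.coord ((fr.index σ).symm j) (fr.embE ((fr.index σ).symm j).1.1 (w i)) *
        (((t : T E) ((fr.index σ).symm j).1.1 : ℝ) : ℂ) := by
  change (((fr.heegMatrix w σ * (fr.I t σ).1 :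
    Matrix (Fin n) (Fin n) (locField (fr.embF σ))) i j : locField (fr.embF σ)) : ℂ) = _
  rw [Frame.I]
  change (((fr.heegMatrix w σ * Matrix.diagonal (_ : Fin n → locField (fr.embF σ)) :
    Matrix (Fin n) (Fin n) (locField (fr.embF σ))) i j : locField (fr.embF σ)) : ℂ) = _
  rw [Matrix.mul_diagonal]
  rfl

/-- The Heegner object is invariant under `U_{E/F}` up to the action of `Γ_L`. -/
lemma exists_periodicity (fr : Frame F E n) (w : Module.Basis (Fin n) F E) (𝔄 : FracIdeal E)
    (ρ : TRel F E) (hρ : ρ ∈ relUnitLattice F E) :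
    ∃ γ ∈ stab (latticeOf w 𝔄), ∀ t : TRel F E,
      fr.heegner w (ρ * t) = toGInf fr.embF γ • fr.heegner w t := by
  obtain ⟨u, hu, hρu⟩ := hρ
  have hu' : Algebra.norm F (u : E) = 1 := hu
  refine ⟨regRep w (u : E) hu', regRep_mem_stab w 𝔄 u hu', fun t => ?_⟩
  change ((fr.W w * fr.I (ρ * t) : GInf fr.embF n) : UpperSpace fr.embF n) =
    ((toGInf fr.embF (regRep w (u : E) hu') * (fr.W w * fr.I t) : GInf fr.embF n) :
      UpperSpace fr.embF n)
  apply mk_eq_of_gram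
  intro σ
  have hA : ∀ i j, (toGLC n (fr.embF σ) ((fr.W w * fr.I (ρ * t)) σ)).1 i j =
      Frame.coord ((fr.index σ).symm j) (fr.embE ((fr.index σ).symm j).1.1 (w i)) *
        ((‖fr.embE ((fr.index σ).symm j).1.1 (u : E)‖ : ℂ) *
          (((t : T E) ((fr.index σ).symm j).1.1 : ℝ) : ℂ)) := by
    intro i j
    refine (fr.entry_W_I w (ρ * t) σ i j).trans ?_
    congr 1
    have h1 : ((ρ : T E) ((fr.index σ).symm j).1.1 : ℝ) =
        ‖fr.embE ((fr.index σ).symm j).1.1 (u : E)‖ := by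
      change regMap E u = (ρ : T E) at hρu
      rw [← hρu]
      change ((fr.index σ).symm j).1.1 (u : E) = _
      conv_lhs => rw [← fr.mk_embE ((fr.index σ).symm j).1.1]
      rfl
    rw [← h1, ← Complex.ofReal_mul]
    rfl
  have hB : ∀ i j, (toGLC n (fr.embF σ)
      ((toGInf fr.embF (regRep w (u : E) hu') * (fr.W w * fr.I t)) σ)).1 i j =
      Frame.coord ((fr.index σ).symm j) (fr.embE ((fr.index σ).symm j).1.1 (u : E) *
        fr.embE ((fr.index σ).symm j).1.1 (w i)) *
          (((t : T E) ((fr.index σ).symm j).1.1 : ℝ) : ℂ) := by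
    intro i j
    have h1 : (toGLC n (fr.embF σ)
        ((toGInf fr.embF (regRep w (u : E) hu') * (fr.W w * fr.I t)) σ)).1 i j =
        ∑ k, (toLoc (fr.embF σ) ((regRep w (u : E) hu').1 i k) : ℂ) *
          (((fr.W w * fr.I t) σ).1 k j : ℂ) := by
      rw [Pi.mul_apply, map_mul]
      change ((toGLC n (fr.embF σ) (toGInf fr.embF (regRep w (u : E) hu') σ)).1 *
        (toGLC n (fr.embF σ) ((fr.W w * fr.I t) σ)).1) i j = _
      rw [Matrix.mul_apply]
      rfl
    rw [h1]
    simp_rw [fr.entry_W_I w t σ, ← mul_assoc]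
    rw [← Finset.sum_mul, ← fr.coord_sum]
    congr 2
    rw [← map_mul, ← sum_regRep w (u : E) hu' i, map_sum]
    refine Finset.sum_congr rfl fun k _ => ?_
    rw [map_mul, fr.compat']
    rfl
  ext i i'
  rw [Matrix.mul_apply, Matrix.mul_apply]
  simp_rw [Matrix.star_apply, hA, hB]
  rw [← (fr.index σ).sum_comp, ← (fr.index σ).sum_comp]
  simp_rw [Equiv.symm_apply_apply]
  rw [Fintype.sum_sigma, Fintype.sum_sigma]
  refine Finset.sum_congr rfl fun τ _ => ?_
  have key := Frame.sum_coord_mul τ (fr.embE τ.1 (u : E)) (fr.embE τ.1 (w i)) (fr.embE τ.1 (w i'))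
  have hs : ∀ r : ℝ, star (r : ℂ) = r := Complex.conj_ofReal
  set tt : ℝ := ((t : T E) τ.1 : ℝ)
  set a : ℝ := ‖fr.embE τ.1 (u : E)‖
  have e1 : ∀ c d : ℂ, c * ((a : ℂ) * tt) * star (d * ((a : ℂ) * tt)) =
      ((a ^ 2 : ℝ) : ℂ) * (c * star d) * ((tt : ℂ) * tt) := by
    intro c d
    simp only [star_mul', hs]
    push_cast
    ring
  have e2 : ∀ c d : ℂ, c * (tt : ℂ) * star (d * (tt : ℂ)) = c * star d * ((tt : ℂ) * tt) := by
    intro c d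
    simp only [star_mul', hs]
    ring
  refine (Finset.sum_congr rfl fun j _ => e1 _ _).trans
    (Eq.trans ?_ (Finset.sum_congr rfl fun j _ => e2 _ _).symm)
  rw [← Finset.sum_mul, ← Finset.sum_mul, ← Finset.mul_sum, key]

/-- The Heegner object as a map `T_{E/F} / U_{E/F} → Γ_L \ 𝔥_F^n`. -/
def heegnerMod (fr : Frame F E n) (w : Module.Basis (Fin n) F E) (𝔄 : FracIdeal E) :
    TRel F E ⧸ relUnitLattice F E → ModSpace fr.embF (latticeOf w 𝔄) :=
  Quotient.lift (fun t => Quotient.mk (MulAction.orbitRel _ _) (fr.heegner w t)) (by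
    intro t t' h
    have h' : t⁻¹ * t' ∈ relUnitLattice F E := QuotientGroup.leftRel_apply.1 h
    obtain ⟨γ, hγ, hγt⟩ := exists_periodicity fr w 𝔄 _ h'
    refine Quotient.sound ((MulAction.orbitRel _ _).symm ?_)
    refine ⟨⟨toGInf fr.embF γ, γ, hγ, rfl⟩, ?_⟩
    have := hγt t
    rw [mul_comm t⁻¹, inv_mul_cancel_right] at this
    exact this.symm)

open Classical in
/-- `Δ_w = N_{F_∞/ℝ}((det W)²)`, where `N_{F_∞/ℝ}` is the product of the local norms
`N_{F_σ/ℝ}`, that is of the identity of `ℝ` for `σ` real and of `z ↦ |z|²` for `σ` complex. -/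
def discW (fr : Frame F E n) (w : Module.Basis (Fin n) F E) : ℝ :=
  ∏ σ : InfinitePlace F, if σ.IsReal then (((fr.W w σ).1.det : ℂ) ^ 2).re
    else Complex.normSq (((fr.W w σ).1.det : ℂ) ^ 2)

/-- The integral `∫_{T_{E/F}/U_{E/F}} E_{𝔞 ↪ L}(ϖ̄(t), s) d^× t_{E/F}`, where `ϖ̄` is the Heegner
object `T_{E/F}/U_{E/F} → Γ_L \ 𝔥_F^n`. -/
def heckeIntegral {F E : Type*} [Field F] [NumberField F] [Field E] [NumberField E] [Algebra F E]
    {n : ℕ} (fr : Frame F E n) (w : Module.Basis (Fin n) F E) (𝔄 : FracIdeal E)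
    (D : ParabolicDatum (latticeOf w 𝔄)) (s : ℂ) : ℂ :=
  ∫ t, eisMod fr.embF fr.mk_embF D (heegnerMod fr w 𝔄 t) s
    ∂quotMeasure (relUnitLattice F E) (haarTRel F E)

end Heegner

end

end RelHecke

open RelHecke

namespace RelHecke

noncomputable section

set_option linter.unusedSectionVars false

/-! ### Lattices over Dedekind domains -/

section Steinitz

variable {R K V : Type*} [CommRing R] [IsDedekindDomain R] [Field K] [Algebra R K]
  [IsFractionRing R K] [AddCommGroup V] [Module K V] [Module R V] [IsScalarTower R K V]

/-! The proof is an unfolding argument. Identify `F^n` with `E` through `w`. A coset of `P` in `Γ_L`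
is determined by the vector `eγ` up to units of `F`, because an element of `Γ_L` preserves `𝔞e`
exactly when it multiplies `e` by a unit (`mem_parabolic_iff`). The vectors that occur are all `x ∈
𝔄_𝔞`, since both `e` and `x` have coefficient ideal `𝔞` and, by Steinitz's structure theorem,
determinant-one automorphisms of a lattice of rank at least two act transitively on such vectors
(`exists_automorphism`). Thus `P \ Γ_L ≃ 𝓞_F^× \ 𝔄_𝔞` (`orbitEquiv`), and this splits as `(𝓞_E^× \
𝔄_𝔞) × (𝓞_E^× / 𝓞_F^×)` (`orbitSplitEquiv`).

At a Heegner point the row vector `xWI(t)` consists of the coordinates of `tx` in `E_∞`, and `det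
I(t)_σ = 1`. The term attached to `x` is therefore `|Δ_w|^{s/2} ∏_σ (∑_{τ|σ} |x|_τ² t_τ²)^{-n n_σ
s/2}`. Homogeneity extracts `|N x|^{-s}` and leaves the integrand of `Γ_{E/F}(s)` translated by the
projection of `|x|` to `T_{E/F}` (`eisTerm_heegner_orbit`). Summing over `𝓞_E^× / 𝓞_F^×` unfolds the
integral over a fundamental domain of `U_{E/F}` to `N Γ_{E/F}(s)`. Here `N = coverNumber` counts how
often the translates of the domain by `𝓞_E^× / 𝓞_F^×` cover `T_{E/F}`: the image of this group may
be larger than `U_{E/F}`, and the map to `T_{E/F}` may have a finite kernel.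

It remains to see that `c_{E/F}(s) = N Γ_{E/F}(s)` (`heckeFactor_eq`). Write `n = [E:F]` and `r` for
the number of archimedean places of `F`. Counting a suitable function on `T_E` in two ways gives `n
N w_F R_E = w_E n^r R_{E/F} R_F` (`regulator_relation`). Integrating `|N t|^s exp(-∑ t_τ²)` over
`T_{k'}` along the fibration over `T_k` expresses relative gamma factors through ordinary gamma
functions (`integral_gammaFun`), which yields `n^r Γ_{F/ℚ}(ns) Γ_{E/F}(s) = n Γ_{E/ℚ}(s)`. The
powers of `n` cancel between the two relations.

For convergence, the pairs `(𝔟, x)` inject into the integral ideals of `E` through `x ↦ x𝔄⁻¹`, so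
the sums over orbits are dominated by the Dedekind zeta function. The unfolded series of absolute
values then has a finite integral, so the Eisenstein series converges absolutely at some Heegner
point. Its terms at two points of `𝔥_F^n` are comparable with a single constant
(`exists_detFun_le`), so it converges everywhere.

The zeta form follows because multiplication by `c ∈ F^×` identifies `𝔄_{c𝔞}` with `𝔄_𝔞`. Each
anti-integral `𝔟` in the class of `𝔞` contributes `(N𝔟 / N𝔞)^{ns}` times the same orbit sum, and
inverting `𝔟` turns the sum over `𝔟` into `ζ_F(𝔞⁻¹, ns)` (`relPartialZeta_eq`). -/

/-- `L = ⨁ I_i b_i`. -/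
def IsPseudoBasis {m : ℕ} (b : Module.Basis (Fin m) K V) (I : Fin m → (FractionalIdeal R⁰ K)ˣ)
    (L : Submodule R V) : Prop :=
  ∀ v, v ∈ L ↔ ∀ i, b.repr v i ∈ (I i : FractionalIdeal R⁰ K)

/-- This is projectivity of an invertible ideal: write `1 = ∑ i_k j_k` with `i_k ∈ I` and `j_k ∈
I⁻¹`, lift each `i_k y` to some `l_k ∈ L`, and take `∑ j_k l_k`. -/
lemma exists_lift_of_ideal {V' : Type*} [AddCommGroup V'] [Module K V'] (π : V →ₗ[K] V')
    (L : Submodule R V) (I : (FractionalIdeal R⁰ K)ˣ) (y : V')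
    (h : ∀ c ∈ (I : FractionalIdeal R⁰ K), ∃ l ∈ L, π l = c • y) :
    ∃ l, π l = y ∧ ∀ c ∈ (I : FractionalIdeal R⁰ K), c • l ∈ L := by
  have h1 : (1 : K) ∈ (I : FractionalIdeal R⁰ K) * ((I⁻¹ : (FractionalIdeal R⁰ K)ˣ) :
      FractionalIdeal R⁰ K) := by
    rw [Units.mul_inv]; exact FractionalIdeal.one_mem_one _
  -- The scalar `1` is made explicit so that it can vary in the induction over sums of products in
  -- `I * I⁻¹`.
  suffices H : ∃ l, π l = (1 : K) • y ∧ ∀ c ∈ (I : FractionalIdeal R⁰ K), c • l ∈ L by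
    simpa using H
  refine FractionalIdeal.mul_induction_on h1 ?_ ?_
  · intro i hi j hj
    obtain ⟨l, hl, hly⟩ := h i hi
    refine ⟨j • l, by rw [map_smul, hly, smul_smul, mul_comm], fun c hc => ?_⟩
    have h2 : c * j ∈ (1 : FractionalIdeal R⁰ K) := by
      rw [← Units.mul_inv I]; exact FractionalIdeal.mul_mem_mul hc hj
    obtain ⟨r, hr⟩ := (FractionalIdeal.mem_one_iff _).1 h2
    rw [smul_smul, ← hr, algebraMap_smul]
    exact L.smul_mem r hl
  · rintro a b ⟨l, hl, hl'⟩ ⟨k, hk, hk'⟩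
    refine ⟨l + k, by rw [map_add, hl, hk, add_smul], fun c hc => ?_⟩
    rw [smul_add]
    exact L.add_mem (hl' c hc) (hk' c hc)

/-- A pseudo-basis of a quotient by a line lifts. -/
lemma exists_isPseudoBasis_cons {m : ℕ} (L : Submodule R V) (x : V) (hx : x ≠ 0)
    (I₀ : (FractionalIdeal R⁰ K)ˣ) (hI₀ : ∀ c : K, c • x ∈ L ↔ c ∈ (I₀ : FractionalIdeal R⁰ K))
    (b : Module.Basis (Fin m) K (V ⧸ (Submodule.span K {x})))
    (I : Fin m → (FractionalIdeal R⁰ K)ˣ)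
    (hb : IsPseudoBasis b I (L.map ((Submodule.span K {x}).mkQ.restrictScalars R))) :
    ∃ b' : Module.Basis (Fin (m + 1)) K V, b' 0 = x ∧ IsPseudoBasis b' (Fin.cons I₀ I) L := by
  classical
  set π := (Submodule.span K {x}).mkQ
  have hlift : ∀ i, ∃ l, π l = b i ∧ ∀ c ∈ (I i : FractionalIdeal R⁰ K), c • l ∈ L := by
    intro i
    refine exists_lift_of_ideal π L (I i) (b i) fun c hc => ?_
    have : c • b i ∈ L.map (π.restrictScalars R) := by
      rw [hb]
      intro j
      rw [map_smul, b.repr_self, Finsupp.smul_apply, Finsupp.single_apply]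
      split_ifs with h
      · subst h; simpa using hc
      · rw [smul_zero]; exact FractionalIdeal.zero_mem _
    obtain ⟨l, hl, h⟩ := this
    exact ⟨l, hl, h⟩
  choose l hl hlL using hlift
  have hπx : π x = 0 := by
    rw [Submodule.mkQ_apply, Submodule.Quotient.mk_eq_zero]
    exact Submodule.mem_span_singleton_self x
  have hker : ∀ v, π v = 0 → ∃ c : K, v = c • x := by
    intro v hv
    rw [Submodule.mkQ_apply, Submodule.Quotient.mk_eq_zero, Submodule.mem_span_singleton] at hv
    obtain ⟨c, hc⟩ := hv
    exact ⟨c, hc.symm⟩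
  have hli : LinearIndependent K (Fin.cons x l : Fin (m + 1) → V) := by
    rw [Fintype.linearIndependent_iff]
    intro g hg
    rw [Fin.sum_univ_succ] at hg
    simp only [Fin.cons_zero, Fin.cons_succ] at hg
    have h1 := congrArg π hg
    simp only [map_add, map_smul, hπx, map_sum, hl, smul_zero, zero_add, map_zero] at h1
    have h2 := Fintype.linearIndependent_iff.1 b.linearIndependent _ h1
    have h3 : g 0 = 0 := by
      simpa [h2, hx] using hg
    exact Fin.cases h3 h2
  have hsp : ⊤ ≤ Submodule.span K (Set.range (Fin.cons x l : Fin (m + 1) → V)) := by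
    intro v _
    obtain ⟨c, hc⟩ := hker (v - ∑ i, b.repr (π v) i • l i) (by
      simp only [map_sub, map_sum, map_smul, hl]
      rw [b.sum_repr, sub_self])
    rw [sub_eq_iff_eq_add] at hc
    rw [hc]
    refine Submodule.add_mem _ (Submodule.smul_mem _ _ (Submodule.subset_span ⟨0, rfl⟩))
      (Submodule.sum_mem _ fun i _ => Submodule.smul_mem _ _ (Submodule.subset_span ⟨i.succ, rfl⟩))
  refine ⟨Module.Basis.mk hli hsp, by simp, fun v => ?_⟩
  set b' := Module.Basis.mk hli hsp
  have hv : v = b'.repr v 0 • x + ∑ i : Fin m, b'.repr v i.succ • l i := by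
    conv_lhs => rw [← b'.sum_repr v, Fin.sum_univ_succ]
    simp [b']
  have hr : ∀ i : Fin m, b.repr (π v) i = b'.repr v i.succ := by
    intro i
    conv_lhs => rw [hv]
    simp only [map_add, map_smul, hπx, map_sum, hl, smul_zero, zero_add]
    simp [Finsupp.single_apply]
  constructor
  · intro hvL
    have h1 : ∀ i : Fin m, b'.repr v i.succ ∈ (I i : FractionalIdeal R⁰ K) := by
      intro i
      rw [← hr]
      exact (hb _).1 ⟨v, hvL, rfl⟩ i
    -- The coordinates on the lifted vectors are already known to be in their ideals, so subtracting
    -- that part of `v` stays inside `L`.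
    have h2 : b'.repr v 0 • x ∈ L := by
      have : b'.repr v 0 • x = v - ∑ i : Fin m, b'.repr v i.succ • l i := by
        rw [eq_sub_iff_add_eq]; exact hv.symm
      rw [this]
      exact L.sub_mem hvL (L.sum_mem fun i _ => hlL i _ (h1 i))
    exact Fin.cases ((hI₀ _).1 h2) h1
  · intro h
    rw [hv]
    exact L.add_mem ((hI₀ _).2 (h 0)) (L.sum_mem fun i _ => hlL i _ (h i.succ))

/-- For `α ≠ 0` in `I` the ideal `αI⁻¹` is integral and non-zero, and in a Dedekind domain some `β`
makes `αI⁻¹ + βP⁻¹` the unit ideal. The four numbers are the entries of the change of basis that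
merges two coefficient ideals. -/
lemma exists_unimodular (I P : (FractionalIdeal R⁰ K)ˣ) :
    ∃ α ∈ (I : FractionalIdeal R⁰ K), ∃ α' ∈ ((I⁻¹ : (FractionalIdeal R⁰ K)ˣ) : FractionalIdeal R⁰ K),
    ∃ β ∈ (P : FractionalIdeal R⁰ K), ∃ β' ∈ ((P⁻¹ : (FractionalIdeal R⁰ K)ˣ) : FractionalIdeal R⁰ K),
      α * α' + β * β' = 1 := by
  obtain ⟨α, hα, hα0⟩ : ∃ α ∈ (I : FractionalIdeal R⁰ K), α ≠ 0 := by
    by_contra! h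
    exact I.ne_zero (FractionalIdeal.eq_zero_iff.2 h)
  obtain ⟨β, hβ⟩ := IsDedekindDomain.exists_add_spanSingleton_mul_eq (R := R) (K := K)
    (a := FractionalIdeal.spanSingleton R⁰ α * ((I⁻¹ : (FractionalIdeal R⁰ K)ˣ) : FractionalIdeal R⁰ K))
    (b := ((P⁻¹ : (FractionalIdeal R⁰ K)ˣ) : FractionalIdeal R⁰ K)) (c := 1)
    (by
      rw [← Units.mul_inv I]
      gcongr
      exact FractionalIdeal.spanSingleton_le_iff_mem.2 hα)
    (mul_ne_zero (FractionalIdeal.spanSingleton_ne_zero_iff.2 hα0) (Units.ne_zero _))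
    (Units.ne_zero _)
  have h1 : (1 : K) ∈ (1 : FractionalIdeal R⁰ K) := FractionalIdeal.one_mem_one _
  rw [← hβ, ← FractionalIdeal.mem_coe, FractionalIdeal.coe_add, Submodule.add_eq_sup, Submodule.mem_sup] at h1
  obtain ⟨a, ha, c, hc, hac⟩ := h1
  rw [FractionalIdeal.mem_coe, FractionalIdeal.mem_singleton_mul] at ha hc
  obtain ⟨α', hα', rfl⟩ := ha
  obtain ⟨β', hβ', rfl⟩ := hc
  refine ⟨α, hα, α', hα', β, ?_, β', hβ', hac⟩
  rw [← FractionalIdeal.spanSingleton_le_iff_mem]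
  have h2 : FractionalIdeal.spanSingleton R⁰ β * ((P⁻¹ : (FractionalIdeal R⁰ K)ˣ) : FractionalIdeal R⁰ K) ≤ 1 := by
    rw [← hβ]; exact le_sup_right
  calc _ = FractionalIdeal.spanSingleton R⁰ β * ((P⁻¹ : (FractionalIdeal R⁰ K)ˣ) : FractionalIdeal R⁰ K) * P := by
        rw [mul_assoc, Units.inv_mul, mul_one]
    _ ≤ 1 * P := by gcongr
    _ = P := one_mul _

/-- The isomorphism `I ⊕ P ≃ IP ⊕ R`. On the first two coordinates it is the matrix with rows `(-β,
α)` and `(α', β')`, which has determinant `-1` by the unimodular relation; the memberships of the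
entries make it and its inverse respect the ideals. -/
lemma exists_isPseudoBasis_mul {m : ℕ} {L : Submodule R V} {b : Module.Basis (Fin (m + 2)) K V}
    {I P : (FractionalIdeal R⁰ K)ˣ} {J : Fin m → (FractionalIdeal R⁰ K)ˣ}
    (hb : IsPseudoBasis b (Fin.cons I (Fin.cons P J)) L) :
    ∃ b' : Module.Basis (Fin (m + 2)) K V, IsPseudoBasis b' (Fin.cons (I * P) (Fin.cons 1 J)) L := by
  obtain ⟨α, hα, α', hα', β, hβ, β', hβ', h1⟩ := exists_unimodular I P
  let e : (Fin (m + 2) → K) ≃ₗ[K] (Fin (m + 2) → K) :=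
    { toFun := fun c => Fin.cons (α * c 1 - β * c 0) (Fin.cons (α' * c 0 + β' * c 1)
        (fun i => c i.succ.succ))
      invFun := fun c => Fin.cons (-β' * c 0 + α * c 1) (Fin.cons (α' * c 0 + β * c 1)
        (fun i => c i.succ.succ))
      map_add' := by
        intro c d
        ext i
        refine Fin.cases ?_ (fun i => Fin.cases ?_ (fun i => ?_) i) i
        · simp; ring
        · simp; ring
        · simp
      map_smul' := by
        intro r c
        ext i
        refine Fin.cases ?_ (fun i => Fin.cases ?_ (fun i => ?_) i) i
        · simp; ring
        · simp; ring
        · simp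
      left_inv := by
        intro c
        ext i
        refine Fin.cases ?_ (fun i => Fin.cases ?_ (fun i => ?_) i) i
        · simp; linear_combination c 0 * h1
        · simp; linear_combination c 1 * h1
        · simp
      right_inv := by
        intro c
        ext i
        refine Fin.cases ?_ (fun i => Fin.cases ?_ (fun i => ?_) i) i
        · simp; linear_combination c 0 * h1
        · simp; linear_combination c 1 * h1
        · simp }
  refine ⟨Module.Basis.ofEquivFun (b.equivFun.trans e), fun v => ?_⟩
  rw [hb v]
  simp only [Module.Basis.ofEquivFun_repr_apply, LinearEquiv.trans_apply]
  set c := b.equivFun v with hc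
  have hc' : ∀ i, b.repr v i = c i := fun i => rfl
  simp only [hc', Fin.forall_fin_succ (n := m + 1), Fin.forall_fin_succ (n := m), Fin.cons_zero,
    Fin.cons_succ]
  change _ ↔ (α * c 1 - β * c 0 ∈ _ ∧ α' * c 0 + β' * c 1 ∈ _ ∧ ∀ i : Fin m, c i.succ.succ ∈ _)
  have mm : ∀ {A B : (FractionalIdeal R⁰ K)} (C : FractionalIdeal R⁰ K) {x y : K}, x ∈ A → y ∈ B →
      A * B = C → x * y ∈ C := fun C _ _ hx hy h => h ▸ FractionalIdeal.mul_mem_mul hx hy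
  have addm : ∀ {A : (FractionalIdeal R⁰ K)} {x y : K}, x ∈ A → y ∈ A → x + y ∈ A := fun hx hy =>
    Submodule.add_mem _ hx hy
  constructor
  · rintro ⟨h0, h2, h3⟩
    refine ⟨?_, ?_, h3⟩
    · rw [sub_eq_add_neg, ← mul_neg]
      refine addm (mm _ hα h2 (by simp)) (mm _ hβ (Submodule.neg_mem _ h0) (by simp [mul_comm]))
    · exact addm (mm _ hα' h0 (by simp)) (mm _ hβ' h2 (by simp))
  · rintro ⟨h0, h2, h3⟩
    have e0 : c 0 = -β' * (α * c 1 - β * c 0) + α * (α' * c 0 + β' * c 1) := by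
      linear_combination -c 0 * h1
    have e1 : c 1 = α' * (α * c 1 - β * c 0) + β * (α' * c 0 + β' * c 1) := by
      linear_combination -c 1 * h1
    refine ⟨?_, ?_, h3⟩
    · change c 0 ∈ _
      rw [e0]
      exact addm (mm _ (Submodule.neg_mem _ hβ') h0 (by
          rw [Units.val_mul, mul_comm (I : FractionalIdeal R⁰ K), Units.inv_mul_cancel_left]))
        (mm _ hα h2 (by simp))
    · change c 1 ∈ _
      rw [e1]
      exact addm (mm _ hα' h0 (by simp)) (mm _ hβ h2 (by simp))

/-- The coefficients embed into the Noetherian module `L` by `c ↦ c x`, so they form a finitely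
generated submodule of `K`; it contains `1`. -/
lemma exists_coeffIdeal {L : Submodule R V} (hL : L.FG) {x : V} (hx : x ≠ 0) (hxL : x ∈ L) :
    ∃ I₀ : (FractionalIdeal R⁰ K)ˣ, ∀ c : K, c • x ∈ L ↔ c ∈ (I₀ : FractionalIdeal R⁰ K) := by
  let f : K →ₗ[R] V := (LinearMap.toSpanSingleton K V x).restrictScalars R
  have hf : Function.Injective f := smul_left_injective K hx
  have : IsNoetherian R L := isNoetherian_of_fg_of_noetherian L hL
  have hfg : (L.comap f).FG := by
    refine Submodule.fg_of_fg_map_injective f hf ?_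
    have := isNoetherian_submodule.1 ‹IsNoetherian R L› ((L.comap f).map f)
      (Submodule.map_comap_le f L)
    exact this
  let I : FractionalIdeal R⁰ K := ⟨L.comap f, FractionalIdeal.isFractional_of_fg hfg⟩
  have h0 : I ≠ 0 := by
    intro h
    have h1 : (1 : K) ∈ I := by
      change (1 : K) • x ∈ L
      rwa [one_smul]
    rw [h, FractionalIdeal.mem_zero_iff] at h1
    exact one_ne_zero h1
  exact ⟨Units.mk0 _ h0, fun c => Iff.rfl⟩

lemma span_map_mkQ {L : Submodule R V} (hsp : Submodule.span K (L : Set V) = ⊤)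
    (N : Submodule K V) :
    Submodule.span K ((L.map (N.mkQ.restrictScalars R) : Submodule R (V ⧸ N)) : Set (V ⧸ N)) = ⊤ := by
  rw [Submodule.map_coe]
  change Submodule.span K (N.mkQ '' L) = ⊤
  rw [← Submodule.map_span, hsp, Submodule.map_top, Submodule.range_mkQ]

/-- Steinitz's theorem: a lattice of rank `m + 1` is of the form `P b_0 ⊕ R b_1 ⊕ ⋯ ⊕ R b_m`. -/
theorem exists_isPseudoBasis : ∀ (m : ℕ) {V : Type*} [AddCommGroup V] [Module K V] [Module R V]
    [IsScalarTower R K V] [FiniteDimensional K V] (L : Submodule R V), L.FG →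
    Submodule.span K (L : Set V) = ⊤ → Module.finrank K V = m + 1 →
    ∃ (b : Module.Basis (Fin (m + 1)) K V) (P : (FractionalIdeal R⁰ K)ˣ),
      IsPseudoBasis b (Fin.cons P fun _ => 1) L := by
  intro m
  induction m with
  | zero =>
    intro V _ _ _ _ _ L hfg hsp hdim
    obtain ⟨x, hxL, hx⟩ : ∃ x ∈ L, x ≠ 0 := by
      by_contra! h
      have : Submodule.span K (L : Set V) = ⊥ := Submodule.span_eq_bot.2 h
      rw [this] at hsp
      rw [← finrank_top, ← hsp, finrank_bot] at hdim
      omega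
    obtain ⟨I₀, hI₀⟩ := exists_coeffIdeal (K := K) hfg hx hxL
    have hq := Submodule.finrank_quotient_add_finrank (Submodule.span K {x})
    rw [finrank_span_singleton hx, hdim] at hq
    obtain ⟨b, -, hb⟩ := exists_isPseudoBasis_cons L x hx I₀ hI₀
      (Module.finBasisOfFinrankEq K _ (by omega : _ = 0)) (fun _ => 1) (by
        have hs : Subsingleton (V ⧸ Submodule.span K {x}) :=
          Module.finrank_zero_iff.1 (by omega : Module.finrank K _ = 0)
        intro v
        refine ⟨fun _ i => i.elim0, fun _ => ?_⟩
        rw [Subsingleton.elim v 0]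
        exact Submodule.zero_mem _)
    exact ⟨b, I₀, hb⟩
  | succ m ih =>
    intro V _ _ _ _ _ L hfg hsp hdim
    obtain ⟨x, hxL, hx⟩ : ∃ x ∈ L, x ≠ 0 := by
      by_contra! h
      have : Submodule.span K (L : Set V) = ⊥ := Submodule.span_eq_bot.2 h
      rw [this] at hsp
      rw [← finrank_top, ← hsp, finrank_bot] at hdim
      omega
    obtain ⟨I₀, hI₀⟩ := exists_coeffIdeal (K := K) hfg hx hxL
    have hq := Submodule.finrank_quotient_add_finrank (Submodule.span K {x})
    rw [finrank_span_singleton hx, hdim] at hq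
    -- Dividing by the line through a lattice vector lowers the rank by one. Lifting back gives
    -- coefficient ideals `I₀, P, 1, …, 1`, and the first two are then merged.
    obtain ⟨b, P, hb⟩ := ih (L.map ((Submodule.span K {x}).mkQ.restrictScalars R))
      (hfg.map _) (span_map_mkQ hsp _) (by omega)
    obtain ⟨b', -, hb'⟩ := exists_isPseudoBasis_cons L x hx I₀ hI₀ b _ hb
    obtain ⟨b'', hb''⟩ := exists_isPseudoBasis_mul hb'
    refine ⟨b'', I₀ * P, ?_⟩
    convert! hb''
    rename_i i
    refine Fin.cases ?_ (fun i => ?_) i <;> rfl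

/-- A product of ideals is additively generated by products of elements. The scalar `d` is
quantified inside the statement because the induction absorbs one factor after another into it. -/
lemma mul_mem_of_prod {ι : Type*} (s : Finset ι) (I : ι → FractionalIdeal R⁰ K)
    (J : FractionalIdeal R⁰ K) : ∀ d : K,
    (∀ c : ι → K, (∀ i ∈ s, c i ∈ I i) → d * ∏ i ∈ s, c i ∈ J) → ∀ y ∈ ∏ i ∈ s, I i, d * y ∈ J := by
  classical
  induction s using Finset.induction_on with
  | empty =>
    intro d h y hy
    rw [Finset.prod_empty, FractionalIdeal.mem_one_iff] at hy
    obtain ⟨r, rfl⟩ := hy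
    have := h 0 (by simp)
    rw [Finset.prod_empty, mul_one] at this
    rw [mul_comm, ← Algebra.smul_def]
    exact Submodule.smul_mem _ r this
  | insert a s ha ih =>
    intro d h y hy
    rw [Finset.prod_insert ha] at hy
    refine FractionalIdeal.mul_induction_on hy ?_ ?_
    · intro i hi j hj
      rw [← mul_assoc]
      refine ih (d * i) (fun c hc => ?_) j hj
      have := h (Function.update c a i) (by
        intro k hk
        rcases Finset.mem_insert.1 hk with rfl | hk
        · simpa using hi
        · rw [Function.update_of_ne (ne_of_mem_of_not_mem hk ha)]
          exact hc k hk)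
      rw [Finset.prod_insert ha, Function.update_self, ← mul_assoc] at this
      rwa [Finset.prod_congr rfl fun k hk => Function.update_of_ne (ne_of_mem_of_not_mem hk ha) _ _]
        at this
    · intro x y hx hy
      rw [mul_add]
      exact Submodule.add_mem _ hx hy

lemma prod_mem_prod {ι : Type*} (s : Finset ι) (I : ι → FractionalIdeal R⁰ K) (c : ι → K)
    (h : ∀ i ∈ s, c i ∈ I i) : ∏ i ∈ s, c i ∈ ∏ i ∈ s, I i := by
  classical
  induction s using Finset.induction_on with
  | empty => simp
  | insert a s ha ih =>
    rw [Finset.prod_insert ha, Finset.prod_insert ha]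
    exact FractionalIdeal.mul_mem_mul (h a (by simp)) (ih fun i hi => h i (by simp [hi]))

/-- By multilinearity `b'.det b * ∏ c_i` is the determinant of the vectors `c_i b_i`. These lie in
`L`, so their `b'`-coordinates lie in the ideals `J`, and every term of the Leibniz expansion lies
in `∏ J_i`. -/
lemma IsPseudoBasis.det_mul_le {m : ℕ} {L : Submodule R V} {b b' : Module.Basis (Fin m) K V}
    {I J : Fin m → (FractionalIdeal R⁰ K)ˣ} (hb : IsPseudoBasis b I L) (hb' : IsPseudoBasis b' J L) :
    ∀ y ∈ ∏ i, (I i : FractionalIdeal R⁰ K), b'.det b * y ∈ ∏ i, (J i : FractionalIdeal R⁰ K) := by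
  refine mul_mem_of_prod _ _ _ _ fun c hc => ?_
  have h1 : b'.det b * ∏ i, c i = b'.det fun i => c i • b i := by
    rw [b'.det.map_smul_univ, smul_eq_mul, mul_comm]
  rw [h1, Module.Basis.det_apply, Matrix.det_apply]
  refine Submodule.sum_mem _ fun σ _ => ?_
  rw [Units.smul_def, ← Int.cast_smul_eq_zsmul R]
  refine Submodule.smul_mem _ _ ?_
  rw [← Equiv.prod_comp σ fun i => (J i : FractionalIdeal R⁰ K)]
  refine prod_mem_prod _ _ _ fun i _ => ?_
  rw [Module.Basis.toMatrix_apply]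
  refine (hb' _).1 ((hb _).2 fun j => ?_) (σ i)
  rw [map_smul, b.repr_self, Finsupp.smul_apply, Finsupp.single_apply]
  split_ifs with h
  · subst h; simpa using hc _ (Finset.mem_univ _)
  · rw [smul_zero]; exact FractionalIdeal.zero_mem _

/-- The determinant of a change of pseudo-basis. -/
lemma IsPseudoBasis.det_mul {m : ℕ} {L : Submodule R V} {b b' : Module.Basis (Fin m) K V}
    {I J : Fin m → (FractionalIdeal R⁰ K)ˣ} (hb : IsPseudoBasis b I L) (hb' : IsPseudoBasis b' J L)
    (y : K) : y ∈ ∏ i, (I i : FractionalIdeal R⁰ K) ↔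
      b'.det b * y ∈ ∏ i, (J i : FractionalIdeal R⁰ K) := by
  refine ⟨hb.det_mul_le hb' y, fun h => ?_⟩
  have := hb'.det_mul_le hb _ h
  rwa [← mul_assoc, Module.Basis.det_mul_det, Module.Basis.det_self, one_mul] at this

/-- The automorphisms of determinant `1` of a lattice of rank at least `2` act transitively on the
primitive vectors with given coefficient ideal. -/
theorem exists_automorphism [FiniteDimensional K V] {m : ℕ} {L : Submodule R V} (hfg : L.FG)
    (hsp : Submodule.span K (L : Set V) = ⊤) (hdim : Module.finrank K V = m + 2)
    (I₀ : (FractionalIdeal R⁰ K)ˣ) {x y : V} (hx : x ≠ 0) (hy : y ≠ 0)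
    (hxI : ∀ c : K, c • x ∈ L ↔ c ∈ (I₀ : FractionalIdeal R⁰ K))
    (hyI : ∀ c : K, c • y ∈ L ↔ c ∈ (I₀ : FractionalIdeal R⁰ K)) :
    ∃ g : V →ₗ[K] V, g x = y ∧ (∀ v, g v ∈ L ↔ v ∈ L) ∧ LinearMap.det g = 1 := by
  -- Both vectors are completed to pseudo-bases of the same shape; only the second ideals `P` and
  -- `P'` may differ.
  have key : ∀ z : V, z ≠ 0 → (∀ c : K, c • z ∈ L ↔ c ∈ (I₀ : FractionalIdeal R⁰ K)) →
      ∃ (b : Module.Basis (Fin (m + 2)) K V) (P : (FractionalIdeal R⁰ K)ˣ), b 0 = z ∧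
        IsPseudoBasis b (Fin.cons I₀ (Fin.cons P fun _ => 1)) L := by
    intro z hz hzI
    have hq := Submodule.finrank_quotient_add_finrank (Submodule.span K {z})
    rw [finrank_span_singleton hz, hdim] at hq
    obtain ⟨b, P, hb⟩ := exists_isPseudoBasis m
      (L.map ((Submodule.span K {z}).mkQ.restrictScalars R))
      (hfg.map _) (span_map_mkQ hsp _) (by omega)
    obtain ⟨b', h0, hb'⟩ := exists_isPseudoBasis_cons L z hz I₀ hzI b _ hb
    exact ⟨b', P, h0, hb'⟩
  obtain ⟨b, P, hb0, hb⟩ := key x hx hxI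
  obtain ⟨b', P', hb0', hb'⟩ := key y hy hyI
  set d := b'.det b with hd
  have hdd : d * b.det b' = 1 := by rw [hd, Module.Basis.det_mul_det, Module.Basis.det_self]
  have hd0 : d ≠ 0 := left_ne_zero_of_mul_eq_one hdd
  -- The determinant of the change of pseudo-basis gives `d I₀ P = I₀ P'`, and cancelling `I₀`
  -- leaves `d P = P'`.
  have hPP : ∀ c, c ∈ (P : FractionalIdeal R⁰ K) ↔ d * c ∈ (P' : FractionalIdeal R⁰ K) := by
    have h1 : ∀ z, z ∈ (I₀ : FractionalIdeal R⁰ K) * P ↔ d * z ∈ (I₀ : FractionalIdeal R⁰ K) * P' := by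
      intro z
      have := hb.det_mul hb' z
      simpa [Fin.prod_univ_succ] using this
    have h2 : FractionalIdeal.spanSingleton R⁰ d * ((I₀ : FractionalIdeal R⁰ K) * P) =
        (I₀ : FractionalIdeal R⁰ K) * P' := by
      ext z
      rw [FractionalIdeal.mem_singleton_mul]
      constructor
      · rintro ⟨w, hw, rfl⟩
        exact (h1 w).1 hw
      · intro hz
        refine ⟨d⁻¹ * z, (h1 _).2 ?_, ?_⟩ <;> rw [mul_inv_cancel_left₀ hd0]
        exact hz
    have h3 : FractionalIdeal.spanSingleton R⁰ d * (P : FractionalIdeal R⁰ K) = P' := by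
      rw [mul_left_comm] at h2
      exact mul_left_cancel₀ (Units.ne_zero I₀) h2
    intro c
    rw [← h3, FractionalIdeal.mem_singleton_mul]
    constructor
    · intro hc
      exact ⟨c, hc, rfl⟩
    · rintro ⟨w, hw, h⟩
      rwa [mul_left_cancel₀ hd0 h]
  -- Scaling the second basis vector by `d` makes the determinant equal to one, and the lattice is
  -- kept because `d P = P'`. A second vector is needed for this, whence the rank condition.
  let a : Fin (m + 2) → K := Fin.cons 1 (Fin.cons d fun _ => 1)
  let g : V →ₗ[K] V := b.constr K fun i => a i • b' i
  have hgb : ∀ i, g (b i) = a i • b' i := fun i => b.constr_basis K _ i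
  have hgr : ∀ v i, b'.repr (g v) i = a i * b.repr v i := by
    intro v i
    conv_lhs => rw [← b.sum_repr v]
    simp only [map_sum, map_smul, hgb]
    simp [Finsupp.single_apply, mul_comm]
  refine ⟨g, ?_, fun v => ?_, ?_⟩
  · rw [← hb0, hgb, hb0']
    simp [a]
  · rw [hb v, hb' (g v)]
    simp only [hgr, Fin.forall_fin_succ (n := m + 1), Fin.forall_fin_succ (n := m), a,
      Fin.cons_zero, Fin.cons_succ, one_mul, hPP]
  · have h1 : b.det (g ∘ b) = LinearMap.det g * b.det b := Module.Basis.det_comp b g b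
    rw [b.det_self, mul_one] at h1
    have h3 : b.det (g ∘ b) = b.det b' * b'.det (g ∘ b) := by
      rw [Module.Basis.det_apply, Module.Basis.det_apply, Module.Basis.det_apply, ← Matrix.det_mul,
        Module.Basis.toMatrix_mul_toMatrix]
    rw [← h1, h3]
    have h2 : (g ∘ b) = fun i => a i • b' i := funext hgb
    rw [h2, b'.det.map_smul_univ, b'.det_self]
    simp only [a, Fin.prod_univ_succ, Fin.cons_zero, Fin.cons_succ, Finset.prod_const_one]
    simp only [one_mul, mul_one, smul_eq_mul]
    rw [mul_comm]; exact hdd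

end Steinitz

/-! ### The index set of the Eisenstein series -/

section Index

variable {F E : Type*} [Field F] [NumberField F] [Field E] [NumberField E] [Algebra F E] {n : ℕ}

/-- For `x ≠ 0` the map `c ↦ c x` is injective, so an equality of subsets of the line becomes one of
coefficient sets. The condition `x ∈ M` is the case `c = 1`, which uses anti-integrality. -/
lemma mem_idealPart_iff {V : Type*} [AddCommGroup V] [Module F V] [Module (𝓞 F) V]
    {M : Submodule (𝓞 F) V} {𝔞 : FracIdeal F} (h1 : AntiIntegral 𝔞) {x : V} :
    x ∈ idealPart M 𝔞 ↔ x ≠ 0 ∧ ∀ c : F, c • x ∈ M ↔ c ∈ fracSub 𝔞 := by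
  constructor
  · rintro ⟨-, hx0, h⟩
    refine ⟨hx0, fun c => ?_⟩
    have hinj : Function.Injective fun c : F => c • x := smul_left_injective F hx0
    constructor
    · intro hc
      have : c • x ∈ {y | (∃ c : F, y = c • x) ∧ y ∈ M} := ⟨⟨c, rfl⟩, hc⟩
      rw [h] at this
      obtain ⟨d, hd, hcd⟩ := this
      rwa [hinj hcd]
    · intro hc
      have : c • x ∈ {y | ∃ c ∈ fracSub 𝔞, y = c • x} := ⟨c, hc, rfl⟩
      rw [← h] at this
      exact this.2
  · rintro ⟨hx0, h⟩
    refine ⟨?_, hx0, ?_⟩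
    · have := (h 1).2 h1
      rwa [one_smul] at this
    · ext y
      constructor
      · rintro ⟨⟨c, rfl⟩, hc⟩
        exact ⟨c, (h c).1 hc, rfl⟩
      · rintro ⟨c, hc, rfl⟩
        exact ⟨⟨c, rfl⟩, (h c).2 hc⟩

/-- The hypothesis says `c𝔞 = 𝔞`; cancelling `𝔞` in the group of fractional ideals gives `(c) =
(1)`. -/
lemma exists_unit_of_ideal (𝔞 : FracIdeal F) (c : F)
    (h : ∀ y : F, y * c ∈ fracSub 𝔞 ↔ y ∈ fracSub 𝔞) (hc : c ≠ 0) : ∃ u : (𝓞 F)ˣ, (u : F) = c := by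
  have hid : FractionalIdeal.spanSingleton (𝓞 F)⁰ c * (𝔞 : FractionalIdeal (𝓞 F)⁰ F) = 𝔞 := by
    ext x
    rw [FractionalIdeal.mem_singleton_mul]
    constructor
    · rintro ⟨a, ha, rfl⟩
      rw [mul_comm]
      exact (h a).2 ha
    · intro hx
      refine ⟨x * c⁻¹, (h _).1 ?_, ?_⟩
      · rwa [inv_mul_cancel_right₀ hc]
      · rw [mul_comm, inv_mul_cancel_right₀ hc]
  have h3 : FractionalIdeal.spanSingleton (𝓞 F)⁰ c = 1 := by
    have := congrArg (· * ((𝔞⁻¹ : FracIdeal F) : FractionalIdeal (𝓞 F)⁰ F)) hid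
    simpa [mul_assoc] using this
  have h4 : c ∈ (1 : FractionalIdeal (𝓞 F)⁰ F) := by
    rw [← h3]; exact FractionalIdeal.mem_spanSingleton_self _ _
  have h5 : (1 : F) ∈ FractionalIdeal.spanSingleton (𝓞 F)⁰ c := by
    rw [h3]; exact FractionalIdeal.one_mem_one _
  obtain ⟨a, ha⟩ := (FractionalIdeal.mem_one_iff _).1 h4
  obtain ⟨r, hr⟩ := (FractionalIdeal.mem_spanSingleton _).1 h5
  have h6 : r * a = 1 := by
    apply RingOfIntegers.ext
    change algebraMap (𝓞 F) F (r * a) = algebraMap (𝓞 F) F 1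
    rw [map_mul, map_one, ha, ← Algebra.smul_def, hr]
  exact ⟨⟨a, r, by rw [mul_comm]; exact h6, h6⟩, ha⟩

lemma unit_smul_mem_iff (𝔞 : FracIdeal F) (u : (𝓞 F)ˣ) (y : F) :
    y * (u : F) ∈ fracSub 𝔞 ↔ y ∈ fracSub 𝔞 := by
  have h : ∀ (v : (𝓞 F)ˣ) (z : F), z ∈ fracSub 𝔞 → z * (v : F) ∈ fracSub 𝔞 := fun v z hz => by
    rw [mul_comm]
    exact (fracSub 𝔞).smul_mem (v : 𝓞 F) hz
  refine ⟨fun hy => ?_, h u y⟩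
  have := h u⁻¹ _ hy
  rwa [mul_assoc, ← Units.coe_mul, mul_inv_cancel, Units.coe_one, mul_one] at this

lemma mem_stab_iff {M : Submodule (𝓞 F) (Fin n → F)} {γ : Matrix.SpecialLinearGroup (Fin n) F} :
    γ ∈ stab M ↔ ∀ v, v ᵥ* γ.1 ∈ M ↔ v ∈ M := by
  have hinv : ∀ v : Fin n → F, (v ᵥ* (γ⁻¹).1) ᵥ* γ.1 = v := fun v => by
    rw [Matrix.vecMul_vecMul, ← Matrix.SpecialLinearGroup.coe_mul, inv_mul_cancel,
      Matrix.SpecialLinearGroup.coe_one, Matrix.vecMul_one]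
  have hinv' : ∀ v : Fin n → F, (v ᵥ* γ.1) ᵥ* (γ⁻¹).1 = v := fun v => by
    rw [Matrix.vecMul_vecMul, ← Matrix.SpecialLinearGroup.coe_mul, mul_inv_cancel,
      Matrix.SpecialLinearGroup.coe_one, Matrix.vecMul_one]
  change M.map (rightMul γ) = M ↔ _
  constructor
  · intro h v
    constructor
    · intro hv
      rw [← h] at hv
      obtain ⟨x, hx, hxv⟩ := hv
      have : x = v := by
        rw [← hinv' x, ← hinv' v]
        exact congrArg (· ᵥ* (γ⁻¹).1) hxv
      exact this ▸ hx
    · intro hv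
      rw [← h]
      exact ⟨v, hv, rfl⟩
  · intro h
    ext v
    constructor
    · rintro ⟨x, hx, rfl⟩
      exact (h x).2 hx
    · intro hv
      exact ⟨v ᵥ* (γ⁻¹).1, (h _).1 (by rwa [hinv]), hinv v⟩

namespace ParabolicDatum

variable {L : Submodule (𝓞 F) (Fin n → F)} (D : ParabolicDatum L)

lemma exists_den (a : F) : ∃ d : 𝓞 F, d ≠ 0 ∧ ∃ b : 𝓞 F, d • a = algebraMap (𝓞 F) F b := by
  obtain ⟨⟨b, d⟩, h⟩ := IsLocalization.surj (𝓞 F)⁰ a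
  exact ⟨d, nonZeroDivisors.coe_ne_zero d, b, by rw [Algebra.smul_def, mul_comm]; exact h⟩

/-- Clearing a denominator of `a` reduces this to `𝓞_F`-linearity, since `F^n` is torsion-free. -/
lemma hom_apply (a : fracSub D.ideal) : (D.hom a : Fin n → F) = (a : F) • D.e := by
  obtain ⟨d, hd, b, hb⟩ := exists_den (a : F)
  have h1 : d • a = b • (⟨1, D.one_mem⟩ : fracSub D.ideal) := by
    apply Subtype.ext
    change d • (a : F) = b • (1 : F)
    rw [hb, Algebra.smul_def, mul_one]
  have h2 := congrArg (fun x => (D.hom x : Fin n → F)) h1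
  simp only [map_smul, Submodule.coe_smul] at h2
  apply smul_right_injective (Fin n → F) hd
  change d • (D.hom a : Fin n → F) = d • (a : F) • D.e
  rw [h2, ← smul_assoc, hb, algebraMap_smul]
  rfl

/-- The splitting enters here: a retraction `r : L → 𝔞` sends `c e` to `c`, again after clearing
denominators, so `c` must lie in `𝔞`. -/
lemma smul_e_mem_iff (c : F) : c • D.e ∈ L ↔ c ∈ fracSub D.ideal := by
  constructor
  · intro hc
    obtain ⟨r, hr⟩ := D.split
    obtain ⟨d, hd, b, hb⟩ := exists_den c
    have h1 : d • (⟨c • D.e, hc⟩ : L) = D.hom (b • ⟨1, D.one_mem⟩) := by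
      apply Subtype.ext
      rw [map_smul]
      change d • (c • D.e) = b • D.e
      rw [← smul_assoc, hb, algebraMap_smul]
    have h2 := congrArg r h1
    have h3 : r (D.hom (b • ⟨1, D.one_mem⟩)) = b • ⟨1, D.one_mem⟩ := LinearMap.congr_fun hr _
    rw [map_smul, h3] at h2
    have h4 := congrArg Subtype.val h2
    change d • (r ⟨c • D.e, hc⟩ : F) = b • (1 : F) at h4
    rw [Algebra.smul_def b, mul_one, ← hb] at h4
    rw [← smul_right_injective F hd h4]
    exact (r _).2
  · intro hc
    rw [← D.hom_apply ⟨c, hc⟩]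
    exact (D.hom _).2

lemma vecMul_e_ne_zero (γ : Matrix.SpecialLinearGroup (Fin n) F) : D.e ᵥ* γ.1 ≠ 0 := by
  intro h
  apply D.e_ne_zero
  have := congrArg (· ᵥ* (γ⁻¹).1) h
  simpa only [Matrix.vecMul_vecMul, ← Matrix.SpecialLinearGroup.coe_mul, mul_inv_cancel,
    Matrix.SpecialLinearGroup.coe_one, Matrix.vecMul_one, Matrix.zero_vecMul] using this

lemma smul_vecMul_e_mem_iff {γ : Matrix.SpecialLinearGroup (Fin n) F} (hγ : γ ∈ stab L) (c : F) :
    c • (D.e ᵥ* γ.1) ∈ L ↔ c ∈ fracSub D.ideal := by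
  rw [← Matrix.smul_vecMul, mem_stab_iff.1 hγ, smul_e_mem_iff]

/-- An element of `Γ_L` lies in the parabolic subgroup if and only if it multiplies `e` by a
unit. -/
lemma mem_parabolic_iff (γ : stab L) :
    γ ∈ D.parabolic ↔ ∃ u : (𝓞 F)ˣ, D.e ᵥ* γ.1.1 = (u : F) • D.e := by
  change γ.1 ∈ stab D.line ↔ _
  constructor
  · intro h
    obtain ⟨c, hc, -⟩ := D.exists_unit γ.1 h
    have hc0 : c ≠ 0 := by
      rintro rfl
      exact D.vecMul_e_ne_zero γ.1 (by rw [hc, zero_smul])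
    obtain ⟨u, hu⟩ := exists_unit_of_ideal D.ideal c (fun y => by
      rw [← D.smul_vecMul_e_mem_iff γ.2 y, hc, smul_smul, D.smul_e_mem_iff]) hc0
    exact ⟨u, by rw [hu, hc]⟩
  · rintro ⟨u, hu⟩
    change D.line.map (rightMul γ.1) = D.line
    have hsm : ∀ a : F, rightMul γ.1 (a • D.e) = (a * u) • D.e := by
      intro a
      change (a • D.e) ᵥ* γ.1.1 = _
      rw [Matrix.smul_vecMul, hu, smul_smul]
    ext y
    rw [Submodule.mem_map, D.mem_line]
    constructor
    · rintro ⟨x, hx, rfl⟩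
      obtain ⟨a, ha, rfl⟩ := D.mem_line.1 hx
      exact ⟨a * u, (unit_smul_mem_iff _ u a).2 ha, (hsm a).symm⟩
    · rintro ⟨a, ha, rfl⟩
      have h1 : a * ((u⁻¹ : (𝓞 F)ˣ) : F) * u = a := by
        rw [mul_assoc, ← Units.coe_mul, inv_mul_cancel, Units.coe_one, mul_one]
      exact ⟨(a * ((u⁻¹ : (𝓞 F)ˣ) : F)) • D.e, D.mem_line.2 ⟨_, (unit_smul_mem_iff _ _ _).2 ha, rfl⟩,
        by rw [hsm, h1]⟩

end ParabolicDatum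

variable (F) in
/-- Two elements of `𝔄_𝔞` are identified if they differ by a unit of `F`. -/
def baseSetoid (𝔄 : FracIdeal E) (𝔞 : FracIdeal F) : Setoid (partOf 𝔄 𝔞) where
  r x y := ∃ u : (𝓞 F)ˣ, (u : F) • (x : E) = y
  iseqv :=
    { refl := fun x => ⟨1, by simp⟩
      symm := by
        rintro x y ⟨u, hu⟩
        refine ⟨u⁻¹, ?_⟩
        rw [← hu, smul_smul, ← Units.coe_mul, inv_mul_cancel, Units.coe_one, one_smul]
      trans := by
        rintro x y z ⟨u, hu⟩ ⟨v, hv⟩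
        refine ⟨v * u, ?_⟩
        rw [← hv, ← hu, Units.coe_mul, mul_smul] }

/-- The quotient `𝓞_F^× \ 𝔄_𝔞`. -/
abbrev BaseOrbits (𝔄 : FracIdeal E) (𝔞 : FracIdeal F) : Type _ := Quotient (baseSetoid F 𝔄 𝔞)


lemma mem_partOf_iff {𝔄 : FracIdeal E} {𝔞 : FracIdeal F} (h1 : AntiIntegral 𝔞) {x : E} :
    x ∈ partOf 𝔄 𝔞 ↔ x ≠ 0 ∧ ∀ c : F, c • x ∈ fracSub 𝔄 ↔ c ∈ fracSub 𝔞 :=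
  mem_idealPart_iff (M := fracRestrict F 𝔄) h1

lemma mem_latticeOf (w : Module.Basis (Fin n) F E) (𝔄 : FracIdeal E) (x : Fin n → F) :
    x ∈ latticeOf w 𝔄 ↔ w.equivFun.symm x ∈ fracSub 𝔄 := Iff.rfl

section Orbits

variable {w : Module.Basis (Fin n) F E} {𝔄 : FracIdeal E} (D : ParabolicDatum (latticeOf w 𝔄))

/-- The element of `𝔄_𝔞` corresponding to `e γ`. -/
def orbitPoint (γ : stab (latticeOf w 𝔄)) : partOf 𝔄 D.ideal :=
  ⟨w.equivFun.symm (D.e ᵥ* γ.1.1), (mem_partOf_iff D.one_mem).2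
    ⟨fun h => D.vecMul_e_ne_zero γ.1 (w.equivFun.symm.map_eq_zero_iff.1 h), fun c => by
      rw [← map_smul, ← mem_latticeOf, D.smul_vecMul_e_mem_iff γ.2]⟩⟩

/-- The map `P \ Γ_L → 𝓞_F^× \ 𝔄_𝔞`, `γ ↦ e γ`. -/
def orbitMap : Quotient (QuotientGroup.rightRel D.parabolic) → BaseOrbits 𝔄 D.ideal :=
  Quotient.map (orbitPoint D) (by
    intro γ δ h
    obtain ⟨u, hu⟩ := (D.mem_parabolic_iff _).1 (QuotientGroup.rightRel_apply.1 h)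
    refine ⟨u, ?_⟩
    change (u : F) • w.equivFun.symm (D.e ᵥ* γ.1.1) = w.equivFun.symm (D.e ᵥ* δ.1.1)
    rw [← map_smul, ← Matrix.smul_vecMul, ← hu, Matrix.vecMul_vecMul]
    congr 2
    rw [← Matrix.SpecialLinearGroup.coe_mul, ← Subgroup.coe_mul, inv_mul_cancel_right])

lemma orbitMap_injective : Function.Injective (orbitMap D) := by
  intro a b
  induction a using Quotient.inductionOn with | h γ => ?_
  induction b using Quotient.inductionOn with | h δ => ?_
  intro h
  obtain ⟨u, hu⟩ := Quotient.exact h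
  change (u : F) • w.equivFun.symm (D.e ᵥ* γ.1.1) = w.equivFun.symm (D.e ᵥ* δ.1.1) at hu
  rw [← map_smul] at hu
  have hu' := w.equivFun.symm.injective hu
  refine Quotient.sound (QuotientGroup.rightRel_apply.2 ((D.mem_parabolic_iff _).2 ⟨u, ?_⟩))
  rw [Subgroup.coe_mul, Matrix.SpecialLinearGroup.coe_mul, ← Matrix.vecMul_vecMul, ← hu',
    Matrix.smul_vecMul, Matrix.vecMul_vecMul, ← Matrix.SpecialLinearGroup.coe_mul,
    ← Subgroup.coe_mul, mul_inv_cancel, Subgroup.coe_one, Matrix.SpecialLinearGroup.coe_one,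
    Matrix.vecMul_one]

variable (w 𝔄) in
lemma latticeOf_fg : (latticeOf w 𝔄).FG := by
  have h1 : (fracSub 𝔄).FG := FractionalIdeal.fg_of_isUnit _ 𝔄.isUnit
  have h2 : Module.Finite (𝓞 F) (𝓞 E) := Module.Finite.of_restrictScalars_finite ℤ (𝓞 F) (𝓞 E)
  have h3 : (fracRestrict F 𝔄).FG := by
    have h4 : Module.Finite (𝓞 E) (fracSub 𝔄) := Module.Finite.iff_fg.2 h1
    have h5 : Module.Finite (𝓞 F) (fracSub 𝔄) := Module.Finite.trans (𝓞 E) _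
    exact Module.Finite.iff_fg.1 (show Module.Finite (𝓞 F) (fracRestrict F 𝔄) from h5)
  have h6 : latticeOf w 𝔄 = (fracRestrict F 𝔄).map (w.equivFun.toLinearMap.restrictScalars (𝓞 F)) := by
    ext x
    rw [mem_latticeOf, Submodule.mem_map]
    constructor
    · intro h
      exact ⟨_, h, w.equivFun.apply_symm_apply x⟩
    · rintro ⟨y, hy, rfl⟩
      change w.equivFun.symm (w.equivFun y) ∈ _
      rw [LinearEquiv.symm_apply_apply]
      exact hy
  rw [h6]
  exact h3.map _

variable (w 𝔄) in
-- With `a ≠ 0` in `𝔄`, any `x / a` in `E` becomes integral after multiplication by a non-zero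
-- integer, so a multiple of `x` lies in `𝔄`.
lemma span_latticeOf : Submodule.span F (latticeOf w 𝔄 : Set (Fin n → F)) = ⊤ := by
  rw [eq_top_iff]
  intro x _
  obtain ⟨a, ha, ha0⟩ : ∃ a ∈ fracSub 𝔄, a ≠ 0 := by
    by_contra! h
    exact 𝔄.ne_zero (FractionalIdeal.eq_zero_iff.2 h)
  have halg : IsAlgebraic ℤ (w.equivFun.symm x / a) :=
    (IsFractionRing.isAlgebraic_iff ℤ ℚ E).2 (Algebra.IsAlgebraic.isAlgebraic _)
  obtain ⟨d, hd, hint⟩ := halg.exists_integral_multiple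
  have h1 : (d : F) • x ∈ latticeOf w 𝔄 := by
    rw [mem_latticeOf, map_smul]
    have : (d : F) • w.equivFun.symm x = (⟨_, hint⟩ : 𝓞 E) • a := by
      rw [Algebra.smul_def, Algebra.smul_def]
      change _ = (d • (w.equivFun.symm x / a)) * a
      rw [zsmul_eq_mul, mul_assoc, div_mul_cancel₀ _ ha0, map_intCast]
    rw [this]
    exact (fracSub 𝔄).smul_mem _ ha
  have h2 : x = (d : F)⁻¹ • (d : F) • x := by
    rw [smul_smul, inv_mul_cancel₀ (by exact_mod_cast hd), one_smul]
  rw [h2]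
  exact Submodule.smul_mem _ _ (Submodule.subset_span h1)

/-- The target vector has the same coefficient ideal as `e`, so transitivity of the automorphisms of
the lattice applies in rank at least two. The automorphism preserves `L` and has determinant one, so
it comes from `Γ_L`. -/
lemma orbitMap_surjective : Function.Surjective (orbitMap D) := by
  intro q
  induction q using Quotient.inductionOn with | h y => ?_
  obtain ⟨y, hy⟩ := y
  obtain ⟨hy0, hyI⟩ := (mem_partOf_iff D.one_mem).1 hy
  set v := w.equivFun y with hv
  have hvy : w.equivFun.symm v = y := w.equivFun.symm_apply_apply y
  have hv0 : v ≠ 0 := by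
    intro h
    rw [h, map_zero] at hvy
    exact hy0 hvy.symm
  have hvI : ∀ c : F, c • v ∈ latticeOf w 𝔄 ↔ c ∈ fracSub D.ideal := by
    intro c
    rw [mem_latticeOf, map_smul, hvy, hyI]
  rcases n with _ | _ | m
  · exact absurd (Subsingleton.elim v 0) hv0
  -- In rank one `Γ_L` is trivial, but then `v` is a multiple of `e` and, both having coefficient
  -- ideal `𝔞`, the ratio is a unit of `F`.
  · have hsub : Subsingleton (Fin (0 + 1)) := inferInstanceAs (Subsingleton (Fin 1))
    obtain ⟨c, hc⟩ : ∃ c : F, v = c • D.e := by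
      have he : D.e 0 ≠ 0 := by
        intro h
        apply D.e_ne_zero
        funext i
        rw [Subsingleton.elim i 0, h]
        rfl
      refine ⟨v 0 / D.e 0, ?_⟩
      funext i
      rw [Subsingleton.elim i 0]
      simp [he]
    have hc0 : c ≠ 0 := by
      rintro rfl
      exact hv0 (by rw [hc, zero_smul])
    obtain ⟨u, hu⟩ := exists_unit_of_ideal D.ideal c (fun z =>
      (D.smul_e_mem_iff (z * c)).symm.trans (by rw [mul_smul, ← hc, hvI])) hc0
    refine ⟨Quotient.mk _ 1, Quotient.sound ⟨u, ?_⟩⟩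
    change (u : F) • w.equivFun.symm (D.e ᵥ* (1 : Matrix (Fin 1) (Fin 1) F)) = y
    rw [Matrix.vecMul_one, ← map_smul, hu, ← hc, hvy]
  · obtain ⟨g, hge, hgL, hdet⟩ := exists_automorphism (m := m) (latticeOf_fg w 𝔄) (span_latticeOf w 𝔄)
      (by simp) D.ideal D.e_ne_zero hv0 D.smul_e_mem_iff hvI
    let γ : Matrix.SpecialLinearGroup (Fin (m + 2)) F :=
      ⟨(LinearMap.toMatrix' g)ᵀ, by rw [Matrix.det_transpose, LinearMap.det_toMatrix', hdet]⟩
    have hγ : ∀ x, x ᵥ* γ.1 = g x := by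
      intro x
      change x ᵥ* (LinearMap.toMatrix' g)ᵀ = _
      rw [Matrix.vecMul_transpose, LinearMap.toMatrix'_mulVec]
    refine ⟨Quotient.mk _ ⟨γ, mem_stab_iff.2 fun x => by rw [hγ, hgL]⟩, Quotient.sound ⟨1, ?_⟩⟩
    change ((1 : (𝓞 F)ˣ) : F) • w.equivFun.symm (D.e ᵥ* γ.1) = y
    rw [hγ, hge, hvy, Units.coe_one, one_smul]

/-- The bijection `P \ Γ_L ≃ 𝓞_F^× \ 𝔄_𝔞`. -/
def orbitEquiv : Quotient (QuotientGroup.rightRel D.parabolic) ≃ BaseOrbits 𝔄 D.ideal :=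
  Equiv.ofBijective (orbitMap D) ⟨orbitMap_injective D, orbitMap_surjective D⟩

end Orbits

variable (F E) in
/-- The image of `𝓞_F^×` in `𝓞_E^×`. -/
def baseUnits : Subgroup (𝓞 E)ˣ := (Units.map (algebraMap (𝓞 F) (𝓞 E)).toMonoidHom).range

lemma unit_smul_mem_partOf {𝔄 : FracIdeal E} {𝔞 : FracIdeal F} (h1 : AntiIntegral 𝔞)
    (u : (𝓞 E)ˣ) (x : partOf 𝔄 𝔞) : (u : E) * x ∈ partOf 𝔄 𝔞 := by
  obtain ⟨hx0, hx⟩ := (mem_partOf_iff h1).1 x.2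
  refine (mem_partOf_iff h1).2 ⟨mul_ne_zero (Units.coe_ne_zero u) hx0, fun c => ?_⟩
  rw [← hx, mul_comm, ← smul_mul_assoc, unit_smul_mem_iff]

variable {𝔄 : FracIdeal E} {𝔞 : FracIdeal F}

/-- `𝔄_𝔞` is the disjoint union of its `𝓞_E^×`-orbits, and each of these is a principal homogeneous
space. -/
def orbitSplit (h1 : AntiIntegral 𝔞) (p : UnitOrbits 𝔄 𝔞 × ((𝓞 E)ˣ ⧸ baseUnits F E)) :
    BaseOrbits 𝔄 𝔞 :=
  Quotient.mk _ ⟨(p.2.out : E) * (p.1.out : E), unit_smul_mem_partOf h1 _ _⟩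

/-- Units of `E` act freely on non-zero elements. Choosing a representative in a class modulo
`𝓞_F^×` changes the product only by a unit of `F`, which the target forgets. -/
lemma orbitSplit_bijective (h1 : AntiIntegral 𝔞) :
    Function.Bijective (orbitSplit (𝔄 := 𝔄) h1) := by
  constructor
  · rintro ⟨x, c⟩ ⟨y, d⟩ h
    obtain ⟨u, hu⟩ := Quotient.exact h
    change (u : F) • ((c.out : E) * (x.out : E)) = (d.out : E) * (y.out : E) at hu
    let u' : (𝓞 E)ˣ := Units.map (algebraMap (𝓞 F) (𝓞 E)).toMonoidHom u
    have hu' : (u' : E) = algebraMap F E u := rfl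
    rw [Algebra.smul_def, ← hu', ← mul_assoc, ← Units.coe_mul] at hu
    have hxy : x = y := by
      rw [← Quotient.out_eq x, ← Quotient.out_eq y]
      refine Quotient.sound ⟨d.out⁻¹ * (u' * c.out), ?_⟩
      rw [Units.coe_mul, mul_assoc, hu, ← mul_assoc, ← Units.coe_mul, inv_mul_cancel, Units.coe_one,
        one_mul]
    subst hxy
    have hx0 : (x.out : E) ≠ 0 := ((mem_partOf_iff h1).1 x.out.2).1
    have h2 := Units.coe_injective E (mul_right_cancel₀ hx0 hu)
    rw [Prod.mk.injEq]
    refine ⟨rfl, ?_⟩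
    rw [← QuotientGroup.out_eq' c, ← QuotientGroup.out_eq' d, QuotientGroup.eq]
    refine ⟨u, ?_⟩
    change u' = _
    rw [← h2, mul_comm u', inv_mul_cancel_left]
  · intro q
    induction q using Quotient.inductionOn with | h y => ?_
    obtain ⟨v, hv⟩ : ∃ v : (𝓞 E)ˣ, (v : E) * ((Quotient.mk (unitSetoid 𝔄 𝔞) y).out : E) = y :=
      Quotient.exact (Quotient.out_eq (Quotient.mk (unitSetoid 𝔄 𝔞) y))
    refine ⟨⟨Quotient.mk _ y, QuotientGroup.mk v⟩, Quotient.sound ?_⟩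
    obtain ⟨u, hu⟩ := QuotientGroup.eq.1 (QuotientGroup.out_eq' (QuotientGroup.mk v : (𝓞 E)ˣ ⧸ baseUnits F E))
    refine ⟨u, ?_⟩
    have hu' : algebraMap F E u = (((QuotientGroup.mk v : (𝓞 E)ˣ ⧸ baseUnits F E).out⁻¹ * v : (𝓞 E)ˣ) : E) := by
      rw [← hu]; rfl
    change (u : F) • (((QuotientGroup.mk v : (𝓞 E)ˣ ⧸ baseUnits F E).out : E) *
      ((Quotient.mk (unitSetoid 𝔄 𝔞) y).out : E)) = y
    rw [Algebra.smul_def, hu', ← mul_assoc, ← Units.coe_mul, mul_right_comm, inv_mul_cancel, one_mul, hv]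

/-- `𝓞_F^× \ 𝔄_𝔞 ≃ (𝓞_E^× \ 𝔄_𝔞) × (𝓞_E^× / 𝓞_F^×)`. -/
def orbitSplitEquiv (h1 : AntiIntegral 𝔞) :
    UnitOrbits 𝔄 𝔞 × ((𝓞 E)ˣ ⧸ baseUnits F E) ≃ BaseOrbits 𝔄 𝔞 :=
  Equiv.ofBijective _ (orbitSplit_bijective h1)

end Index

/-! ### Complex powers of positive real numbers -/

section Powers

lemma cpow_ofReal_eq_exp {r : ℝ} (hr : 0 < r) (s : ℂ) :
    (r : ℂ) ^ s = Complex.exp (Real.log r * s) := by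
  rw [Complex.cpow_def_of_ne_zero (by exact_mod_cast hr.ne'), Complex.ofReal_log hr.le]

lemma ofReal_rpow_cpow {r : ℝ} (hr : 0 < r) (a : ℝ) (s : ℂ) :
    ((r ^ a : ℝ) : ℂ) ^ s = (r : ℂ) ^ (a * s) := by
  rw [cpow_ofReal_eq_exp hr, cpow_ofReal_eq_exp (Real.rpow_pos_of_pos hr a), Real.log_rpow hr]
  push_cast
  ring_nf

lemma ofReal_pow_cpow {r : ℝ} (hr : 0 < r) (m : ℕ) (s : ℂ) :
    ((r ^ m : ℝ) : ℂ) ^ s = (r : ℂ) ^ (m * s) := by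
  rw [← Real.rpow_natCast, ofReal_rpow_cpow hr]
  norm_cast

lemma ofReal_mul_cpow {a b : ℝ} (ha : 0 < a) (hb : 0 < b) (s : ℂ) :
    ((a * b : ℝ) : ℂ) ^ s = (a : ℂ) ^ s * (b : ℂ) ^ s := by
  rw [Complex.ofReal_mul, Complex.mul_cpow_ofReal_nonneg ha.le hb.le]

lemma ofReal_inv_cpow {a : ℝ} (ha : 0 < a) (s : ℂ) :
    ((a⁻¹ : ℝ) : ℂ) ^ s = (a : ℂ) ^ (-s) := by
  have := ofReal_rpow_cpow ha (-1) s
  rw [Real.rpow_neg_one] at this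
  rw [this]
  simp

lemma ofReal_prod_cpow {ι : Type*} (S : Finset ι) (f : ι → ℝ) (hf : ∀ i, 0 < f i) (s : ℂ) :
    ((∏ i ∈ S, f i : ℝ) : ℂ) ^ s = ∏ i ∈ S, (f i : ℂ) ^ s := by
  classical
  induction S using Finset.induction_on with
  | empty => simp
  | insert a S ha ih =>
    rw [Finset.prod_insert ha, Finset.prod_insert ha,
      ofReal_mul_cpow (hf a) (Finset.prod_pos fun i _ => hf i), ih]

end Powers

/-! ### The integrand of the relative gamma factor -/

section GammaIntegrand

variable (k k' : Type*) [Field k] [NumberField k] [Field k'] [NumberField k'] [Algebra k k']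

variable {k k'} in
/-- `∑_{τ|σ} t_τ²` -/
def sqSum (σ : InfinitePlace k) (t : T k') : ℝ := ∑ τ : Above k' σ, (t τ.1 : ℝ) ^ 2

/-- `∏_σ (∑_{τ|σ} t_τ²) ^ (-[k':k] n_σ s / 2)` -/
def gammaFun (s : ℂ) (t : T k') : ℂ :=
  ∏ σ : InfinitePlace k, (sqSum σ t : ℂ) ^ (-(Module.finrank k k' * σ.mult * s / 2))

variable {k k'} in
lemma above_nonempty (σ : InfinitePlace k) : Nonempty (Above k' σ) := by
  have : FiniteDimensional k k' := Module.Finite.of_restrictScalars_finite ℚ k k'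
  obtain ⟨τ, hτ⟩ := InfinitePlace.comap_surjective (K := k') σ
  exact ⟨⟨τ, hτ⟩⟩

variable {k k'} in
lemma sqSum_pos (σ : InfinitePlace k) (t : T k') : 0 < sqSum σ t := by
  have := above_nonempty (k' := k') σ
  exact Finset.sum_pos (fun τ _ => pow_pos (t τ.1).2 2) Finset.univ_nonempty

lemma finrank_pos' : 0 < Module.finrank k k' := by
  have : FiniteDimensional k k' := Module.Finite.of_restrictScalars_finite ℚ k k'
  exact Module.finrank_pos

/-- `∏_σ t_σ ^ n_σ` -/
def absNormT (t : T k) : ℝ := ∏ σ : InfinitePlace k, (t σ : ℝ) ^ σ.mult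

lemma absNormT_mul (t u : T k) : absNormT k (t * u) = absNormT k t * absNormT k u := by
  simp only [absNormT, ← Finset.prod_mul_distrib, ← mul_pow]
  rfl

lemma coe_normT (t : T k') (σ : InfinitePlace k) :
    (normT k k' t σ : ℝ) = ∏ τ : Above k' σ, (t τ.1 : ℝ) ^ relDeg k τ.1 := by
  change ((∏ τ : Above k' σ, t τ.1 ^ relDeg k τ.1 : PosReal) : ℝ) = _
  induction (Finset.univ : Finset (Above k' σ)) using Finset.cons_induction with
  | empty => simp
  | cons a S ha ih => rw [Finset.prod_cons, Finset.prod_cons, ← ih]; rfl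

variable {k'} in
lemma prod_above {M : Type*} [CommMonoid M] (f : InfinitePlace k' → M) :
    ∏ σ : InfinitePlace k, ∏ τ : Above k' σ, f τ.1 = ∏ τ, f τ := by
  classical
  convert Fintype.prod_fiberwise (fun τ : InfinitePlace k' => τ.comap (algebraMap k k')) f

lemma mult_mul_relDeg' (σ : InfinitePlace k) (τ : Above k' σ) :
    σ.mult * relDeg k τ.1 = τ.1.mult := by
  obtain ⟨τ, rfl⟩ := τ
  exact mult_mul_relDeg τ

lemma absNormT_normT (t : T k') : absNormT k (normT k k' t) = absNormT k' t := by
  unfold absNormT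
  rw [← prod_above k fun τ : InfinitePlace k' => (t τ : ℝ) ^ τ.mult]
  refine Finset.prod_congr rfl fun σ _ => ?_
  rw [coe_normT, ← Finset.prod_pow]
  refine Finset.prod_congr rfl fun τ _ => ?_
  rw [← pow_mul, mul_comm, mult_mul_relDeg']

lemma sqSum_rootT_mul (σ : InfinitePlace k) (c : T k) (t : T k') :
    sqSum σ (rootT k k' c * t) = (c σ : ℝ) ^ (2 * (Module.finrank k k' : ℝ)⁻¹) * sqSum σ t := by
  unfold sqSum
  rw [Finset.mul_sum]
  refine Finset.sum_congr rfl fun τ _ => ?_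
  obtain ⟨τ, rfl⟩ := τ
  change ((c _ : ℝ) ^ (Module.finrank k k' : ℝ)⁻¹ * (t τ : ℝ)) ^ 2 = _
  rw [mul_pow, ← Real.rpow_natCast, ← Real.rpow_mul (c _).2.le]
  ring_nf

lemma rootT_mul_toTRel (t : T k') : rootT k k' (normT k k' t) * toTRel k k' t = t := by
  change rootT k k' (normT k k' t) * (t * (rootT k k' (normT k k' t))⁻¹) = t
  rw [mul_comm t, mul_inv_cancel_left]

/-- Homogeneity: `∑ t_τ²` is multiplied by `c_σ ^ (2 / [k':k])`, and the exponent `-[k':k] n_σ s /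
2` turns this into `c_σ ^ (-n_σ s)`. This is the source of `|N x|^{-s}` in the final sum. -/
lemma gammaFun_rootT_mul (s : ℂ) (c : T k) (t : T k') :
    gammaFun k k' s (rootT k k' c * t) = (absNormT k c : ℂ) ^ (-s) * gammaFun k k' s t := by
  have hn : (Module.finrank k k' : ℂ) ≠ 0 := by exact_mod_cast (finrank_pos' k k').ne'
  unfold gammaFun absNormT
  rw [ofReal_prod_cpow _ _ fun σ => pow_pos (c σ).2 _, ← Finset.prod_mul_distrib]
  refine Finset.prod_congr rfl fun σ _ => ?_
  rw [sqSum_rootT_mul, ofReal_mul_cpow (Real.rpow_pos_of_pos (c σ).2 _) (sqSum_pos σ t),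
    ofReal_rpow_cpow (c σ).2, ofReal_pow_cpow (c σ).2]
  congr 2
  push_cast
  field_simp

lemma gammaFun_eq (s : ℂ) (t : T k') :
    gammaFun k k' s t = (absNormT k' t : ℂ) ^ (-s) * gammaFun k k' s (toTRel k k' t) := by
  conv_lhs => rw [← rootT_mul_toTRel k k' t]
  rw [gammaFun_rootT_mul, absNormT_normT]

lemma toTRel_rootT (c : T k) : toTRel k k' (rootT k k' c) = 1 := by
  apply Subtype.ext
  change rootT k k' c * (rootT k k' (normT k k' (rootT k k' c)))⁻¹ = 1
  rw [normT_rootT, mul_inv_cancel]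

lemma toTRel_coe (t : TRel k k') : toTRel k k' (t : T k') = t := by
  apply Subtype.ext
  change (t : T k') * (rootT k k' (normT k k' t))⁻¹ = t
  have : normT k k' t = 1 := t.2
  rw [this, map_one, inv_one, mul_one]

/-- The absolute values of a non-zero element of `k`. -/
def absT : kˣ →* T k where
  toFun u := fun σ => ⟨σ (u : k), InfinitePlace.pos_iff.2 u.ne_zero⟩
  map_one' := by ext σ; simp
  map_mul' u v := by ext σ; simp

lemma absNormT_absT (u : kˣ) : absNormT k (absT k u) = |Algebra.norm ℚ (u : k)| :=
  InfinitePlace.prod_eq_abs_norm (u : k)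

/-- A place above `σ` restricts to `σ` without a root being taken, while `rootT` takes the root of
order `[k':k]`; hence the compensating power. In particular elements of `k` become trivial in
`T_{k'/k}`. -/
lemma absT_algebraMap (u : kˣ) :
    absT k' (Units.map (algebraMap k k').toMonoidHom u) =
      rootT k k' (absT k u ^ Module.finrank k k') := by
  funext τ
  apply Subtype.ext
  change τ (algebraMap k k' u) = (((absT k u (τ.comap (algebraMap k k')) : PosReal) : ℝ) ^
    Module.finrank k k') ^ (Module.finrank k k' : ℝ)⁻¹
  rw [Real.pow_rpow_inv_natCast (absT k u _).2.le (finrank_pos' k k').ne']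
  rfl

/-- The projection of the absolute values of a unit. -/
def unitProj : (𝓞 k')ˣ →* TRel k k' := (toTRel k k').comp (regMap k')

lemma regMap_eq_absT (u : (𝓞 k)ˣ) :
    regMap k u = absT k (Units.map (algebraMap (𝓞 k) k).toMonoidHom u) := rfl

lemma absNormT_regMap (u : (𝓞 k)ˣ) : absNormT k (regMap k u) = 1 := by
  rw [regMap_eq_absT, absNormT_absT]
  change ((|Algebra.norm ℚ (u : k)| : ℚ) : ℝ) = 1
  rw [abs_norm_unit]
  simp

lemma regMap_baseUnits (u : (𝓞 k)ˣ) :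
    regMap k' (Units.map (algebraMap (𝓞 k) (𝓞 k')).toMonoidHom u) =
      rootT k k' (regMap k u ^ Module.finrank k k') := by
  rw [regMap_eq_absT k, ← absT_algebraMap]
  rfl

lemma baseUnits_le_ker : baseUnits k k' ≤ (unitProj k k').ker := by
  rintro _ ⟨u, rfl⟩
  rw [MonoidHom.mem_ker]
  change toTRel k k' (regMap k' _) = 1
  rw [regMap_baseUnits, toTRel_rootT]

/-- The homomorphism `𝓞_{k'}^× / 𝓞_k^× → T_{k'/k}`. -/
def quotProj : (𝓞 k')ˣ ⧸ baseUnits k k' →* TRel k k' :=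
  QuotientGroup.lift _ (unitProj k k') (baseUnits_le_ker k k')

end GammaIntegrand

/-! ### The Eisenstein series at the Heegner points -/

section HeegnerValues

variable {F E : Type*} [Field F] [NumberField F] [Field E] [NumberField E] [Algebra F E] {n : ℕ}

lemma Frame.sum_norm_coord {σ : InfinitePlace F} (τ : Above E σ) (a : ℂ) :
    ∑ j : Fin (relDeg F τ.1), ‖Frame.coord ⟨τ, j⟩ a‖ ^ 2 = ‖a‖ ^ 2 := by
  unfold Frame.coord
  rcases Frame.relDeg_cases τ with h1 | h1
  · simp [h1.1]
  · simp only [h1.1, OfNat.ofNat_ne_one, if_false]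
    have hs : ∀ f : ℕ → ℝ, ∑ j : Fin (relDeg F τ.1), f j = f 0 + f 1 := by
      intro f
      rw [Fin.sum_univ_eq_sum_range f, h1.1, Finset.sum_range_succ, Finset.sum_range_one]
    rw [hs fun j => ‖(if j = 0 then (a.im : ℂ) else (a.re : ℂ))‖ ^ 2]
    simp only [if_true, one_ne_zero, if_false, Complex.norm_real, Real.norm_eq_abs, sq_abs]
    rw [← Complex.normSq_eq_norm_sq, Complex.normSq_apply]
    ring

/-- The entries of `x W I(t)` at `σ` are the real or complex coordinates of the numbers `t_τ ξ ∈
E_τ`, `τ | σ`, and the coordinate maps `E_τ ≃ F_σ^{n_{τ|σ}}` are isometries. -/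
lemma Frame.locNorm_sq (fr : Frame F E n) (w : Module.Basis (Fin n) F E) (t : TRel F E)
    (σ : InfinitePlace F) (x : Fin n → F) (ξ : Eˣ) (hξ : w.equivFun.symm x = ξ) :
    locNorm ((toLoc (fr.embF σ) ∘ x) ᵥ* ((fr.W w * fr.I t) σ).1) ^ 2 =
      sqSum σ (absT E ξ * (t : T E)) := by
  unfold locNorm
  rw [EuclideanSpace.norm_sq_eq]
  have h1 : ∀ j : Fin n, ((((toLoc (fr.embF σ) ∘ x) ᵥ* ((fr.W w * fr.I t) σ).1) j :
      locField (fr.embF σ)) : ℂ) = Frame.coord ((fr.index σ).symm j)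
        (fr.embE ((fr.index σ).symm j).1.1 ξ) * (((t : T E) ((fr.index σ).symm j).1.1 : ℝ) : ℂ) := by
    intro j
    have : ((((toLoc (fr.embF σ) ∘ x) ᵥ* ((fr.W w * fr.I t) σ).1) j :
      locField (fr.embF σ)) : ℂ) = ∑ i, (toLoc (fr.embF σ) (x i) : ℂ) *
        (((fr.W w * fr.I t) σ).1 i j : ℂ) := by
      simp [Matrix.vecMul, dotProduct]
    rw [this]
    simp_rw [fr.entry_W_I w t σ, ← mul_assoc]
    rw [← Finset.sum_mul, ← fr.coord_sum]
    congr 2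
    rw [← hξ, Module.Basis.equivFun_symm_apply, map_sum]
    refine Finset.sum_congr rfl fun k _ => ?_
    rw [Algebra.smul_def, map_mul, fr.compat']
    rfl
  simp only [h1]
  rw [← (fr.index σ).sum_comp]
  simp_rw [Equiv.symm_apply_apply]
  rw [Fintype.sum_sigma]
  refine Finset.sum_congr rfl fun τ _ => ?_
  simp_rw [norm_mul, mul_pow]
  rw [← Finset.sum_mul, Frame.sum_norm_coord]
  change _ = (τ.1 (ξ : E) * ((t : T E) τ.1 : ℝ)) ^ 2
  rw [mul_pow]
  congr 2
  · conv_rhs => rw [← fr.mk_embE τ.1]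
    rfl
  · simp [((t : T E) τ.1).2.le]

/-- The determinant of `I(t)_σ` is `∏ t_τ ^ n_{τ|σ}`, which is `1` because `t` lies in the kernel of
the norm. -/
lemma Frame.norm_det (fr : Frame F E n) (w : Module.Basis (Fin n) F E) (t : TRel F E)
    (σ : InfinitePlace F) :
    ‖((((fr.W w * fr.I t) σ).1.det : locField (fr.embF σ)) : ℂ)‖ =
      ‖(((fr.W w) σ).1.det : ℂ)‖ := by
  have h1 : ((fr.W w * fr.I t) σ).1 = ((fr.W w) σ).1 * ((fr.I t) σ).1 := rfl
  have h2 : ((((fr.I t) σ).1.det : locField (fr.embF σ)) : ℂ) = 1 := by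
    change (((Matrix.diagonal _).det : locField (fr.embF σ)) : ℂ) = 1
    rw [Matrix.det_diagonal]
    rw [← (fr.index σ).prod_comp]
    simp_rw [Equiv.symm_apply_apply]
    rw [Fintype.prod_sigma]
    have h3 := congrArg Subtype.val (congrFun (show normT F E t = 1 from t.2) σ)
    rw [coe_normT] at h3
    rw [← Subfield.subtype_apply, map_prod]
    simp_rw [map_prod]
    change ∏ τ : Above E σ, ∏ _j : Fin (relDeg F τ.1), (((t : T E) τ.1 : ℝ) : ℂ) = 1
    simp only [Finset.prod_const, Finset.card_univ, Fintype.card_fin]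
    exact_mod_cast h3
  rw [h1, Matrix.det_mul, Subfield.coe_mul, h2, mul_one]

lemma sqrt_abs_discW (fr : Frame F E n) (w : Module.Basis (Fin n) F E) :
    |discW fr w| = (∏ σ : InfinitePlace F, ‖(((fr.W w) σ).1.det : ℂ)‖ ^ σ.mult) ^ 2 := by
  unfold discW
  rw [Finset.abs_prod, ← Finset.prod_pow]
  refine Finset.prod_congr rfl fun σ _ => ?_
  split_ifs with h
  · have h1 := fr.locField_real h ((fr.W w) σ).1.det
    set z := ((((fr.W w) σ).1.det : locField (fr.embF σ)) : ℂ)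
    have hz : z = (z.re : ℂ) := Complex.ext rfl (by simpa using h1)
    rw [h.mult_eq_one, pow_one, hz, ← Complex.ofReal_pow, Complex.ofReal_re, abs_pow,
      Complex.norm_real, Real.norm_eq_abs]
  · rw [(InfinitePlace.not_isReal_iff_isComplex.1 h).mult_eq_two, Complex.normSq_eq_norm_sq,
      norm_pow, abs_of_nonneg (by positivity)]

/-- Since `γ` has determinant one, it only replaces `e` by `eγ`; the square root in the Euclidean
norm accounts for the `2` in the exponents of `gammaFun`. -/
lemma eisTerm_heegner (fr : Frame F E n) (w : Module.Basis (Fin n) F E) {𝔄 : FracIdeal E}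
    (D : ParabolicDatum (latticeOf w 𝔄)) (s : ℂ) (t : TRel F E) (γ : stab (latticeOf w 𝔄)) (ξ : Eˣ)
    (hξ : w.equivFun.symm (D.e ᵥ* γ.1.1) = ξ) :
    eisTerm fr.embF fr.mk_embF D (fr.heegner w t) s (Quotient.mk _ γ) =
      ((|discW fr w| : ℝ) : ℂ) ^ (s / 2) * gammaFun F E s (absT E ξ * (t : T E)) := by
  have hn : Module.finrank F E = n := by simpa using Module.finrank_eq_card_basis w
  change ((detFun fr.embF D.e (toGInf fr.embF γ.1 * (fr.W w * fr.I t)) : ℝ) : ℂ) ^ s = _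
  have hdet : ∀ σ, ‖((((toGInf fr.embF γ.1 * (fr.W w * fr.I t)) σ).1.det :
      locField (fr.embF σ)) : ℂ)‖ = ‖(((fr.W w) σ).1.det : ℂ)‖ := by
    intro σ
    have h1 : ((toGInf fr.embF γ.1 * (fr.W w * fr.I t)) σ).1 =
      ((toLoc (fr.embF σ)).mapMatrix γ.1.1) * ((fr.W w * fr.I t) σ).1 := rfl
    rw [h1, Matrix.det_mul, ← RingHom.map_det, γ.1.2, map_one, one_mul, fr.norm_det]
  have hvec : ∀ σ, (toLoc (fr.embF σ) ∘ D.e) ᵥ* ((toGInf fr.embF γ.1 * (fr.W w * fr.I t)) σ).1 =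
      (toLoc (fr.embF σ) ∘ (D.e ᵥ* γ.1.1)) ᵥ* ((fr.W w * fr.I t) σ).1 := by
    intro σ
    have h1 : ((toGInf fr.embF γ.1 * (fr.W w * fr.I t)) σ).1 =
      γ.1.1.map (toLoc (fr.embF σ)) * ((fr.W w * fr.I t) σ).1 := rfl
    rw [h1, ← Matrix.vecMul_vecMul]
    congr 1
    funext i
    exact (RingHom.map_vecMul (toLoc (fr.embF σ)) γ.1.1 D.e i).symm
  have hW : ∀ σ, 0 < ‖(((fr.W w) σ).1.det : ℂ)‖ := by
    intro σ
    rw [norm_pos_iff]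
    exact_mod_cast fr.det_heegMatrix_ne_zero w σ
  have hnorm : ∀ σ, locNorm ((toLoc (fr.embF σ) ∘ D.e) ᵥ*
      ((toGInf fr.embF γ.1 * (fr.W w * fr.I t)) σ).1) = sqSum σ (absT E ξ * (t : T E)) ^ (2⁻¹ : ℝ) := by
    intro σ
    rw [hvec, ← fr.locNorm_sq w t σ _ ξ hξ, show (2⁻¹ : ℝ) = 1 / 2 by norm_num, ← Real.sqrt_eq_rpow]
    exact (Real.sqrt_sq (norm_nonneg _)).symm
  unfold detFun
  simp_rw [hdet, hnorm]
  rw [sqrt_abs_discW, ofReal_pow_cpow (Finset.prod_pos fun σ _ => pow_pos (hW σ) _),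
    ofReal_prod_cpow _ _ (fun σ => pow_pos (hW σ) _), ofReal_prod_cpow, gammaFun,
    ← Finset.prod_mul_distrib]
  · refine Finset.prod_congr rfl fun σ _ => ?_
    have hS := sqSum_pos σ (absT E ξ * (t : T E))
    rw [div_eq_mul_inv, ofReal_mul_cpow (pow_pos (hW σ) _)
      (inv_pos.2 (pow_pos (Real.rpow_pos_of_pos hS _) _)),
      ofReal_inv_cpow (pow_pos (Real.rpow_pos_of_pos hS _) _), ofReal_pow_cpow (Real.rpow_pos_of_pos hS _),
      ofReal_rpow_cpow hS, hn]
    congr 2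
    · push_cast; ring
    · push_cast; ring
  · intro σ
    exact div_pos (pow_pos (hW σ) _) (pow_pos (Real.rpow_pos_of_pos (sqSum_pos σ _) _) _)

lemma partOf_ne_zero {𝔄 : FracIdeal E} {𝔞 : FracIdeal F} (x : partOf 𝔄 𝔞) : (x : E) ≠ 0 := x.2.2.1

/-- The class in `T_{E/F}` of an orbit. -/
def orbitProj {𝔄 : FracIdeal E} {𝔞 : FracIdeal F} (x : UnitOrbits 𝔄 𝔞) : TRel F E :=
  toTRel F E (absT E (Units.mk0 (x.out : E) (partOf_ne_zero x.out)))

/-- The terms of the Eisenstein series at a Heegner point. -/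
lemma eisTerm_heegner_orbit (fr : Frame F E n) (w : Module.Basis (Fin n) F E) {𝔄 : FracIdeal E}
    (D : ParabolicDatum (latticeOf w 𝔄)) (s : ℂ) (t : TRel F E)
    (p : UnitOrbits 𝔄 D.ideal × ((𝓞 E)ˣ ⧸ baseUnits F E)) :
    eisTerm fr.embF fr.mk_embF D (fr.heegner w t) s
      ((orbitEquiv D).symm (orbitSplitEquiv D.one_mem p)) =
      ((|discW fr w| : ℝ) : ℂ) ^ (s / 2) * (orbitTerm s p.1 *
        gammaFun F E s ((quotProj F E p.2 * (orbitProj p.1 * t) : TRel F E) : T E)) := by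
  obtain ⟨x, c⟩ := p
  generalize hq : (orbitEquiv D).symm (orbitSplitEquiv D.one_mem (x, c)) = q
  rw [Equiv.symm_apply_eq] at hq
  induction q using Quotient.inductionOn with | h γ => ?_
  obtain ⟨u, hu⟩ := Quotient.exact hq
  change (u : F) • ((c.out : E) * (x.out : E)) = w.equivFun.symm (D.e ᵥ* γ.1.1) at hu
  let x' : Eˣ := Units.mk0 (x.out : E) (partOf_ne_zero x.out)
  -- The chosen representatives give `eγ` only up to a unit `u` of `F`, which is absorbed into the
  -- unit of `E`.
  let v : (𝓞 E)ˣ := Units.map (algebraMap (𝓞 F) (𝓞 E)).toMonoidHom u * c.out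
  let ξ : Eˣ := Units.map (algebraMap (𝓞 E) E).toMonoidHom v * x'
  have hξ : w.equivFun.symm (D.e ᵥ* γ.1.1) = ξ := by
    rw [← hu, Algebra.smul_def, ← mul_assoc]
    rfl
  rw [eisTerm_heegner fr w D s t γ ξ hξ, gammaFun_eq, map_mul (toTRel F E), toTRel_coe]
  congr 2
  -- Units and elements of `T_{E/F}` have absolute norm one, so only the representative of the orbit
  -- contributes to the scalar factor.
  · rw [absNormT_mul, map_mul (absT E), absNormT_mul, ← regMap_eq_absT, absNormT_regMap, one_mul,
      absNormT_absT, ← absNormT_normT F E t, show normT F E t = 1 from t.2]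
    have h1 : absNormT F 1 = 1 := by simp [absNormT]
    rw [h1, mul_one]
    conv_rhs => rw [← Quotient.out_eq x]
    change _ = ((|Algebra.norm ℚ (x.out : E)| : ℚ) : ℂ) ^ (-s)
    simp only [x', Units.val_mk0]
    rw [Complex.ofReal_ratCast]
  · rw [map_mul (absT E), map_mul (toTRel F E), ← regMap_eq_absT]
    -- The unit `u` of `F` is killed by the projection to `T_{E/F}`.
    have h2 : toTRel F E (regMap E v) = quotProj F E c := by
      conv_rhs => rw [← QuotientGroup.out_eq' c]
      change unitProj F E v = unitProj F E c.out
      rw [map_mul, show unitProj F E (Units.map (algebraMap (𝓞 F) (𝓞 E)).toMonoidHom u) = 1 from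
        baseUnits_le_ker F E ⟨u, rfl⟩, one_mul]
    rw [h2, mul_assoc]
    rfl

end HeegnerValues

/-! ### Strict fundamental domains -/

section StrictDomain

open scoped Pointwise

variable {G : Type*} [CommGroup G] [MeasurableSpace G]

/-- A measurable set of representatives of `G / U`. -/
structure IsStrictDomain (U : Subgroup G) (D : Set G) : Prop where
  measurableSet : MeasurableSet D
  exists_mem : ∀ x, ∃ u ∈ U, u * x ∈ D
  unique : ∀ x ∈ D, ∀ u ∈ U, u * x ∈ D → u = 1

/-- A strict domain serves every measure at once and, unlike a fundamental domain up to null sets,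
permits counting arguments at each individual point. -/
lemma IsStrictDomain.isFundamentalDomain {U : Subgroup G} {D : Set G} (h : IsStrictDomain U D)
    (μ : Measure G) : IsFundamentalDomain U D μ := by
  refine IsFundamentalDomain.mk' h.measurableSet.nullMeasurableSet fun x => ?_
  obtain ⟨u, hu, hux⟩ := h.exists_mem x
  refine ⟨⟨u, hu⟩, hux, ?_⟩
  rintro ⟨v, hv⟩ hvx
  have hvx' : v * x ∈ D := hvx
  have := h.unique _ hux (v * u⁻¹) (U.mul_mem hv (U.inv_mem hu)) (by
    rwa [mul_assoc, inv_mul_cancel_left])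
  exact Subtype.ext (mul_inv_eq_one.1 this)

/-- A subgroup all of whose translates meet the sets of a countable measurable covering in at most
one point has a measurable set of representatives. -/
lemma exists_isStrictDomain [MeasurableMul G] (U : Subgroup G) [Countable U] {ι : Type*} [Countable ι]
    [Nonempty ι] (C : ι → Set G) (hC : ∀ i, MeasurableSet (C i)) (hcov : ∀ x, ∃ i, x ∈ C i)
    (hinj : ∀ i, ∀ x ∈ C i, ∀ u ∈ U, u * x ∈ C i → u = 1) : ∃ D, IsStrictDomain U D := by
  classical
  obtain ⟨f, hf⟩ := exists_surjective_nat ι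
  let S : ℕ → Set G := fun j => {x | ∃ u : U, (u : G) * x ∈ C (f j)}
  have hSm : ∀ j, MeasurableSet (S j) := by
    intro j
    have : S j = ⋃ u : U, (fun x => (u : G) * x) ⁻¹' C (f j) := by
      ext x; simp [S]
    rw [this]
    exact MeasurableSet.iUnion fun u => (measurable_const_mul (u : G)) (hC _)
  have hSinv : ∀ j x, ∀ u ∈ U, u * x ∈ S j → x ∈ S j := by
    rintro j x u hu ⟨v, hv⟩
    exact ⟨⟨v * u, U.mul_mem v.2 hu⟩, by rwa [mul_assoc]⟩
  -- Each orbit is represented by its point in the first set of the covering that it meets; `S j` is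
  -- the union of the orbits meeting `C (f j)`.
  refine ⟨⋃ i, C (f i) \ ⋃ j, ⋃ (_ : j < i), S j, ?_, ?_, ?_⟩
  · exact MeasurableSet.iUnion fun i => (hC _).diff
      (MeasurableSet.iUnion fun j => MeasurableSet.iUnion fun _ => hSm j)
  · intro x
    have hex : ∃ i, x ∈ S i := by
      obtain ⟨i, hi⟩ := hcov x
      obtain ⟨j, rfl⟩ := hf i
      exact ⟨j, 1, by simpa using hi⟩
    obtain ⟨u, hu⟩ := Nat.find_spec hex
    refine ⟨u, u.2, Set.mem_iUnion.2 ⟨Nat.find hex, hu, ?_⟩⟩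
    simp only [Set.mem_iUnion, not_exists]
    intro j hj hxj
    exact Nat.find_min hex hj (hSinv j x u u.2 hxj)
  · intro x hx u hu hux
    obtain ⟨i, hi, hi'⟩ := Set.mem_iUnion.1 hx
    obtain ⟨j, hj, hj'⟩ := Set.mem_iUnion.1 hux
    simp only [Set.mem_iUnion, not_exists] at hi' hj'
    have hij : i = j := by
      rcases lt_trichotomy i j with h | h | h
      · exact absurd ⟨⟨u⁻¹, U.inv_mem hu⟩, by simpa using hi⟩ (hj' i h)
      · exact h
      · exact absurd ⟨⟨u, hu⟩, hj⟩ (hi' j h)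
    subst hij
    exact hinj _ x hi u hu hj

/-- `quotMeasure` rests on an arbitrarily chosen fundamental domain. Preimages of subsets of the
quotient are `U`-invariant, and all fundamental domains give these the same measure. -/
lemma quotMeasure_eq [MeasurableMul G] {U : Subgroup G} [Countable U] {D : Set G} (h : IsStrictDomain U D)
    (μ : Measure G) [μ.IsMulLeftInvariant] :
    quotMeasure U μ = (μ.restrict D).map (QuotientGroup.mk : G → G ⧸ U) := by
  have : MeasurableConstSMul U G := ⟨fun u => measurable_const_mul (u : G)⟩
  have : SMulInvariantMeasure U G μ := ⟨fun u s hs => measure_preimage_mul μ (u : G) s⟩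
  have hex : ∃ D : Set G, IsFundamentalDomain U D μ := ⟨D, h.isFundamentalDomain μ⟩
  have hmk : Measurable (QuotientGroup.mk : G → G ⧸ U) := measurable_quotient_mk''
  rw [quotMeasure, dif_pos hex]
  ext A hA
  rw [Measure.map_apply hmk hA, Measure.map_apply hmk hA, Measure.restrict_apply (hmk hA),
    Measure.restrict_apply (hmk hA)]
  refine hex.choose_spec.measure_set_eq (h.isFundamentalDomain μ) (hmk hA) fun u => ?_
  ext x
  change (QuotientGroup.mk ((u : G) * x) : G ⧸ U) ∈ A ↔ (QuotientGroup.mk x : G ⧸ U) ∈ A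
  rw [QuotientGroup.mk_mul, (QuotientGroup.eq_one_iff (u : G)).2 u.2, one_mul]

lemma quotMeasure_univ [MeasurableMul G] {U : Subgroup G} [Countable U] {D : Set G} (h : IsStrictDomain U D)
    (μ : Measure G) [μ.IsMulLeftInvariant] : quotMeasure U μ Set.univ = μ D := by
  have hmk : Measurable (QuotientGroup.mk : G → G ⧸ U) := measurable_quotient_mk''
  rw [quotMeasure_eq h, Measure.map_apply hmk MeasurableSet.univ, Set.preimage_univ,
    Measure.restrict_apply_univ]

lemma IsStrictDomain.measure_ne_zero [MeasurableMul G] {U : Subgroup G} [Countable U] {D : Set G}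
    (h : IsStrictDomain U D) {μ : Measure G} [μ.IsMulLeftInvariant] (hμ : μ ≠ 0) : μ D ≠ 0 := by
  have : SMulInvariantMeasure U G μ := ⟨fun u s hs => measure_preimage_mul μ (u : G) s⟩
  exact (h.isFundamentalDomain μ).measure_ne_zero hμ

/-- `D` is covered by the pieces that some `u ∈ U` moves into `A`, and the measures of these pieces
add up to that of `A`. -/
lemma IsStrictDomain.measure_le [MeasurableMul G] {U : Subgroup G} [Countable U] {D : Set G}
    (h : IsStrictDomain U D) {μ : Measure G} [μ.IsMulLeftInvariant] {A : Set G}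
    (hA : ∀ x, ∃ u ∈ U, u * x ∈ A) : μ D ≤ μ A := by
  have : MeasurableConstSMul U G := ⟨fun u => measurable_const_mul (u : G)⟩
  have : SMulInvariantMeasure U G μ := ⟨fun u s hs => measure_preimage_mul μ (u : G) s⟩
  rw [(h.isFundamentalDomain μ).measure_eq_tsum A]
  have h1 : D ⊆ ⋃ u : U, {x | x ∈ D ∧ (u : G) * x ∈ A} := by
    intro x hx
    obtain ⟨u, hu, hux⟩ := hA x
    exact Set.mem_iUnion.2 ⟨⟨u, hu⟩, hx, hux⟩
  refine (measure_mono h1).trans ((measure_iUnion_le _).trans ?_)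
  have h2 : ∀ u : U, μ {x | x ∈ D ∧ (u : G) * x ∈ A} = μ (u⁻¹ • A ∩ D) := by
    intro u
    congr 1
    ext x
    rw [Set.mem_inter_iff, Set.mem_inv_smul_set_iff, and_comm]
    rfl
  simp_rw [h2]
  exact ((Equiv.inv U).tsum_eq fun u : U => μ (u • A ∩ D)).le

variable {A : Type*} [CommGroup A] (ρ : A →* G)

open Classical in
-- In each class modulo `ρ⁻¹(U)` the `a` with `ρ(a) x ∈ D` form exactly one coset of `ker ρ`: a
-- solution exists because `U` lies in the image of `ρ`, and two solutions differ by an element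
-- whose image in `U` is `1` by uniqueness.
lemma IsStrictDomain.tsum_indicator {U : Subgroup G} {D : Set G} (h : IsStrictDomain U D)
    (hU : U ≤ ρ.range) [Finite (A ⧸ U.comap ρ)] [Finite ρ.ker] (x : G) :
    ∑' a : A, D.indicator (1 : G → ℝ≥0∞) (ρ a * x) =
      (Nat.card (A ⧸ U.comap ρ) * Nat.card ρ.ker : ℕ) := by
  have hb : ∀ c : A ⧸ U.comap ρ, ∃ a : A, (QuotientGroup.mk a : A ⧸ U.comap ρ) = c ∧ ρ a * x ∈ D := by
    intro c
    obtain ⟨a, rfl⟩ := QuotientGroup.mk_surjective c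
    obtain ⟨u, hu, hux⟩ := h.exists_mem (ρ a * x)
    obtain ⟨v, rfl⟩ := hU hu
    refine ⟨a * v, ?_, ?_⟩
    · rw [QuotientGroup.mk_mul, (QuotientGroup.eq_one_iff v).2 hu, mul_one]
    · rwa [map_mul, mul_comm (ρ a), mul_assoc]
  choose b hbc hbD using hb
  let g : (A ⧸ U.comap ρ) × ρ.ker → A := fun p => b p.1 * p.2
  have hmk : ∀ p, (QuotientGroup.mk (g p) : A ⧸ U.comap ρ) = p.1 := by
    intro p
    have : (p.2 : A) ∈ U.comap ρ := by
      rw [Subgroup.mem_comap, (MonoidHom.mem_ker).1 p.2.2]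
      exact U.one_mem
    rw [QuotientGroup.mk_mul, (QuotientGroup.eq_one_iff (p.2 : A)).2 this, mul_one, hbc]
  have hg : Function.Injective g := by
    rintro ⟨c, k⟩ ⟨c', k'⟩ hcc
    have h1 : c = c' := (hmk (c, k)).symm.trans ((congrArg _ hcc).trans (hmk (c', k')))
    subst h1
    rw [Prod.mk.injEq]
    exact ⟨rfl, Subtype.ext (mul_left_cancel hcc)⟩
  have hsupp : Function.support (fun a : A => D.indicator (1 : G → ℝ≥0∞) (ρ a * x)) ⊆ Set.range g := by
    intro a ha
    have haD : ρ a * x ∈ D := Set.mem_of_indicator_ne_zero ha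
    set c : A ⧸ U.comap ρ := QuotientGroup.mk a
    have h1 : (b c)⁻¹ * a ∈ U.comap ρ := QuotientGroup.eq.1 (hbc c)
    have h2 := h.unique _ (hbD c) _ h1 (by
      rwa [map_mul, map_inv, mul_assoc, mul_left_comm (ρ a), inv_mul_cancel_left])
    exact ⟨(c, ⟨(b c)⁻¹ * a, h2⟩), mul_inv_cancel_left _ _⟩
  rw [← hg.tsum_eq hsupp]
  have h1 : ∀ p, D.indicator (1 : G → ℝ≥0∞) (ρ (g p) * x) = 1 := by
    rintro ⟨c, k⟩
    have : ρ (g (c, k)) = ρ (b c) := by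
      change ρ (b c * k) = _
      rw [map_mul, (MonoidHom.mem_ker).1 k.2, mul_one]
    rw [this, Set.indicator_of_mem (hbD c)]
    rfl
  simp_rw [h1]
  have := Fintype.ofFinite ((A ⧸ U.comap ρ) × ρ.ker)
  rw [tsum_fintype, ← Nat.card_prod, Finset.sum_const, Finset.card_univ, nsmul_eq_mul, mul_one,
    Nat.card_eq_fintype_card]

/-- The density at `y` of the sum of the translated measures is the number of `a` with `ρ(a)⁻¹ y ∈
D`, which is `N` everywhere. -/
lemma measure_sum_map [MeasurableMul G] [Countable A] {D : Set G} (hD : MeasurableSet D) (N : ℝ≥0∞)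
    (hN : ∀ x, ∑' a : A, D.indicator (1 : G → ℝ≥0∞) (ρ a * x) = N) (μ : Measure G)
    [μ.IsMulLeftInvariant] :
    (Measure.sum fun a : A => (μ.restrict D).map fun x => ρ a * x) = N • μ := by
  ext S hS
  rw [Measure.sum_apply _ hS, Measure.smul_apply, smul_eq_mul]
  have h1 : ∀ a : A, (μ.restrict D).map (fun x => ρ a * x) S =
      ∫⁻ y in S, D.indicator (1 : G → ℝ≥0∞) (ρ a⁻¹ * y) ∂μ := by
    intro a
    have h2 : MeasurableSet ((fun y => ρ a⁻¹ * y) ⁻¹' D) := measurable_const_mul _ hD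
    have h3 : (fun y => D.indicator (1 : G → ℝ≥0∞) (ρ a⁻¹ * y)) =
        ((fun y => ρ a⁻¹ * y) ⁻¹' D).indicator 1 := rfl
    rw [h3, lintegral_indicator_one h2, Measure.restrict_apply h2,
      Measure.map_apply (measurable_const_mul _) hS,
      Measure.restrict_apply (measurable_const_mul _ hS),
      ← measure_preimage_mul μ (ρ a) ((fun y => ρ a⁻¹ * y) ⁻¹' D ∩ S)]
    congr 1
    ext y
    simp [and_comm]
  simp_rw [h1]
  rw [← lintegral_tsum (f := fun a y => D.indicator (1 : G → ℝ≥0∞) (ρ a⁻¹ * y))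
    fun a => ((measurable_one.indicator hD).comp (measurable_const_mul _)).aemeasurable]
  have h4 : ∀ y, ∑' a : A, D.indicator (1 : G → ℝ≥0∞) (ρ a⁻¹ * y) = N := by
    intro y
    rw [← hN y]
    exact (Equiv.inv A).tsum_eq fun a => D.indicator (1 : G → ℝ≥0∞) (ρ a * y)
  simp_rw [h4]
  rw [setLIntegral_const]

end StrictDomain

/-! ### The Haar measures on the tori -/

section Haar

variable (k k' : Type*) [Field k] [NumberField k] [Field k'] [NumberField k'] [Algebra k k']

instance : MeasurableMul (TRel k k') where
  measurable_const_mul c := (measurable_subtype_coe.const_mul (c : T k')).subtype_mk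
  measurable_mul_const c := (measurable_subtype_coe.mul_const (c : T k')).subtype_mk

instance : SFinite (haarTRel k k') := by unfold haarTRel; infer_instance

lemma measurableSet_boxT : MeasurableSet (boxT k) := by
  have : boxT k = ⋂ σ, {u : T k | (u σ : ℝ) ∈ Set.Icc 1 (Real.exp 1)} := by
    ext u
    simp [boxT]
  rw [this]
  exact MeasurableSet.iInter fun σ =>
    (measurable_subtype_coe.comp (measurable_pi_apply σ)) measurableSet_Icc

lemma haarT_boxT_ne_zero : haarT k (boxT k) ≠ 0 := by
  rw [haarT_boxT, Finset.prod_ne_zero_iff]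
  intro σ _
  exact_mod_cast InfinitePlace.mult_ne_zero

lemma haarT_boxT_ne_top : haarT k (boxT k) ≠ ∞ := by
  rw [haarT_boxT]
  exact ENNReal.prod_ne_top fun σ _ => ENNReal.natCast_ne_top _

lemma haarTRel_apply {S : Set (TRel k k')} (hS : MeasurableSet S) :
    haarTRel k k' S = (haarT k (boxT k))⁻¹ *
      haarT k' (toTRel k k' ⁻¹' S ∩ normT k k' ⁻¹' boxT k) := by
  rw [haarTRel, Measure.smul_apply, smul_eq_mul, Measure.map_apply (measurable_toTRel k k') hS,
    Measure.restrict_apply (measurable_toTRel k k' hS)]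

instance : (haarTRel k k').IsMulLeftInvariant where
  map_mul_left_eq_self g := by
    ext S hS
    rw [Measure.map_apply (measurable_const_mul g) hS, haarTRel_apply k k' hS,
      haarTRel_apply k k' (measurable_const_mul g hS), ← measure_preimage_mul (haarT k') (g : T k')
        (toTRel k k' ⁻¹' S ∩ normT k k' ⁻¹' boxT k)]
    congr 2
    ext t
    have h1 : normT k k' (g * t) = normT k k' t := by
      rw [map_mul, show normT k k' g = 1 from g.2, one_mul]
    simp only [Set.mem_inter_iff, Set.mem_preimage, h1, map_mul, toTRel_coe]

lemma haarTRel_ne_zero : haarTRel k k' ≠ 0 := by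
  intro h
  have := lintegral_haarTRel k k' ((boxT k').indicator 1) (measurable_one.indicator (measurableSet_boxT k'))
  rw [lintegral_indicator_one (measurableSet_boxT k'), h] at this
  simp only [lintegral_zero_measure, lintegral_zero] at this
  exact haarT_boxT_ne_zero k' this

/-- `{t | ∀ σ, |log t_σ| ≤ B}` -/
def logBox (B : ℝ) : Set (T k) := {t | ∀ σ, |Real.log (t σ)| ≤ B}

lemma haarT_logBox_lt_top (B : ℝ) : haarT k (logBox k B) < ∞ := by
  have : logBox k B = Set.pi Set.univ fun _ => {x : PosReal | |Real.log x| ≤ B} := by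
    ext u
    simp [logBox]
  rw [this, haarT, Measure.pi_pi]
  refine ENNReal.prod_lt_top fun σ _ => ?_
  rw [Measure.smul_apply, smul_eq_mul]
  refine ENNReal.mul_lt_top (ENNReal.natCast_lt_top _) ?_
  rw [haarPos_eq, expPos.map_apply]
  have : expPos ⁻¹' {x : PosReal | |Real.log x| ≤ B} = Set.Icc (-B) B := by
    ext x
    change |Real.log (Real.exp x)| ≤ B ↔ _
    rw [Real.log_exp, abs_le, Set.mem_Icc]
  rw [this, Real.volume_Icc]
  exact ENNReal.ofReal_lt_top

lemma measurableSet_logBox (B : ℝ) : MeasurableSet (logBox k B) := by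
  have : logBox k B = ⋂ σ, {u : T k | |Real.log (u σ)| ≤ B} := by
    ext u
    simp [logBox]
  rw [this]
  refine MeasurableSet.iInter fun σ => measurableSet_le ?_ measurable_const
  exact measurable_norm.comp (Real.measurable_log.comp
    (measurable_subtype_coe.comp (measurable_pi_apply σ)))

/-- Over `boxT` the factor `rootT (N t)` has logarithms in `[0, 1]`: those of `N t` lie there and
are divided by `[k':k] ≥ 1`. A point of the tube over the box that projects to the log box of size
`B` thus lies in the one of size `B + 1`. -/
lemma haarTRel_logBox_lt_top (B : ℝ) :
    haarTRel k k' (Subtype.val ⁻¹' logBox k' B) < ∞ := by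
  rw [haarTRel_apply k k' (measurable_subtype_coe (measurableSet_logBox k' B))]
  refine ENNReal.mul_lt_top (ENNReal.inv_lt_top.2 (haarT_boxT_ne_zero k).bot_lt) ?_
  refine (measure_mono ?_).trans_lt (haarT_logBox_lt_top k' (B + 1))
  rintro t ⟨ht, htN⟩ τ
  have h1 := ht τ
  have h2 : |Real.log ((rootT k k' (normT k k' t) τ : PosReal) : ℝ)| ≤ 1 := by
    obtain ⟨h3, h4⟩ := htN (τ.comap (algebraMap k k'))
    change |Real.log ((normT k k' t (τ.comap (algebraMap k k')) : ℝ) ^ (Module.finrank k k' : ℝ)⁻¹)| ≤ 1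
    rw [Real.log_rpow (normT k k' t _).2, abs_of_nonneg (mul_nonneg (by positivity) (Real.log_nonneg h3))]
    have h5 : Real.log (normT k k' t (τ.comap (algebraMap k k')) : ℝ) ≤ 1 := by
      rw [← Real.log_exp 1]
      exact Real.log_le_log (normT k k' t _).2 h4
    have h6 : (Module.finrank k k' : ℝ)⁻¹ ≤ 1 :=
      inv_le_one_of_one_le₀ (by exact_mod_cast finrank_pos' k k')
    exact mul_le_one₀ h6 (Real.log_nonneg h3) h5
  have h7 := congrArg (fun u : T k' => Real.log (u τ : ℝ)) (rootT_mul_toTRel k k' t)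
  change Real.log (((rootT k k' (normT k k' t) τ : PosReal) : ℝ) * _) = _ at h7
  rw [Real.log_mul (rootT k k' (normT k k' t) τ).2.ne' ((toTRel k k' t : T k') τ).2.ne'] at h7
  rw [← h7]
  refine (abs_add_le _ _).trans ?_
  rw [add_comm B]
  exact add_le_add h2 h1

end Haar

/-! ### Unit lattices -/

section UnitLattices

variable (k k' : Type*) [Field k] [NumberField k] [Field k'] [NumberField k'] [Algebra k k']

lemma prod_norm_embeddings_over (φ : k →+* ℂ) (x : k') [DecidableEq (k →+* ℂ)] :
    ∏ ψ : k' →+* ℂ with ψ.comp (algebraMap k k') = φ, ‖ψ x‖ = ‖φ (Algebra.norm k x)‖ := by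
  have : FiniteDimensional k k' := Module.Finite.of_restrictScalars_finite ℚ k k'
  let _ : Algebra k ℂ := φ.toAlgebra
  have h : φ (Algebra.norm k x) = ∏ σ : k' →ₐ[k] ℂ, σ x :=
    Algebra.norm_eq_prod_embeddings k ℂ x
  rw [h, norm_prod]
  symm
  refine Finset.prod_bij' (fun σ _ => (σ : k' →+* ℂ))
    (fun ψ hψ => { ψ with commutes' := fun r => RingHom.congr_fun (Finset.mem_filter.1 hψ).2 r })
    ?_ ?_ ?_ ?_ ?_
  · intro σ _
    refine Finset.mem_filter.2 ⟨Finset.mem_univ _, ?_⟩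
    ext r
    exact σ.commutes r
  · simp
  · intros
    rfl
  · intros
    rfl
  · intros
    rfl

/-- The absolute values of a norm at the place `σ` are products over the places above `σ`. -/
lemma place_norm (σ : InfinitePlace k) (x : k') :
    σ (Algebra.norm k x) = ∏ τ : Above k' σ, τ.1 x ^ relDeg k τ.1 := by
  classical
  -- The identity is proved after raising to the power `n_σ`, where both sides are products over all
  -- embeddings of `k'` above `σ`: grouped by their restriction to `k` here, by their place in `h1`.
  have h0 : ∏ ψ : k' →+* ℂ with InfinitePlace.mk (ψ.comp (algebraMap k k')) = σ, ‖ψ x‖ =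
      σ (Algebra.norm k x) ^ σ.mult := by
    rw [← Finset.prod_fiberwise_of_maps_to (t := Finset.univ.filter fun φ => InfinitePlace.mk φ = σ)
      (g := fun ψ : k' →+* ℂ => ψ.comp (algebraMap k k'))
      (by intro ψ hψ; simpa using hψ), ← InfinitePlace.card_filter_mk_eq, ← Finset.prod_const]
    refine Finset.prod_congr rfl fun φ hφ => ?_
    rw [Finset.mem_filter] at hφ
    obtain ⟨_, rfl⟩ := hφ
    rw [InfinitePlace.apply, ← prod_norm_embeddings_over, Finset.filter_filter]
    refine Finset.prod_congr (Finset.filter_congr fun ψ _ => ?_) fun _ _ => rfl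
    exact ⟨fun h => h.2, fun h => ⟨by rw [h], h⟩⟩
  have h1 : ∏ ψ : k' →+* ℂ with InfinitePlace.mk (ψ.comp (algebraMap k k')) = σ, ‖ψ x‖ =
      (∏ τ : Above k' σ, τ.1 x ^ relDeg k τ.1) ^ σ.mult := by
    rw [← Finset.prod_fiberwise_of_maps_to (t := Finset.univ.filter fun τ : InfinitePlace k' =>
      τ.comap (algebraMap k k') = σ) (g := fun ψ : k' →+* ℂ => InfinitePlace.mk ψ)
      (by intro ψ hψ; simpa [InfinitePlace.comap_mk] using hψ), ← Finset.prod_pow,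
      ← Finset.prod_coe_sort]
    refine Fintype.prod_equiv (Equiv.subtypeEquivRight (by simp)) _ _ ?_
    rintro ⟨τ, hτ⟩
    have hτ' : τ.comap (algebraMap k k') = σ := by simpa using hτ
    change _ = (τ x ^ relDeg k τ) ^ σ.mult
    rw [← pow_mul, mul_comm, mult_mul_relDeg' k k' σ ⟨τ, hτ'⟩, ← InfinitePlace.card_filter_mk_eq,
      ← Finset.prod_const, Finset.filter_filter]
    refine Finset.prod_congr (Finset.filter_congr fun ψ _ => ?_) fun ψ hψ => ?_
    · refine ⟨fun h => h.2, fun h => ⟨?_, h⟩⟩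
      rw [← InfinitePlace.comap_mk, h, hτ']
    · have h2 : InfinitePlace.mk ψ = τ := (Finset.mem_filter.1 hψ).2
      rw [← h2]
      rfl
  refine (pow_left_inj₀ (apply_nonneg _ _)
    (Finset.prod_nonneg fun τ _ => pow_nonneg (apply_nonneg _ _) _) σ.mult_ne_zero).1 (h0.symm.trans h1)

lemma normT_regMap (u : (𝓞 k')ˣ) (σ : InfinitePlace k) :
    (normT k k' (regMap k' u) σ : ℝ) = σ (Algebra.norm k (u : k')) := by
  rw [coe_normT, place_norm]
  rfl

lemma regMap_mem_TRel {u : (𝓞 k')ˣ} (hu : u ∈ relUnits k k') : regMap k' u ∈ TRel k k' := by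
  rw [MonoidHom.mem_ker]
  funext σ
  apply Subtype.ext
  have : Algebra.norm k (u : k') = 1 := hu
  rw [normT_regMap, this, map_one]
  rfl

lemma regMap_mem_TRel_rat (u : (𝓞 k)ˣ) : regMap k u ∈ TRel ℚ k := by
  rw [MonoidHom.mem_ker]
  funext σ
  apply Subtype.ext
  rw [normT_regMap]
  have h1 : |Algebra.norm ℚ (u : k)| = 1 := abs_norm_unit u
  rcases abs_eq (zero_le_one) |>.1 h1 with h | h
  · rw [h, map_one]
    rfl
  · rw [h]
    change σ.1 (-1) = 1
    rw [map_neg_eq_map, map_one]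

instance : Countable k :=
  (Module.finBasis ℚ k).equivFun.toEquiv.injective.countable

instance : Countable (𝓞 k)ˣ := by
  have h : Function.Injective fun u : (𝓞 k)ˣ => (u : k) := fun u v huv =>
    Units.ext (RingOfIntegers.ext huv)
  exact h.countable

/-- Discreteness of the units: those with all logarithms below `1` in absolute value are integers
with bounded conjugates, hence finitely many, so one may take a positive bound below their non-zero
logarithms. -/
lemma exists_log_gap : ∃ ε : ℝ, 0 < ε ∧ ∀ u : (𝓞 k)ˣ,
    (∀ τ, |Real.log (regMap k u τ : ℝ)| < ε) → regMap k u = 1 := by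
  let S : Set (𝓞 k)ˣ := {u | ∀ τ, |Real.log (regMap k u τ : ℝ)| < 1}
  have hS : S.Finite := by
    refine Set.Finite.of_finite_image ((Embeddings.finite_of_norm_le k ℂ (Real.exp 1)).subset ?_)
      (f := fun u : (𝓞 k)ˣ => (u : k)) fun u _ v _ huv => Units.ext (RingOfIntegers.ext huv)
    rintro _ ⟨u, hu, rfl⟩
    refine ⟨(u : 𝓞 k).isIntegral_coe, fun φ => ?_⟩
    have h1 := hu (InfinitePlace.mk φ)
    have h2 : ((regMap k u (InfinitePlace.mk φ) : PosReal) : ℝ) = ‖φ (u : k)‖ := rfl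
    rw [h2] at h1
    have h3 : 0 < ‖φ (u : k)‖ := (regMap k u (InfinitePlace.mk φ)).2
    exact (Real.log_le_iff_le_exp h3).1 ((le_abs_self _).trans h1.le)
  have h1 : ∀ u ∈ S, ∃ ε : ℝ, 0 < ε ∧
      ((∀ τ, |Real.log (regMap k u τ : ℝ)| < ε) → regMap k u = 1) := by
    intro u _
    by_cases h : ∀ τ, Real.log (regMap k u τ : ℝ) = 0
    · refine ⟨1, one_pos, fun _ => ?_⟩
      funext τ
      exact Subtype.ext (Real.eq_one_of_pos_of_log_eq_zero (regMap k u τ).2 (h τ))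
    · push Not at h
      obtain ⟨τ, hτ⟩ := h
      exact ⟨_, abs_pos.2 hτ, fun h => absurd (h τ) (lt_irrefl _)⟩
  choose! e he he' using h1
  obtain ⟨ε, hε, hε'⟩ : ∃ ε : ℝ, 0 < ε ∧ ∀ u ∈ S, ε ≤ e u := by
    rcases S.eq_empty_or_nonempty with h | h
    · exact ⟨1, one_pos, by simp [h]⟩
    · obtain ⟨v, hv, hv'⟩ := hS.exists_minimalFor e S h
      exact ⟨e v, he v hv, fun u hu => (le_total (e v) (e u)).elim id (hv' hu)⟩
  refine ⟨min ε 1, lt_min hε one_pos, fun u hu => ?_⟩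
  have huS : u ∈ S := fun τ => (hu τ).trans_le (min_le_right _ _)
  exact he' u huS fun τ => (hu τ).trans_le ((min_le_left _ _).trans (hε' u huS))

lemma countable_of_le_range {U : Subgroup (TRel k k')}
    (hU : ∀ u ∈ U, (u : T k') ∈ (regMap k').range) : Countable U := by
  choose! f hf using hU
  have : Function.Injective fun u : U => f u.1 := by
    intro u v huv
    apply Subtype.ext
    apply Subtype.ext
    rw [← hf u.1 u.2, ← hf v.1 v.2]
    exact congrArg _ huv
  exact this.countable

/-- Cut the torus into cubes of side `ε` in logarithmic coordinates, `ε` being the gap of the units.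
Two points of one cube differ by less than `ε` at every place, so an element of `U` relating them is
trivial. -/
lemma exists_isStrictDomain_of_le_range {U : Subgroup (TRel k k')}
    (hU : ∀ u ∈ U, (u : T k') ∈ (regMap k').range) : ∃ D, IsStrictDomain U D := by
  have := countable_of_le_range k k' hU
  obtain ⟨ε, hε, hgap⟩ := exists_log_gap k'
  refine exists_isStrictDomain U (ι := InfinitePlace k' → ℤ)
    (fun z => {t | ∀ τ, ⌊Real.log ((t : T k') τ : ℝ) / ε⌋ = z τ}) ?_ ?_ ?_
  · intro z
    have : {t : TRel k k' | ∀ τ, ⌊Real.log ((t : T k') τ : ℝ) / ε⌋ = z τ} =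
        ⋂ τ, (fun t : TRel k k' => ⌊Real.log ((t : T k') τ : ℝ) / ε⌋) ⁻¹' {z τ} := by
      ext t
      simp
    rw [this]
    refine MeasurableSet.iInter fun τ => ?_
    have h1 : Measurable fun t : TRel k k' => ((t : T k') τ : ℝ) :=
      measurable_subtype_coe.comp ((measurable_pi_apply τ).comp measurable_subtype_coe)
    exact (Int.measurable_floor.comp ((Real.measurable_log.comp h1).div_const ε))
      (measurableSet_singleton _)
  · intro t
    exact ⟨fun τ => ⌊Real.log ((t : T k') τ : ℝ) / ε⌋, fun τ => rfl⟩
  · intro z t ht u hu hut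
    obtain ⟨v, hv⟩ := hU u hu
    apply Subtype.ext
    rw [← hv]
    refine hgap v fun τ => ?_
    rw [hv]
    have h1 := ht τ
    have h2 := hut τ
    change ⌊Real.log (((u : T k') τ : ℝ) * ((t : T k') τ : ℝ)) / ε⌋ = z τ at h2
    rw [Real.log_mul ((u : T k') τ).2.ne' ((t : T k') τ).2.ne'] at h2
    have h3 := Int.abs_sub_lt_one_of_floor_eq_floor (h2.trans h1.symm)
    rw [← sub_div, add_sub_cancel_right, abs_div, abs_of_pos hε, div_lt_one hε] at h3
    exact h3

lemma coe_mem_range_of_mem_relUnitLattice :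
    ∀ u ∈ relUnitLattice k k', (u : T k') ∈ (regMap k').range := by
  rintro u ⟨v, _, hv⟩
  exact ⟨v, hv⟩

lemma coe_mem_range_of_mem_unitLattice :
    ∀ u ∈ unitLattice k, (u : T k) ∈ (regMap k).range := fun _ h => h

instance : Countable (relUnitLattice k k') :=
  countable_of_le_range k k' (coe_mem_range_of_mem_relUnitLattice k k')

instance : Countable (unitLattice k) :=
  countable_of_le_range ℚ k (coe_mem_range_of_mem_unitLattice k)

end UnitLattices

/-! ### Covering numbers for finitely generated groups. -/

section Quotient

variable {G B : Type*} [CommGroup G] [MeasurableSpace G] [CommGroup B] [Group.FG B]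

/-- Both the cokernel `(B ⧸ N) ⧸ p⁻¹(U)` and the kernel of `p` are finitely generated torsion
groups, by `hpow` and `hker` respectively, hence finite. The pointwise count is the product of their
orders, independent of `D` and `x`. -/
lemma exists_tsum_indicator_quotient (ρ : B →* G) (N : Subgroup B) (hN : N ≤ ρ.ker)
    (U : Subgroup G) (hU : U ≤ ρ.range) {n : ℕ} (hn : 0 < n) (hpow : ∀ b, ρ b ^ n ∈ U)
    (hker : ∀ b ∈ ρ.ker, ∃ m, 0 < m ∧ b ^ m ∈ N) :
    ∃ M : ℕ, M ≠ 0 ∧ ∀ D, IsStrictDomain U D → ∀ x,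
      ∑' c : B ⧸ N, D.indicator (1 : G → ℝ≥0∞) (QuotientGroup.lift N ρ hN c * x) = M := by
  let p : B ⧸ N →* G := QuotientGroup.lift N ρ hN
  have hp : ∀ b : B, p b = ρ b := fun b => rfl
  have h1 : Finite ((B ⧸ N) ⧸ U.comap p) := by
    refine CommGroup.finite_of_fg_isMulTorsion _ fun g => ?_
    obtain ⟨c, rfl⟩ := QuotientGroup.mk_surjective g
    obtain ⟨b, rfl⟩ := QuotientGroup.mk_surjective c
    rw [isOfFinOrder_iff_pow_eq_one]
    refine ⟨n, hn, ?_⟩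
    rw [← QuotientGroup.mk_pow, QuotientGroup.eq_one_iff, Subgroup.mem_comap, map_pow, hp]
    exact hpow b
  have h2 : Finite p.ker := by
    have h1 : Module.Finite ℤ (Additive (B ⧸ N)) :=
      Module.Finite.iff_addGroup_fg.2 inferInstance
    let M : Submodule ℤ (Additive (B ⧸ N)) := AddSubgroup.toIntSubmodule p.ker.toAddSubgroup
    have h2 : Module.IsTorsion ℤ M := by
      rintro ⟨c, hc⟩
      obtain ⟨b, hb⟩ := QuotientGroup.mk_surjective (s := N) c.toMul
      have hb' : b ∈ ρ.ker := by
        have hc' : p c.toMul = 1 := hc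
        rw [← hb, hp] at hc'
        exact hc'
      obtain ⟨m, hm, hm'⟩ := hker b hb'
      refine ⟨⟨(m : ℤ), mem_nonZeroDivisors_of_ne_zero (by exact_mod_cast hm.ne')⟩, ?_⟩
      apply Subtype.ext
      change (m : ℤ) • c = 0
      rw [natCast_zsmul]
      change c.toMul ^ m = 1
      rw [← hb, ← QuotientGroup.mk_pow, QuotientGroup.eq_one_iff]
      exact hm'
    exact Module.finite_of_fg_torsion M h2
  refine ⟨Nat.card ((B ⧸ N) ⧸ U.comap p) * Nat.card p.ker,
    mul_ne_zero Nat.card_pos.ne' Nat.card_pos.ne', fun D hD x => hD.tsum_indicator p ?_ x⟩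
  intro u hu
  obtain ⟨b, rfl⟩ := hU hu
  exact ⟨b, hp b⟩

end Quotient

/-! ### Dirichlet's unit theorem: finite covolume and covering numbers. -/

section Dirichlet

variable (k k' : Type*) [Field k] [NumberField k] [Field k'] [NumberField k'] [Algebra k k']

lemma absNormT_one : absNormT k 1 = 1 := by
  simp [absNormT]

lemma absNormT_TRel (t : TRel k k') : absNormT k' t = 1 := by
  rw [← absNormT_normT k k', show normT k k' (t : T k') = 1 from t.2, absNormT_one]

lemma sum_mult_log (t : T k) :
    ∑ σ : InfinitePlace k, σ.mult * Real.log (t σ : ℝ) = Real.log (absNormT k t) := by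
  rw [absNormT, Real.log_prod fun σ _ => pow_ne_zero _ (t σ).2.ne']
  exact Finset.sum_congr rfl fun σ _ => (Real.log_pow _ _).symm

open Units Units.dirichletUnitTheorem in
/-- Dirichlet's unit theorem: `T_{k/ℚ} / U_k` is bounded. -/
lemma exists_logBox_covering : ∃ B : ℝ, ∀ t : TRel ℚ k, ∃ u ∈ RelHecke.unitLattice k,
    u * t ∈ (Subtype.val ⁻¹' logBox k B : Set (TRel ℚ k)) := by
  classical
  let b := (basisUnitLattice k).ofZLatticeBasis ℝ (Units.unitLattice k)
  let B₀ : ℝ := ∑ i, ‖b i‖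
  have hB₀ : 0 ≤ B₀ := Finset.sum_nonneg fun i _ => norm_nonneg _
  -- `B₀` bounds the fractional part with respect to the lattice basis at the places other than
  -- `w₀`. The coordinate at `w₀` is minus the sum of the others, which costs a factor equal to
  -- their number.
  refine ⟨(Fintype.card {w : InfinitePlace k // w ≠ w₀} + 1) * B₀, fun t => ?_⟩
  let v : logSpace k := fun w => w.1.mult * Real.log ((t : T k) w.1 : ℝ)
  have hfl : ((ZSpan.floor b v : Submodule.span ℤ (Set.range b)) : logSpace k) ∈ Units.unitLattice k := by
    rw [← (basisUnitLattice k).ofZLatticeBasis_span ℝ]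
    exact (ZSpan.floor b v).2
  obtain ⟨u, -, hu⟩ := hfl
  -- The translating unit is the inverse of the one whose logarithmic vector is the integral part of
  -- that of `t`.
  refine ⟨⟨regMap k u.toMul, regMap_mem_TRel_rat k _⟩⁻¹,
    Subgroup.inv_mem _ ⟨u.toMul, rfl⟩, ?_⟩
  have h1 : ∀ w : {w : InfinitePlace k // w ≠ w₀},
      |w.1.mult * Real.log ((((regMap k u.toMul)⁻¹ * t : T k) w.1 : PosReal) : ℝ)| ≤ B₀ := by
    intro w
    have h2 : w.1.mult * Real.log ((((regMap k u.toMul)⁻¹ * t : T k) w.1 : PosReal) : ℝ) =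
        ZSpan.fract b v w := by
      have h3 : ((((regMap k u.toMul)⁻¹ * t : T k) w.1 : PosReal) : ℝ) =
          (w.1 (u.toMul : k))⁻¹ * ((t : T k) w.1 : ℝ) := rfl
      have h4 : logEmbedding k u w = w.1.mult * Real.log (w.1 (u.toMul : k)) := rfl
      have h5 : logEmbedding k u = ((ZSpan.floor b v : Submodule.span ℤ (Set.range b)) : logSpace k) := hu
      rw [ZSpan.fract_apply, ← h5, Pi.sub_apply, h4, h3, Real.log_mul
        (inv_ne_zero (Units.pos_at_place u.toMul w.1).ne') ((t : T k) w.1).2.ne', Real.log_inv]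
      ring
    rw [h2]
    exact (norm_le_pi_norm (ZSpan.fract b v) w).trans (ZSpan.norm_fract_le b v)
  have h0 : ∑ σ : InfinitePlace k, σ.mult *
      Real.log ((((regMap k u.toMul)⁻¹ * t : T k) σ : PosReal) : ℝ) = 0 := by
    have h3 := absNormT_TRel ℚ k (⟨regMap k u.toMul, regMap_mem_TRel_rat k _⟩⁻¹ * t)
    change absNormT k ((regMap k u.toMul)⁻¹ * t) = 1 at h3
    rw [sum_mult_log, h3, Real.log_one]
  have h6 : ∀ w : InfinitePlace k,
      |w.mult * Real.log ((((regMap k u.toMul)⁻¹ * t : T k) w : PosReal) : ℝ)| ≤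
        (Fintype.card {w : InfinitePlace k // w ≠ w₀} + 1) * B₀ := by
    intro w
    by_cases hw : w = w₀
    · subst hw
      rw [Fintype.sum_eq_add_sum_subtype_ne _ w₀, add_eq_zero_iff_eq_neg] at h0
      rw [h0, abs_neg]
      refine (Finset.abs_sum_le_sum_abs _ _).trans ((Finset.sum_le_card_nsmul _ _ B₀
        fun w _ => h1 w).trans ?_)
      rw [nsmul_eq_mul, Finset.card_univ]
      nlinarith
    · have := h1 ⟨w, hw⟩
      have h7 : (0 : ℝ) ≤ Fintype.card {w : InfinitePlace k // w ≠ w₀} := Nat.cast_nonneg _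
      nlinarith
  intro w
  refine le_trans ?_ (h6 w)
  rw [abs_mul]
  have h8 : (1 : ℝ) ≤ |(w.mult : ℝ)| := by
    rw [Nat.abs_cast]
    exact_mod_cast Nat.one_le_iff_ne_zero.2 w.mult_ne_zero
  exact le_mul_of_one_le_left (abs_nonneg _) h8

lemma haarTRel_unitLattice_lt_top {D : Set (TRel ℚ k)} (hD : IsStrictDomain (unitLattice k) D) :
    haarTRel ℚ k D < ∞ := by
  obtain ⟨B, hB⟩ := exists_logBox_covering k
  exact (hD.measure_le hB).trans_lt (haarTRel_logBox_lt_top ℚ k B)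

lemma mem_ker_regMap (u : (𝓞 k)ˣ) : u ∈ (regMap k).ker ↔ u ∈ Units.torsion k := by
  rw [MonoidHom.mem_ker, Units.mem_torsion]
  constructor
  · intro h w
    exact congrArg Subtype.val (congrFun h w)
  · intro h
    funext w
    exact Subtype.ext (h w)

lemma coe_unitProj_rat (u : (𝓞 k)ˣ) : ((unitProj ℚ k u : TRel ℚ k) : T k) = regMap k u :=
  congrArg Subtype.val (toTRel_coe ℚ k ⟨regMap k u, regMap_mem_TRel_rat k u⟩)

lemma ker_unitProj_rat : (unitProj ℚ k).ker = Units.torsion k := by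
  ext u
  rw [← mem_ker_regMap, MonoidHom.mem_ker, MonoidHom.mem_ker, ← coe_unitProj_rat, OneMemClass.coe_eq_one]

lemma unitProj_rat_mem (u : (𝓞 k)ˣ) : unitProj ℚ k u ∈ unitLattice k :=
  ⟨u, (coe_unitProj_rat k u).symm⟩

open Classical in
-- Over `ℚ` every unit already has absolute values in the norm-one torus, so the image of the units
-- is exactly `U_k`; the count is the order of the kernel, the group of roots of unity.
lemma tsum_indicator_unitLattice {D : Set (TRel ℚ k)} (hD : IsStrictDomain (unitLattice k) D)
    (x : TRel ℚ k) :
    ∑' u : (𝓞 k)ˣ, D.indicator (1 : TRel ℚ k → ℝ≥0∞) (unitProj ℚ k u * x) =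
      (Units.torsionOrder k : ℕ) := by
  have hle : unitLattice k ≤ (unitProj ℚ k).range := by
    rintro x ⟨u, hu⟩
    exact ⟨u, Subtype.ext ((coe_unitProj_rat k u).trans hu)⟩
  have hcomap : (unitLattice k).comap (unitProj ℚ k) = ⊤ := by
    ext u
    simp [unitProj_rat_mem k u]
  have : Subsingleton ((𝓞 k)ˣ ⧸ (unitLattice k).comap (unitProj ℚ k)) := by
    rw [hcomap]
    exact QuotientGroup.subsingleton_quotient_top
  have : Finite (unitProj ℚ k).ker := by
    rw [ker_unitProj_rat]
    infer_instance
  rw [hD.tsum_indicator _ hle, Nat.card_of_subsingleton (1 : (𝓞 k)ˣ ⧸ _), one_mul, ker_unitProj_rat]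
  rfl

/-- `u ^ [k':k] / N_{k'/k}(u)`, a unit of relative norm `1`. -/
def relPart (u : (𝓞 k')ˣ) : (𝓞 k')ˣ :=
  u ^ Module.finrank k k' * (Units.map (algebraMap (𝓞 k) (𝓞 k')).toMonoidHom
    (Units.map (RingOfIntegers.norm k) u))⁻¹

lemma relPart_mem (u : (𝓞 k')ˣ) : relPart k k' u ∈ relUnits k k' := by
  have : FiniteDimensional k k' := Module.Finite.of_restrictScalars_finite ℚ k k'
  change Algebra.norm k ((relPart k k' u : 𝓞 k') : k') = 1
  have h1 : ((relPart k k' u : 𝓞 k') : k') * algebraMap k k' (Algebra.norm k (u : k')) =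
      (u : k') ^ Module.finrank k k' := by
    have : relPart k k' u * (Units.map (algebraMap (𝓞 k) (𝓞 k')).toMonoidHom
        (Units.map (RingOfIntegers.norm k) u)) = u ^ Module.finrank k k' := inv_mul_cancel_right _ _
    have := congrArg (fun v : (𝓞 k')ˣ => algebraMap (𝓞 k') k' (v : 𝓞 k')) this
    simp only [Units.val_mul, map_mul, Units.val_pow_eq_pow_val, map_pow] at this
    exact this
  have h2 := congrArg (Algebra.norm k) h1
  rw [map_mul, Algebra.norm_algebraMap, map_pow] at h2
  have h3 : Algebra.norm k (u : k') ≠ 0 := by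
    rw [Algebra.norm_ne_zero_iff]
    exact Units.coe_ne_zero u
  exact mul_right_cancel₀ (pow_ne_zero _ h3) (h2.trans (one_mul _).symm)

lemma coe_unitProj {v : (𝓞 k')ˣ} (hv : v ∈ relUnits k k') :
    ((unitProj k k' v : TRel k k') : T k') = regMap k' v :=
  congrArg Subtype.val (toTRel_coe k k' ⟨regMap k' v, regMap_mem_TRel k k' hv⟩)

lemma relUnitLattice_le_range : relUnitLattice k k' ≤ (unitProj k k').range := by
  rintro x ⟨v, hv, hvx⟩
  exact ⟨v, Subtype.ext ((coe_unitProj k k' hv).trans hvx)⟩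

/-- The norm is a unit of `k` and so projects trivially. Consequently the image of all units in
`T_{k'/k}` has exponent dividing `[k':k]` modulo `U_{k'/k}`. -/
lemma unitProj_relPart (u : (𝓞 k')ˣ) :
    unitProj k k' (relPart k k' u) = unitProj k k' u ^ Module.finrank k k' := by
  have h : Units.map (algebraMap (𝓞 k) (𝓞 k')).toMonoidHom
      (Units.map (RingOfIntegers.norm k) u) ∈ (unitProj k k').ker := baseUnits_le_ker k k' ⟨_, rfl⟩
  rw [relPart, map_mul, map_inv, (MonoidHom.mem_ker).1 h, inv_one, mul_one, map_pow]

lemma unitProj_pow_mem (u : (𝓞 k')ˣ) :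
    unitProj k k' u ^ Module.finrank k k' ∈ relUnitLattice k k' := by
  rw [← unitProj_relPart]
  exact ⟨relPart k k' u, relPart_mem k k' u, (coe_unitProj k k' (relPart_mem k k' u)).symm⟩

/-- If `u` projects trivially, then `relPart u` has all absolute values `1` and is a root of unity;
so a power of `u ^ [k':k]` equals a power of the norm, a unit of `k`. -/
lemma exists_pow_mem_baseUnits {u : (𝓞 k')ˣ} (hu : u ∈ (unitProj k k').ker) :
    ∃ m, 0 < m ∧ u ^ m ∈ baseUnits k k' := by
  have h2 : relPart k k' u ∈ (regMap k').ker := by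
    rw [MonoidHom.mem_ker, ← coe_unitProj k k' (relPart_mem k k' u), unitProj_relPart,
      (MonoidHom.mem_ker).1 hu, one_pow]
    rfl
  rw [mem_ker_regMap] at h2
  obtain ⟨m, hm, hm'⟩ := isOfFinOrder_iff_pow_eq_one.1 ((CommGroup.mem_torsion _).1 h2)
  refine ⟨Module.finrank k k' * m, Nat.mul_pos (finrank_pos' k k') hm, ?_⟩
  rw [relPart, mul_pow, inv_pow, mul_inv_eq_one, ← pow_mul, ← map_pow] at hm'
  rw [hm']
  exact ⟨_, rfl⟩

lemma exists_tsum_indicator : ∃ N : ℕ, N ≠ 0 ∧ ∀ D, IsStrictDomain (relUnitLattice k k') D → ∀ x,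
    ∑' c, D.indicator (1 : TRel k k' → ℝ≥0∞) (quotProj k k' c * x) = N := by
  have : Group.FG (𝓞 k')ˣ := Group.fg_iff_monoid_fg.2 inferInstance
  exact exists_tsum_indicator_quotient (unitProj k k') (baseUnits k k') (baseUnits_le_ker k k')
    (relUnitLattice k k') (relUnitLattice_le_range k k') (finrank_pos' k k') (unitProj_pow_mem k k')
    (fun u => exists_pow_mem_baseUnits k k')

/-- The number of times that the translates by `𝓞_{k'}^× / 𝓞_k^×` of a fundamental domain for
`U_{k'/k}` cover `T_{k'/k}`. -/
def coverNumber : ℕ := (exists_tsum_indicator k k').choose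

lemma tsum_indicator_relUnitLattice {D : Set (TRel k k')}
    (hD : IsStrictDomain (relUnitLattice k k') D) (x : TRel k k') :
    ∑' c, D.indicator (1 : TRel k k' → ℝ≥0∞) (quotProj k k' c * x) = coverNumber k k' :=
  (exists_tsum_indicator k k').choose_spec.2 D hD x

end Dirichlet

/-! ### The relation between the regulators -/

section Powers

lemma haarPos_preimage_pow {m : ℕ} (hm : m ≠ 0) (S : Set PosReal) :
    haarPos ((fun x : PosReal => x ^ m) ⁻¹' S) = (m : ℝ≥0∞)⁻¹ * haarPos S := by
  rw [haarPos_eq, expPos.map_apply, expPos.map_apply]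
  have h2 : expPos ⁻¹' ((fun x : PosReal => x ^ m) ⁻¹' S) =
      (fun x : ℝ => (m : ℝ) * x) ⁻¹' (expPos ⁻¹' S) := by
    ext x
    have : expPos x ^ m = expPos (m * x) := Subtype.ext (Real.exp_nat_mul x m).symm
    simp only [Set.mem_preimage, this]
  rw [h2, Real.volume_preimage_mul_left (by exact_mod_cast hm), abs_of_pos (by positivity),
    ENNReal.ofReal_inv_of_pos (by positivity), ENNReal.ofReal_natCast]

variable (k : Type*) [Field k] [NumberField k]

lemma haarT_map_pow {m : ℕ} (hm : m ≠ 0) :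
    haarT k = ((m : ℝ≥0∞) ^ Fintype.card (InfinitePlace k)) • (haarT k).map fun t => t ^ m := by
  have h1 : Measurable fun t : T k => t ^ m := measurable_pi_iff.2 fun σ =>
    (measurable_pi_apply σ).pow_const m
  refine Measure.pi_eq fun S hS => ?_
  have hpre : (fun t : T k => t ^ m) ⁻¹' Set.pi Set.univ S =
      Set.pi Set.univ fun σ => (fun x : PosReal => x ^ m) ⁻¹' S σ := by
    ext t
    simp
  rw [Measure.smul_apply, Measure.map_apply h1 (MeasurableSet.univ_pi hS), hpre, haarT,
    Measure.pi_pi, smul_eq_mul, Fintype.card, ← Finset.prod_const, ← Finset.prod_mul_distrib]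
  refine Finset.prod_congr rfl fun σ _ => ?_
  have hm' : (m : ℝ≥0∞) ≠ 0 := by exact_mod_cast hm
  rw [Measure.smul_apply, Measure.smul_apply, haarPos_preimage_pow hm (S σ), smul_eq_mul,
    smul_eq_mul, mul_left_comm, ← mul_assoc (m : ℝ≥0∞),
    ENNReal.mul_inv_cancel hm' (ENNReal.natCast_ne_top m), one_mul]

/-- In logarithmic coordinates the power map is multiplication by `m` at each place. This produces
the power of `[E:F]` in the relation between the regulators. -/
lemma lintegral_haarT_pow {m : ℕ} (hm : m ≠ 0) {φ : T k → ℝ≥0∞} (hφ : Measurable φ) :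
    ∫⁻ t, φ t ∂haarT k =
      (m : ℝ≥0∞) ^ Fintype.card (InfinitePlace k) * ∫⁻ t, φ (t ^ m) ∂haarT k := by
  have h1 : Measurable fun t : T k => t ^ m := measurable_pi_iff.2 fun σ =>
    (measurable_pi_apply σ).pow_const m
  conv_lhs => rw [haarT_map_pow k hm]
  rw [lintegral_smul_measure, lintegral_map hφ h1, smul_eq_mul]

lemma absNormT_pow (t : T k) (m : ℕ) : absNormT k (t ^ m) = absNormT k t ^ m := by
  induction m with
  | zero => simp [absNormT_one]
  | succ m ih => rw [pow_succ, absNormT_mul, ih, pow_succ]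

lemma measurable_absNormT : Measurable (absNormT k) := by
  unfold absNormT
  exact Finset.measurable_prod _ fun σ _ =>
    (measurable_subtype_coe.comp (measurable_pi_apply σ)).pow_const _

/-- `(t_σ)_σ ↦ (t_σ ^ a)_σ` -/
def rpowT (a : ℝ) : T k →* T k where
  toFun t := fun σ => ⟨(t σ : ℝ) ^ a, Real.rpow_pos_of_pos (t σ).2 _⟩
  map_one' := by ext; simp
  map_mul' s t := by
    funext σ
    exact Subtype.ext (Real.mul_rpow (s σ).2.le (t σ).2.le)

lemma measurable_rpowT (a : ℝ) : Measurable (rpowT k a) := by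
  rw [measurable_pi_iff]
  intro σ
  apply Measurable.subtype_mk
  exact (measurable_subtype_coe.comp (measurable_pi_apply _)).pow_const _

lemma rpowT_inv_pow {m : ℕ} (hm : m ≠ 0) (t : T k) : rpowT k (m : ℝ)⁻¹ (t ^ m) = t := by
  funext σ
  exact Subtype.ext (Real.pow_rpow_inv_natCast (t σ).2.le hm)

variable (k' : Type*) [Field k'] [NumberField k'] [Algebra k k']

/-- Under `T_{k'} ≃ T_{k'/k} × T_k`, given by `toTRel` and the norm, the Haar measure is the product
measure. -/
lemma lintegral_mul_normT {A : TRel k k' → ℝ≥0∞} (hA : Measurable A) {ψ : T k → ℝ≥0∞}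
    (hψ : Measurable ψ) :
    ∫⁻ t, A (toTRel k k' t) * ψ (normT k k' t) ∂haarT k' =
      (∫⁻ t, A t ∂haarTRel k k') * ∫⁻ u, ψ u ∂haarT k := by
  rw [lintegral_haarTRel k k' (fun t => A (toTRel k k' t) * ψ (normT k k' t)) ((hA.comp (measurable_toTRel k k')).mul
    (hψ.comp (measurable_normT k k')))]
  have h1 : ∀ (u : T k) (t : TRel k k'), toTRel k k' (rootT k k' u * t) = t := by
    intro u t
    rw [map_mul, toTRel_rootT, one_mul, toTRel_coe]
  have h2 : ∀ (u : T k) (t : TRel k k'), normT k k' (rootT k k' u * t) = u := by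
    intro u t
    rw [map_mul, normT_rootT, show normT k k' t = 1 from t.2, mul_one]
  simp_rw [h1, h2]
  rw [← lintegral_const_mul _ hψ]
  refine lintegral_congr fun u => ?_
  rw [lintegral_mul_const _ hA]

end Powers

/-! ### Splitting the units of `E`, and a double count on `T_E`. -/

section RegulatorRelation

variable (F E : Type*) [Field F] [NumberField F] [Field E] [NumberField E] [Algebra F E]

/-- Representatives: every unit of `E` is uniquely the product of a chosen representative of its
class modulo `𝓞_F^×` and of a unit of `F`. -/
def unitSplit : ((𝓞 E)ˣ ⧸ baseUnits F E) × (𝓞 F)ˣ ≃ (𝓞 E)ˣ :=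
  Equiv.ofBijective (fun p => p.1.out * Units.map (algebraMap (𝓞 F) (𝓞 E)).toMonoidHom p.2) (by
    have hmk : ∀ p : ((𝓞 E)ˣ ⧸ baseUnits F E) × (𝓞 F)ˣ, (QuotientGroup.mk (p.1.out *
        Units.map (algebraMap (𝓞 F) (𝓞 E)).toMonoidHom p.2) : (𝓞 E)ˣ ⧸ baseUnits F E) = p.1 := by
      intro p
      refine Eq.trans ?_ (QuotientGroup.out_eq' p.1)
      rw [QuotientGroup.eq, mul_inv_rev, inv_mul_cancel_right]
      exact Subgroup.inv_mem _ ⟨_, rfl⟩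
    have hinj : Function.Injective (Units.map (algebraMap (𝓞 F) (𝓞 E)).toMonoidHom) :=
      Units.map_injective (FaithfulSMul.algebraMap_injective (𝓞 F) (𝓞 E))
    constructor
    · intro p q h
      have h1 : p.1 = q.1 := (hmk p).symm.trans ((congrArg _ h).trans (hmk q))
      refine Prod.ext h1 (hinj ?_)
      have h' : p.1.out * _ = q.1.out * _ := h
      rw [h1] at h'
      exact mul_left_cancel h'
    · intro u
      have : (QuotientGroup.mk u : (𝓞 E)ˣ ⧸ baseUnits F E).out⁻¹ * u ∈ baseUnits F E := by
        rw [← QuotientGroup.eq]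
        exact QuotientGroup.out_eq' _
      obtain ⟨v, hv⟩ := this
      exact ⟨(QuotientGroup.mk u, v), by
        change _ * Units.map _ v = u
        rw [hv, mul_inv_cancel_left]⟩)

lemma unitSplit_apply (p : ((𝓞 E)ˣ ⧸ baseUnits F E) × (𝓞 F)ˣ) :
    unitSplit F E p = p.1.out * Units.map (algebraMap (𝓞 F) (𝓞 E)).toMonoidHom p.2 := rfl

lemma unitProj_unitSplit (p : ((𝓞 E)ˣ ⧸ baseUnits F E) × (𝓞 F)ˣ) :
    unitProj F E (unitSplit F E p) = quotProj F E p.1 := by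
  have h : Units.map (algebraMap (𝓞 F) (𝓞 E)).toMonoidHom p.2 ∈ (unitProj F E).ker :=
    baseUnits_le_ker F E ⟨_, rfl⟩
  rw [unitSplit_apply, map_mul, (MonoidHom.mem_ker).1 h, mul_one]
  exact congrArg (quotProj F E) (QuotientGroup.out_eq' p.1)

/-- A unit `v` of `F` has relative norm `v ^ n`, so it moves the norm by `|v| ^ n`. Taking `n`-th
roots makes `v` act on the `T_{F/ℚ}` coordinate through its own absolute values, as needed to count
with a domain for `U_F`. -/
lemma rpowT_normT_unitSplit (p : ((𝓞 E)ˣ ⧸ baseUnits F E) × (𝓞 F)ˣ) (t : T E) :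
    toTRel ℚ F (rpowT F (Module.finrank F E : ℝ)⁻¹ (normT F E (regMap E (unitSplit F E p) * t))) =
      unitProj ℚ F p.2 *
        toTRel ℚ F (rpowT F (Module.finrank F E : ℝ)⁻¹ (normT F E (regMap E p.1.out * t))) := by
  rw [unitSplit_apply, map_mul (regMap E), regMap_baseUnits, mul_right_comm, map_mul (normT F E),
    normT_rootT, map_mul (rpowT F _), rpowT_inv_pow F (finrank_pos' F E).ne', map_mul, mul_comm]
  rfl

variable {F E}

lemma absNormT_regMap_mul (u : (𝓞 E)ˣ) (t : T E) :
    absNormT E (regMap E u * t) = absNormT E t := by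
  rw [absNormT_mul, absNormT_regMap, one_mul]

/-- The function `Φ` is the indicator of a box in `T_E`: `toTRel t` in `D`, the projection of the
`n`-th root of the norm in `DF`, and absolute norm in `[1, e]`. Fibring over `T_F` computes `∫ Φ`
from the volumes of `D` and `DF`. On the other hand the sum of `Φ` over translates by `𝓞_E^×` is `N
w_F` times the cutoff in the absolute norm, while those of the indicator of `DE` sum to `w_E`;
unfolding gives `w_E ∫ Φ` in terms of the volume of `DE`. -/
lemma measure_relation {D : Set (TRel F E)} (hD : IsStrictDomain (relUnitLattice F E) D)
    {DF : Set (TRel ℚ F)} (hDF : IsStrictDomain (unitLattice F) DF)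
    {DE : Set (TRel ℚ E)} (hDE : IsStrictDomain (unitLattice E) DE) :
    (Module.finrank F E : ℝ≥0∞) * (coverNumber F E * Units.torsionOrder F * haarTRel ℚ E DE) =
      Units.torsionOrder E * ((Module.finrank F E : ℝ≥0∞) ^ Fintype.card (InfinitePlace F) *
        (haarTRel F E D * haarTRel ℚ F DF)) := by
  set n := Module.finrank F E with hn
  have hn0 : n ≠ 0 := (finrank_pos' F E).ne'
  let A : TRel F E → ℝ≥0∞ := D.indicator 1
  let AF : TRel ℚ F → ℝ≥0∞ := DF.indicator 1
  let AE : TRel ℚ E → ℝ≥0∞ := DE.indicator 1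
  -- The cutoff in the absolute norm keeps the volumes finite; on `T_ℚ` it is the indicator of
  -- `boxT`, whose volume is neither `0` nor infinite.
  let b : ℝ → ℝ≥0∞ := (Set.Icc 1 (Real.exp 1)).indicator 1
  have hA : Measurable A := measurable_one.indicator hD.measurableSet
  have hAF : Measurable AF := measurable_one.indicator hDF.measurableSet
  have hAE : Measurable AE := measurable_one.indicator hDE.measurableSet
  have hb : Measurable b := measurable_one.indicator measurableSet_Icc
  let R : T F → TRel ℚ F := fun y => toTRel ℚ F (rpowT F (n : ℝ)⁻¹ y)
  have hR : Measurable R := (measurable_toTRel ℚ F).comp (measurable_rpowT F _)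
  let Φ : T E → ℝ≥0∞ := fun t => A (toTRel F E t) * (AF (R (normT F E t)) *
    b (absNormT F (normT F E t)))
  have hψ : Measurable fun y : T F => AF (R y) * b (absNormT F y) :=
    (hAF.comp hR).mul (hb.comp (measurable_absNormT F))
  have hΦ : Measurable Φ := (hA.comp (measurable_toTRel F E)).mul (hψ.comp (measurable_normT F E))
  let V : ℝ≥0∞ := ∫⁻ u, b (absNormT ℚ u) ∂haarT ℚ
  have hbm : Measurable fun u : T ℚ => b (absNormT ℚ u) := hb.comp (measurable_absNormT ℚ)
  have hVbox : V = haarT ℚ (boxT ℚ) := by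
    rw [← lintegral_indicator_one (measurableSet_boxT ℚ)]
    refine lintegral_congr fun u => ?_
    have h1 : absNormT ℚ u = u default := by
      have hm : (default : InfinitePlace ℚ).mult = 1 := by
        have : (default : InfinitePlace ℚ).IsReal := ⟨Rat.castHom ℂ, by
          ext x; simp, Subsingleton.elim _ _⟩
        exact this.mult_eq_one
      rw [absNormT, Fintype.prod_unique, hm, pow_one]
    have h2 : u ∈ boxT ℚ ↔ absNormT ℚ u ∈ Set.Icc 1 (Real.exp 1) := by
      rw [h1]
      exact ⟨fun h => h _, fun h σ => by rwa [Subsingleton.elim σ default]⟩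
    by_cases h : u ∈ boxT ℚ
    · rw [Set.indicator_of_mem h]
      exact Set.indicator_of_mem (h2.1 h) _
    · rw [Set.indicator_of_notMem h]
      exact Set.indicator_of_notMem (fun h' => h (h2.2 h')) _
  have hV0 : V ≠ 0 := hVbox ▸ haarT_boxT_ne_zero ℚ
  have hVt : V ≠ ∞ := hVbox ▸ haarT_boxT_ne_top ℚ
  have hintA : ∫⁻ t, A t ∂haarTRel F E = haarTRel F E D := lintegral_indicator_one hD.measurableSet
  have hintAF : ∫⁻ t, AF t ∂haarTRel ℚ F = haarTRel ℚ F DF :=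
    lintegral_indicator_one hDF.measurableSet
  have hintAE : ∫⁻ t, AE t ∂haarTRel ℚ E = haarTRel ℚ E DE :=
    lintegral_indicator_one hDE.measurableSet
  -- the fibration of `T_E` over `T_F`
  have e1 : ∫⁻ t, Φ t ∂haarT E = haarTRel F E D *
      ((n : ℝ≥0∞) ^ Fintype.card (InfinitePlace F) *
        (haarTRel ℚ F DF * ∫⁻ u, b (absNormT ℚ u ^ n) ∂haarT ℚ)) := by
    rw [lintegral_mul_normT F E hA hψ, hintA, lintegral_haarT_pow F hn0 hψ]
    congr 2
    have h1 : ∀ y : T F, AF (R (y ^ n)) * b (absNormT F (y ^ n)) =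
        AF (toTRel ℚ F y) * b (absNormT ℚ (normT ℚ F y) ^ n) := by
      intro y
      change AF (toTRel ℚ F (rpowT F (n : ℝ)⁻¹ (y ^ n))) * _ = _
      rw [rpowT_inv_pow F hn0, absNormT_pow, absNormT_normT]
    simp_rw [h1]
    rw [lintegral_mul_normT ℚ F hAF (ψ := fun u => b (absNormT ℚ u ^ n))
      (hb.comp ((measurable_absNormT ℚ).pow_const n)), hintAF]
  -- Over `F` the cutoff appears at the `n`-th power, over `ℚ` at the first; the rescaling on the
  -- single place of `ℚ` gives the isolated factor `n`.
  have e2 : V = n * ∫⁻ u, b (absNormT ℚ u ^ n) ∂haarT ℚ := by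
    change ∫⁻ u, b (absNormT ℚ u) ∂haarT ℚ = _
    rw [lintegral_haarT_pow ℚ hn0 hbm, Fintype.card_unique, pow_one]
    simp_rw [absNormT_pow]
  -- the fibration of `T_E` over `T_ℚ`
  have hsum : ∀ t, ∑' u : (𝓞 E)ˣ, Φ (regMap E u * t) =
      coverNumber F E * Units.torsionOrder F * b (absNormT E t) := by
    intro t
    rw [← (unitSplit F E).tsum_eq, ENNReal.tsum_prod (f := fun c v =>
      Φ (regMap E (unitSplit F E (c, v)) * t))]
    have h1 : ∀ c v, Φ (regMap E (unitSplit F E (c, v)) * t) =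
        A (quotProj F E c * toTRel F E t) *
          (AF (unitProj ℚ F v * R (normT F E (regMap E c.out * t))) * b (absNormT E t)) := by
      intro c v
      change A (toTRel F E _) * (AF (toTRel ℚ F (rpowT F _ (normT F E _))) * b _) = _
      rw [rpowT_normT_unitSplit, absNormT_normT, absNormT_regMap_mul, map_mul (toTRel F E),
        ← unitProj_unitSplit F E (c, v)]
      rfl
    simp_rw [h1, ENNReal.tsum_mul_left, ENNReal.tsum_mul_right]
    have h2 : ∀ x, ∑' v : (𝓞 F)ˣ, AF (unitProj ℚ F v * x) = (Units.torsionOrder F : ℕ) :=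
      tsum_indicator_unitLattice F hDF
    have h3 : ∑' c, A (quotProj F E c * toTRel F E t) = coverNumber F E :=
      tsum_indicator_relUnitLattice F E hD _
    simp_rw [h2]
    rw [ENNReal.tsum_mul_right, h3, mul_assoc]
  have e3 : Units.torsionOrder E * ∫⁻ t, Φ t ∂haarT E =
      coverNumber F E * Units.torsionOrder F * (haarTRel ℚ E DE * V) := by
    have hAEm : ∀ u : (𝓞 E)ˣ, Measurable fun t : T E => AE (toTRel ℚ E (regMap E u * t)) :=
      fun u => hAE.comp ((measurable_toTRel ℚ E).comp (measurable_const_mul _))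
    calc _ = ∫⁻ t, ∑' u : (𝓞 E)ˣ, AE (toTRel ℚ E (regMap E u * t)) * Φ t ∂haarT E := by
          rw [← lintegral_const_mul _ hΦ]
          refine lintegral_congr fun t => ?_
          rw [ENNReal.tsum_mul_right]
          congr 1
          have := tsum_indicator_unitLattice E hDE (toTRel ℚ E t)
          rw [← this]
          exact tsum_congr fun u => by rw [map_mul]; rfl
      _ = ∑' u : (𝓞 E)ˣ, ∫⁻ t, AE (toTRel ℚ E (regMap E u * t)) * Φ t ∂haarT E :=
          lintegral_tsum fun u => ((hAEm u).mul hΦ).aemeasurable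
      -- Invariance of the Haar measure moves the translation from the indicator of `DE` to `Φ`.
      _ = ∑' u : (𝓞 E)ˣ, ∫⁻ t, AE (toTRel ℚ E t) * Φ (regMap E u⁻¹ * t) ∂haarT E := by
          refine tsum_congr fun u => ?_
          rw [← lintegral_mul_left_eq_self (μ := haarT E)
            (fun t => AE (toTRel ℚ E t) * Φ (regMap E u⁻¹ * t)) (regMap E u)]
          refine lintegral_congr fun t => ?_
          rw [map_inv, inv_mul_cancel_left]
      _ = ∫⁻ t, ∑' u : (𝓞 E)ˣ, AE (toTRel ℚ E t) * Φ (regMap E u⁻¹ * t) ∂haarT E :=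
          (lintegral_tsum fun u => ((hAE.comp (measurable_toTRel ℚ E)).mul
            (hΦ.comp (measurable_const_mul _))).aemeasurable).symm
      _ = ∫⁻ t, coverNumber F E * Units.torsionOrder F *
            (AE (toTRel ℚ E t) * b (absNormT ℚ (normT ℚ E t))) ∂haarT E := by
          refine lintegral_congr fun t => ?_
          have hinv : ∑' u : (𝓞 E)ˣ, Φ (regMap E u⁻¹ * t) = ∑' u : (𝓞 E)ˣ, Φ (regMap E u * t) :=
            (Equiv.inv (𝓞 E)ˣ).tsum_eq fun u => Φ (regMap E u * t)
          rw [ENNReal.tsum_mul_left, hinv, hsum, absNormT_normT]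
          ring
      _ = _ := by
          have hm : Measurable fun t : T E => AE (toTRel ℚ E t) * b (absNormT ℚ (normT ℚ E t)) :=
            (hAE.comp (measurable_toTRel ℚ E)).mul (hbm.comp (measurable_normT ℚ E))
          rw [lintegral_const_mul _ hm, lintegral_mul_normT ℚ E hAE hbm, hintAE]
  rw [e1] at e3
  set J := ∫⁻ u, b (absNormT ℚ u ^ n) ∂haarT ℚ
  rw [e2] at e3
  rw [e2] at hV0 hVt
  have hJ0 : J ≠ 0 := fun h => hV0 (by rw [h, mul_zero])
  have hJt : J ≠ ∞ := by
    intro h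
    rw [h, ENNReal.mul_top (by exact_mod_cast hn0)] at hVt
    exact hVt rfl
  -- The common factor `J` is finite and non-zero because `n J = V` is.
  rw [← ENNReal.mul_left_inj hJ0 hJt]
  calc _ = coverNumber F E * Units.torsionOrder F * (haarTRel ℚ E DE * (n * J)) := by ring
    _ = _ := by rw [← e3]; ring

variable (F E)

lemma regulator_pos : 0 < regulator F := by
  obtain ⟨DF, hDF⟩ := exists_isStrictDomain_of_le_range ℚ F (coe_mem_range_of_mem_unitLattice F)
  rw [regulator, Measure.real, quotMeasure_univ hDF]
  exact ENNReal.toReal_pos (hDF.measure_ne_zero (haarTRel_ne_zero ℚ F))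
    (haarTRel_unitLattice_lt_top F hDF).ne

/-- The relation between the regulators of `E`, `F` and `E/F`. -/
theorem regulator_relation :
    Module.finrank F E * (coverNumber F E * Units.torsionOrder F * regulator E) =
      Units.torsionOrder E * ((Module.finrank F E : ℝ) ^ Fintype.card (InfinitePlace F) *
        (relRegulator F E * regulator F)) := by
  obtain ⟨D, hD⟩ := exists_isStrictDomain_of_le_range F E (coe_mem_range_of_mem_relUnitLattice F E)
  obtain ⟨DF, hDF⟩ := exists_isStrictDomain_of_le_range ℚ F (coe_mem_range_of_mem_unitLattice F)
  obtain ⟨DE, hDE⟩ := exists_isStrictDomain_of_le_range ℚ E (coe_mem_range_of_mem_unitLattice E)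
  have h := congrArg ENNReal.toReal (measure_relation hD hDF hDE)
  simp only [ENNReal.toReal_mul, ENNReal.toReal_natCast, ENNReal.toReal_pow] at h
  simpa only [regulator, relRegulator, Measure.real, quotMeasure_univ hD, quotMeasure_univ hDF,
    quotMeasure_univ hDE] using h

end RegulatorRelation

/-! ### Gamma factors -/

section GammaFactors

lemma integral_haarPos (g : ℝ → ℂ) :
    (Integrable (fun x : PosReal => g x) haarPos ↔
      IntegrableOn (fun x : ℝ => ((x⁻¹ : ℝ) : ℂ) * g x) (Set.Ioi 0)) ∧
    ∫ x : PosReal, g x ∂haarPos = ∫ x in Set.Ioi (0 : ℝ), ((x⁻¹ : ℝ) : ℂ) * g x := by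
  have he : MeasurableEmbedding (Subtype.val : PosReal → ℝ) :=
    MeasurableEmbedding.subtype_coe measurableSet_Ioi
  have hm : Measurable fun x : ℝ => ENNReal.ofReal x⁻¹ := by fun_prop
  have hfin : ∀ᵐ x ∂(volume.restrict (Set.Ioi (0 : ℝ))), ENNReal.ofReal x⁻¹ < ∞ :=
    Filter.Eventually.of_forall fun _ => ENNReal.ofReal_lt_top
  have hmap : haarPos.map Subtype.val =
      (volume.restrict (Set.Ioi (0 : ℝ))).withDensity fun x : ℝ => ENNReal.ofReal x⁻¹ := by
    have hr : Set.range (Subtype.val : PosReal → ℝ) = Set.Ioi 0 := Subtype.range_val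
    rw [haarPos, he.map_comap, hr, restrict_withDensity measurableSet_Ioi]
  have hcongr : ∀ x ∈ Set.Ioi (0 : ℝ), (ENNReal.ofReal x⁻¹).toReal • g x = ((x⁻¹ : ℝ) : ℂ) * g x := by
    intro x hx
    rw [ENNReal.toReal_ofReal (inv_nonneg.2 (le_of_lt hx)), Complex.real_smul]
  constructor
  · rw [← integrableOn_congr_fun hcongr measurableSet_Ioi, IntegrableOn,
      ← integrable_withDensity_iff_integrable_smul' hm hfin, ← hmap, he.integrable_map_iff]
    rfl
  · rw [← setIntegral_congr_fun measurableSet_Ioi hcongr,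
      ← integral_withDensity_eq_integral_toReal_smul hm hfin, ← hmap, he.integral_map]

/-- `∫_0^∞ x^b exp(-c x^a) dx / x = a⁻¹ c^{-b/a} Γ(b/a)` -/
lemma integral_haarPos_exp {a c : ℝ} (ha : 0 < a) (hc : 0 < c) {b : ℂ} (hb : 0 < b.re) :
    Integrable (fun x : PosReal => ((x : ℝ) : ℂ) ^ b * ((Real.exp (-(c * (x : ℝ) ^ a)) : ℝ) : ℂ))
      haarPos ∧
    ∫ x : PosReal, ((x : ℝ) : ℂ) ^ b * ((Real.exp (-(c * (x : ℝ) ^ a)) : ℝ) : ℂ) ∂haarPos =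
      (a : ℂ)⁻¹ * ((c : ℂ) ^ (-(b / a)) * Complex.Gamma (b / a)) := by
  have hba : 0 < (b / a).re := by
    rw [Complex.div_ofReal_re]
    exact div_pos hb ha
  obtain ⟨h1, h2⟩ := integral_haarPos fun x : ℝ => (x : ℂ) ^ b * ((Real.exp (-(c * x ^ a)) : ℝ) : ℂ)
  let g : ℝ → ℂ := fun x => ((Real.exp (-x) : ℝ) : ℂ)
  have hcongr : ∀ x ∈ Set.Ioi (0 : ℝ), ((x⁻¹ : ℝ) : ℂ) * ((x : ℂ) ^ b *
      ((Real.exp (-(c * x ^ a)) : ℝ) : ℂ)) = (x : ℂ) ^ (b - 1) • g (c * x ^ a) := by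
    intro x hx
    have hx0 : (x : ℂ) ≠ 0 := by exact_mod_cast (ne_of_gt hx)
    rw [Complex.cpow_sub _ _ hx0, Complex.cpow_one, smul_eq_mul, Complex.ofReal_inv]
    ring
  rw [h1, h2, setIntegral_congr_fun measurableSet_Ioi hcongr,
    integrableOn_congr_fun hcongr measurableSet_Ioi]
  constructor
  · refine (MellinConvergent.comp_rpow (f := fun y => g (c * y)) ha.ne').2
      ((MellinConvergent.comp_mul_left (f := g) hc).2 ?_)
    have := Complex.GammaIntegral_convergent hba
    refine this.congr_fun (fun x _ => ?_) measurableSet_Ioi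
    rw [smul_eq_mul, mul_comm]
  · refine (mellin_comp_rpow (fun y => g (c * y)) b a).trans ?_
    rw [mellin_comp_mul_left g _ hc, abs_of_pos ha,
      Complex.Gamma_eq_integral hba, Complex.GammaIntegral_eq_mellin, Complex.real_smul, smul_eq_mul,
      Complex.ofReal_inv]

lemma integral_smul_haarPos_exp {a c : ℝ} (ha : 0 < a) (hc : 0 < c) {b : ℂ} (hb : 0 < b.re) (m : ℕ) :
    Integrable (fun x : PosReal => ((x : ℝ) : ℂ) ^ b * ((Real.exp (-(c * (x : ℝ) ^ a)) : ℝ) : ℂ))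
      ((m : ℝ≥0∞) • haarPos) ∧
    ∫ x : PosReal, ((x : ℝ) : ℂ) ^ b * ((Real.exp (-(c * (x : ℝ) ^ a)) : ℝ) : ℂ)
        ∂((m : ℝ≥0∞) • haarPos) =
      m * (a : ℂ)⁻¹ * Complex.Gamma (b / a) * (c : ℂ) ^ (-(b / a)) := by
  obtain ⟨h1, h2⟩ := integral_haarPos_exp ha hc hb
  refine ⟨h1.smul_measure (ENNReal.natCast_ne_top m), ?_⟩
  rw [integral_smul_measure, h2, ENNReal.toReal_natCast, Complex.real_smul, Complex.ofReal_natCast]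
  ring

variable (k k' : Type*) [Field k] [NumberField k] [Field k'] [NumberField k'] [Algebra k k']

lemma integral_haarT_exp {a : ℝ} (ha : 0 < a) (c : InfinitePlace k → ℝ) (hc : ∀ σ, 0 < c σ) {s : ℂ}
    (hs : 0 < s.re) :
    Integrable (fun u : T k => (absNormT k u : ℂ) ^ s *
      ((Real.exp (-∑ σ, c σ * (u σ : ℝ) ^ a) : ℝ) : ℂ)) (haarT k) ∧
    ∫ u : T k, (absNormT k u : ℂ) ^ s * ((Real.exp (-∑ σ, c σ * (u σ : ℝ) ^ a) : ℝ) : ℂ) ∂haarT k =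
      ∏ σ : InfinitePlace k, (σ.mult * (a : ℂ)⁻¹ * Complex.Gamma (σ.mult * s / a) *
        (c σ : ℂ) ^ (-(σ.mult * s / a))) := by
  have hre : ∀ σ : InfinitePlace k, 0 < ((σ.mult : ℂ) * s).re := by
    intro σ
    rw [← Complex.ofReal_natCast, Complex.re_ofReal_mul]
    exact mul_pos (by exact_mod_cast Nat.pos_of_ne_zero σ.mult_ne_zero) hs
  have hf : ∀ u : T k, (absNormT k u : ℂ) ^ s *
      ((Real.exp (-∑ σ, c σ * (u σ : ℝ) ^ a) : ℝ) : ℂ) =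
      ∏ σ : InfinitePlace k, (((u σ : ℝ) : ℂ) ^ ((σ.mult : ℂ) * s) *
        ((Real.exp (-(c σ * (u σ : ℝ) ^ a)) : ℝ) : ℂ)) := by
    intro u
    rw [absNormT, ofReal_prod_cpow _ _ (fun σ => pow_pos (u σ).2 _), ← Finset.sum_neg_distrib,
      Real.exp_sum, Complex.ofReal_prod, ← Finset.prod_mul_distrib]
    refine Finset.prod_congr rfl fun σ _ => ?_
    rw [ofReal_pow_cpow (u σ).2]
  simp_rw [hf]
  constructor
  · exact Integrable.fintype_prod (f := fun (σ : InfinitePlace k) (x : PosReal) =>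
      ((x : ℝ) : ℂ) ^ ((σ.mult : ℂ) * s) * ((Real.exp (-(c σ * (x : ℝ) ^ a)) : ℝ) : ℂ))
      fun σ => (integral_smul_haarPos_exp ha (hc σ) (hre σ) _).1
  · rw [haarT, integral_fintype_prod_eq_prod (f := fun (σ : InfinitePlace k) (x : PosReal) =>
      ((x : ℝ) : ℂ) ^ ((σ.mult : ℂ) * s) * ((Real.exp (-(c σ * (x : ℝ) ^ a)) : ℝ) : ℂ))]
    exact Finset.prod_congr rfl fun σ _ => (integral_smul_haarPos_exp ha (hc σ) (hre σ) _).2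

/-- This restates `lintegral_haarTRel` in the form needed for Fubini with complex integrands. -/
lemma measurePreserving_rootT_mul :
    MeasurePreserving (fun p : T k × TRel k k' => rootT k k' p.1 * (p.2 : T k'))
      ((haarT k).prod (haarTRel k k')) (haarT k') := by
  have hm : Measurable fun p : T k × TRel k k' => rootT k k' p.1 * (p.2 : T k') :=
    ((measurable_rootT k k').comp measurable_fst).mul (measurable_subtype_coe.comp measurable_snd)
  refine ⟨hm, ?_⟩
  ext S hS
  rw [Measure.map_apply hm hS, ← lintegral_indicator_one (hm hS), ← lintegral_indicator_one hS,
    lintegral_haarTRel k k' _ (measurable_one.indicator hS),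
    lintegral_prod _ (measurable_one.indicator (hm hS)).aemeasurable]
  rfl

/-- The factor at infinity `∏_σ (n_σ / 2) Γ(n_σ s / 2)`. -/
def gammaProd (s : ℂ) : ℂ :=
  ∏ σ : InfinitePlace k, ((σ.mult : ℂ) / 2 * Complex.Gamma (σ.mult * s / 2))

variable {k} in
lemma gammaProd_ne_zero {s : ℂ} (hs : 0 < s.re) : gammaProd k s ≠ 0 := by
  refine Finset.prod_ne_zero_iff.2 fun σ _ => ?_
  have hm : (σ.mult : ℂ) ≠ 0 := by exact_mod_cast σ.mult_ne_zero
  refine mul_ne_zero (div_ne_zero hm two_ne_zero) (Complex.Gamma_ne_zero_of_re_pos ?_)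
  have : ((σ.mult : ℂ) * s / 2).re = σ.mult * s.re / 2 := by simp
  rw [this]
  have : (0 : ℝ) < σ.mult := by exact_mod_cast Nat.pos_of_ne_zero σ.mult_ne_zero
  positivity

/-- The gamma factor of `k'/k` in terms of gamma functions. -/
theorem integral_gammaFun {s : ℂ} (hs : 0 < s.re) :
    Integrable (fun t : TRel k k' => gammaFun k k' s t) (haarTRel k k') ∧
    (Module.finrank k k' : ℂ) ^ Fintype.card (InfinitePlace k) *
      gammaProd k (Module.finrank k k' * s) * relGamma k k' s = gammaProd k' s := by
  set m := Module.finrank k k' with hmdef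
  have hm0 : (0 : ℝ) < m := by exact_mod_cast finrank_pos' k k'
  have hmc : (m : ℂ) ≠ 0 := by exact_mod_cast hm0.ne'
  -- Over all of `T_{k'}` this function integrates to a product of gamma integrals, one for each
  -- place; along the cosets of `rootT (T_k)` it integrates to a multiple of `gammaFun`.
  let f : T k' → ℂ := fun t => (absNormT k' t : ℂ) ^ s *
    ((Real.exp (-∑ τ, 1 * (t τ : ℝ) ^ (2 : ℝ)) : ℝ) : ℂ)
  obtain ⟨hf1, hf2⟩ := integral_haarT_exp k' (a := 2) two_pos (fun _ => 1) (fun _ => one_pos) hs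
  have hf2' : ∫ t, f t ∂haarT k' = gammaProd k' s := by
    refine hf2.trans (Finset.prod_congr rfl fun τ _ => ?_)
    rw [Complex.ofReal_one, Complex.one_cpow, mul_one]
    push_cast
    ring
  let C : ℂ := (m : ℂ) ^ Fintype.card (InfinitePlace k) * gammaProd k (m * s)
  have hms : 0 < ((m : ℂ) * s).re := by
    rw [← Complex.ofReal_natCast, Complex.re_ofReal_mul]
    exact mul_pos hm0 hs
  have hC : C ≠ 0 := mul_ne_zero (pow_ne_zero _ hmc) (gammaProd_ne_zero hms)
  have hfib : ∀ (u : T k) (t : TRel k k'), f (rootT k k' u * t) = (absNormT k u : ℂ) ^ s *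
      ((Real.exp (-∑ σ, sqSum σ (t : T k') * (u σ : ℝ) ^ (2 * (m : ℝ)⁻¹)) : ℝ) : ℂ) := by
    intro u t
    have h1 : absNormT k' (rootT k k' u * t) = absNormT k u := by
      rw [← absNormT_normT k k', map_mul, normT_rootT, show normT k k' t = 1 from t.2, mul_one]
    have h2 : ∑ τ : InfinitePlace k', 1 * (((rootT k k' u * t : T k') τ : PosReal) : ℝ) ^ (2 : ℝ) =
        ∑ σ, sqSum σ (t : T k') * (u σ : ℝ) ^ (2 * (m : ℝ)⁻¹) := by
      have h3 : ∀ σ : InfinitePlace k, sqSum σ (t : T k') * (u σ : ℝ) ^ (2 * (m : ℝ)⁻¹) =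
          ∑ τ : Above k' σ, (((rootT k k' u * t : T k') τ.1 : PosReal) : ℝ) ^ 2 := by
        intro σ
        rw [mul_comm, ← sqSum_rootT_mul]
        rfl
      classical
      simp_rw [h3, one_mul, Real.rpow_two]
      symm
      convert Fintype.sum_fiberwise (fun τ : InfinitePlace k' => τ.comap (algebraMap k k'))
        fun τ => (((rootT k k' u * t : T k') τ : PosReal) : ℝ) ^ 2
    simp only [f]
    rw [h1, h2]
  have hinner : ∀ t : TRel k k', ∫ u, f (rootT k k' u * t) ∂haarT k = C * gammaFun k k' s t := by
    intro t
    simp_rw [hfib]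
    -- On such a coset `u` enters `∑ t_τ²` through its `m`-th root, whence the exponent `2 / m`; its
    -- inverse is responsible for the factor `m / 2` at each place.
    rw [(integral_haarT_exp k (a := 2 * (m : ℝ)⁻¹) (by positivity) (fun σ => sqSum σ (t : T k'))
      (fun σ => sqSum_pos σ _) hs).2]
    simp only [C, gammaProd, gammaFun, Fintype.card, ← Finset.prod_const, ← Finset.prod_mul_distrib]
    refine Finset.prod_congr rfl fun σ _ => ?_
    have h4 : (σ.mult : ℂ) * s / ((2 * (m : ℝ)⁻¹ : ℝ) : ℂ) = σ.mult * (m * s) / 2 := by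
      push_cast
      field_simp
    have h5 : (((2 * (m : ℝ)⁻¹ : ℝ) : ℂ))⁻¹ = m / 2 := by
      push_cast
      field_simp
    rw [h4, h5]
    congr 1
    · ring
    · congr 1
      ring
  have hmp := measurePreserving_rootT_mul k k'
  have hfm : AEStronglyMeasurable f (haarT k') := hf1.aestronglyMeasurable
  have hint : Integrable (fun p : T k × TRel k k' => f (rootT k k' p.1 * (p.2 : T k')))
      ((haarT k).prod (haarTRel k k')) :=
    (hmp.integrable_comp hfm).2 hf1
  constructor
  -- Fubini gives integrability of `C * gammaFun`, and `C` is non-zero since the gamma function has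
  -- no zeros.
  · have h1 := hint.integral_prod_right
    simp_rw [hinner] at h1
    have h2 := h1.const_mul C⁻¹
    simpa only [inv_mul_cancel_left₀ hC] using h2
  · have h1 : ∫ p : T k × TRel k k', f (rootT k k' p.1 * (p.2 : T k'))
        ∂(haarT k).prod (haarTRel k k') = gammaProd k' s := by
      rw [← hf2', ← hmp.map_eq, integral_map hmp.measurable.aemeasurable (by rwa [hmp.map_eq])]
    rw [integral_prod_symm _ hint] at h1
    simp_rw [hinner] at h1
    rw [integral_const_mul] at h1
    exact h1

variable (F E : Type*) [Field F] [NumberField F] [Field E] [NumberField E] [Algebra F E]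

/-- The constant `c_{E/F}(s)` is `Γ_{E/F}(s)` times the number of times that the translates under
`𝓞_E^× / 𝓞_F^×` of a fundamental domain of `U_{E/F}` cover `T_{E/F}`. -/
theorem heckeFactor_eq {s : ℂ} (hs : 0 < s.re) :
    heckeFactor F E s = coverNumber F E * relGamma F E s := by
  set n := Module.finrank F E with hn
  have hnc : (n : ℂ) ≠ 0 := by exact_mod_cast (finrank_pos' F E).ne'
  have hns : 0 < ((n : ℂ) * s).re := by
    rw [← Complex.ofReal_natCast, Complex.re_ofReal_mul]
    exact mul_pos (by exact_mod_cast finrank_pos' F E) hs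
  have hmul : Module.finrank ℚ E = Module.finrank ℚ F * n := (Module.finrank_mul_finrank ℚ F E).symm
  have hF0 : (Module.finrank ℚ F : ℂ) ≠ 0 := by exact_mod_cast (finrank_pos' ℚ F).ne'
  have h1 := (integral_gammaFun F E hs).2
  have h2 := (integral_gammaFun ℚ E hs).2
  have h3 := (integral_gammaFun ℚ F hns).2
  rw [Fintype.card_unique, pow_one, hmul] at h2
  rw [Fintype.card_unique, pow_one] at h3
  rw [← hn, ← h3, ← h2] at h1
  push_cast at h1
  have hG : gammaProd ℚ ((Module.finrank ℚ F : ℂ) * (n * s)) ≠ 0 := by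
    apply gammaProd_ne_zero
    rw [← Complex.ofReal_natCast, Complex.re_ofReal_mul]
    exact mul_pos (by exact_mod_cast finrank_pos' ℚ F) hns
  rw [mul_assoc (Module.finrank ℚ F : ℂ) (n : ℂ) s] at h1
  -- The gamma identities for `E/F` at `s`, for `E/ℚ` at `s` and for `F/ℚ` at `n s` are combined;
  -- the factor of `ℚ` at `[E:ℚ] s` and the degree `[F:ℚ]` cancel.
  have h4 : (n : ℂ) ^ Fintype.card (InfinitePlace F) * relGamma ℚ F (n * s) * relGamma F E s =
      n * relGamma ℚ E s := by
    apply mul_left_cancel₀ (mul_ne_zero hF0 hG)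
    linear_combination h1
  have hΓ0 : relGamma ℚ F (n * s) ≠ 0 := by
    intro h
    rw [h, mul_zero] at h3
    exact gammaProd_ne_zero hns h3.symm
  have h5 : (n : ℂ) * (coverNumber F E * Units.torsionOrder F * regulator E) =
      Units.torsionOrder E * ((n : ℂ) ^ Fintype.card (InfinitePlace F) *
        (relRegulator F E * regulator F)) := by
    exact_mod_cast congrArg (fun x : ℝ => (x : ℂ)) (regulator_relation F E)
  have hwF : (Units.torsionOrder F : ℂ) ≠ 0 := by exact_mod_cast Units.torsionOrder_ne_zero F
  have hwE : (Units.torsionOrder E : ℂ) ≠ 0 := by exact_mod_cast Units.torsionOrder_ne_zero E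
  have hRF : (regulator F : ℂ) ≠ 0 := by exact_mod_cast (regulator_pos F).ne'
  have hRE : (regulator E : ℂ) ≠ 0 := by exact_mod_cast (regulator_pos E).ne'
  rw [heckeFactor, ← hn, mul_div_assoc', div_eq_iff (mul_ne_zero (mul_ne_zero hwF (inv_ne_zero hRF)) hΓ0)]
  have h6 : (relRegulator F E : ℂ) * Units.torsionOrder E * regulator F * relGamma ℚ E s =
      coverNumber F E * relGamma F E s * Units.torsionOrder F * relGamma ℚ F (n * s) * regulator E := by
    apply mul_left_cancel₀ hnc
    linear_combination (-(Units.torsionOrder E * relRegulator F E * regulator F : ℂ)) * h4 -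
      (relGamma F E s * relGamma ℚ F (n * s)) * h5
  field_simp
  linear_combination h6

end GammaFactors

/-! ### Summability -/

section IdealSums

variable (k : Type*) [Field k] [NumberField k]

open Filter in
/-- The Dedekind zeta function converges absolutely for `s > 1`. -/
lemma summable_absNorm_rpow {s : ℝ} (hs : 1 < s) :
    Summable fun I : (Ideal (𝓞 k))⁰ => (Ideal.absNorm (I : Ideal (𝓞 k)) : ℝ) ^ (-s) := by
  let N : (Ideal (𝓞 k))⁰ → ℕ := fun I => Ideal.absNorm (I : Ideal (𝓞 k))
  have hN0 : ∀ I, N I ≠ 0 := fun I => Ideal.absNorm_ne_zero_of_nonZeroDivisors I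
  have hfin : ∀ m, Finite {I // N I = m} := by
    intro m
    have := (Ideal.finite_setOfPred_absNorm_eq (S := 𝓞 k) m).to_subtype
    let g : {I // N I = m} → {I : Ideal (𝓞 k) | Ideal.absNorm I = m} := fun I => ⟨I.1.1, I.2⟩
    refine Finite.of_injective g fun I J h => ?_
    have h' : (I.1 : Ideal (𝓞 k)) = J.1 := congrArg (fun K => (K.1 : Ideal (𝓞 k))) h
    exact Subtype.ext (Subtype.ext h')
  let a : ℕ → ℝ := fun m => Nat.card {I // N I = m}
  -- The number of ideals of norm at most `m`, divided by `m`, has a finite limit; linear growth of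
  -- the partial sums gives convergence of the Dirichlet series for `s > 1`.
  have hO : (fun m : ℕ => ∑ i ∈ Finset.Icc 1 m, a i) =O[atTop] fun m : ℕ => (m : ℝ) ^ (1 : ℝ) := by
    have h1 := ((Ideal.tendsto_norm_le_div_atTop₀ k).comp tendsto_natCast_atTop_atTop)
    have h2 : (fun m : ℕ => ∑ i ∈ Finset.Icc 1 m, a i) =
        fun m : ℕ => (Nat.card {I : (Ideal (𝓞 k))⁰ // (N I : ℝ) ≤ (m : ℝ)} : ℝ) := by
      funext m
      have h3 := Finset.card_preimage_eq_sum_card_image_eq (f := N) (s := Finset.Icc 1 m)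
        fun b _ => (hfin b : Finite {I | N I = b})
      simp only [a]
      rw [← Nat.cast_sum, ← h3]
      congr 1
      refine Nat.card_congr (Equiv.subtypeEquivRight fun I => ?_)
      simp [Nat.one_le_iff_ne_zero, hN0 I]
    rw [h2]
    have h4 := h1.isBigO_one ℝ
    have h5 := h4.mul (Asymptotics.isBigO_refl (fun m : ℕ => (m : ℝ)) atTop)
    refine (h5.congr' ?_ ?_)
    · filter_upwards [eventually_ne_atTop 0] with m hm
      exact div_mul_cancel₀ _ (by exact_mod_cast hm)
    · filter_upwards with m
      rw [one_mul, Real.rpow_one]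
  have hL := LSeriesSummable_of_sum_norm_bigO_and_nonneg hO (fun m => Nat.cast_nonneg _) zero_le_one
    (s := (s : ℂ)) (by simpa using hs)
  have hL' := hL.norm
  -- The sum over ideals is regrouped by the norm, each fibre being finite.
  have hnn : ∀ p : Σ m, {I // N I = m}, 0 ≤ ((fun I : (Ideal (𝓞 k))⁰ =>
      (Ideal.absNorm (I : Ideal (𝓞 k)) : ℝ) ^ (-s)) ∘ (Equiv.sigmaFiberEquiv N)) p :=
    fun p => Real.rpow_nonneg (Nat.cast_nonneg _) _
  rw [← (Equiv.sigmaFiberEquiv N).summable_iff, summable_sigma_of_nonneg hnn]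
  have hval : ∀ (m : ℕ) (I : {I // N I = m}), ((fun I : (Ideal (𝓞 k))⁰ =>
      (Ideal.absNorm (I : Ideal (𝓞 k)) : ℝ) ^ (-s)) ∘ (Equiv.sigmaFiberEquiv N)) ⟨m, I⟩ =
      (m : ℝ) ^ (-s) := by
    intro m I
    change ((N I.1 : ℕ) : ℝ) ^ (-s) = _
    rw [I.2]
  refine ⟨fun m => Summable.of_finite, hL'.congr fun m => ?_⟩
  have := Fintype.ofFinite {I // N I = m}
  simp_rw [hval]
  rw [LSeries.norm_term_eq, tsum_const, nsmul_eq_mul]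
  split_ifs with hm
  · have : IsEmpty {I // N I = m} := ⟨fun I => hN0 I.1 (I.2.trans hm)⟩
    simp
  · rw [Real.rpow_neg (Nat.cast_nonneg _), ← div_eq_mul_inv]
    simp [a]

/-- The series of the partial zeta functions. -/
lemma summable_zetaTerm {C : ClassGroup (𝓞 k)} {s : ℂ} (hs : 1 < s.re) :
    Summable (zetaTerm (C := C) s) := by
  refine Summable.of_norm ?_
  have h := (summable_absNorm_rpow k hs).comp_injective
    (Subtype.val_injective : Function.Injective (Subtype.val : IntegralIdealsIn C → _))
  refine h.congr fun 𝔟 => ?_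
  rw [zetaTerm, Complex.norm_natCast_cpow_of_pos
    (Nat.pos_of_ne_zero (Ideal.absNorm_ne_zero_of_nonZeroDivisors 𝔟.1)), Complex.neg_re]
  rfl

variable {k}

lemma fracNorm_pos (𝔄 : FracIdeal k) : 0 < fracNorm 𝔄 := by
  refine lt_of_le_of_ne (FractionalIdeal.absNorm_nonneg _) fun h => ?_
  exact 𝔄.ne_zero (FractionalIdeal.absNorm_eq_zero_iff.1 h.symm)

/-- The ideal is `x 𝔄⁻¹`, integral because `x ∈ 𝔄`. It controls `|N x|` by the norm of an integral
ideal. -/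
lemma exists_ideal_mul_eq (𝔄 : FracIdeal k) {x : k} (hx : x ∈ fracSub 𝔄) (hx0 : x ≠ 0) :
    ∃ I : (Ideal (𝓞 k))⁰, ((I : Ideal (𝓞 k)) : FractionalIdeal (𝓞 k)⁰ k) * 𝔄 =
      FractionalIdeal.spanSingleton (𝓞 k)⁰ x := by
  have h1 : FractionalIdeal.spanSingleton (𝓞 k)⁰ x ≤ (𝔄 : FractionalIdeal (𝓞 k)⁰ k) :=
    FractionalIdeal.spanSingleton_le_iff_mem.2 hx
  have h2 : FractionalIdeal.spanSingleton (𝓞 k)⁰ x * (𝔄⁻¹ : FracIdeal k) ≤ 1 := by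
    have := mul_le_mul_left h1 ((𝔄⁻¹ : FracIdeal k) : FractionalIdeal (𝓞 k)⁰ k)
    rwa [Units.mul_inv] at this
  obtain ⟨I, hI⟩ := FractionalIdeal.le_one_iff_exists_coeIdeal.1 h2
  have hI' : (I : FractionalIdeal (𝓞 k)⁰ k) * 𝔄 = FractionalIdeal.spanSingleton (𝓞 k)⁰ x := by
    rw [hI, Units.inv_mul_cancel_right]
  refine ⟨⟨I, mem_nonZeroDivisors_of_ne_zero ?_⟩, hI'⟩
  rintro rfl
  rw [Submodule.zero_eq_bot, FractionalIdeal.coeIdeal_bot, zero_mul] at hI'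
  exact hx0 (FractionalIdeal.spanSingleton_eq_zero_iff.1 hI'.symm)

lemma absNorm_of_mul_eq (𝔄 : FracIdeal k) {x : k} {I : (Ideal (𝓞 k))⁰}
    (h : ((I : Ideal (𝓞 k)) : FractionalIdeal (𝓞 k)⁰ k) * 𝔄 =
      FractionalIdeal.spanSingleton (𝓞 k)⁰ x) :
    (Ideal.absNorm (I : Ideal (𝓞 k)) : ℚ) * fracNorm 𝔄 = |Algebra.norm ℚ x| := by
  rw [← FractionalIdeal.absNorm_span_singleton (R := 𝓞 k), ← h, map_mul,
    FractionalIdeal.coeIdeal_absNorm]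
  rfl

lemma exists_unit_mul_eq {x y : k} (h : FractionalIdeal.spanSingleton (𝓞 k)⁰ x =
    FractionalIdeal.spanSingleton (𝓞 k)⁰ y) : ∃ u : (𝓞 k)ˣ, (u : k) * x = y := by
  have h1 := congrArg (fun I : FractionalIdeal (𝓞 k)⁰ k => (I : Submodule (𝓞 k) k)) h
  simp only [FractionalIdeal.coe_spanSingleton] at h1
  obtain ⟨u, hu⟩ := Submodule.span_singleton_eq_span_singleton.1 h1
  exact ⟨u, hu⟩

lemma norm_pos_of_ne_zero {x : k} (hx : x ≠ 0) : 0 < |Algebra.norm ℚ x| :=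
  abs_pos.2 (Algebra.norm_ne_zero_iff.2 hx)

variable {F E : Type*} [Field F] [NumberField F] [Field E] [NumberField E] [Algebra F E]
  {𝔄 : FracIdeal E}

lemma mem_fracSub_of_partOf {𝔞 : FracIdeal F} (x : partOf 𝔄 𝔞) : (x : E) ∈ fracSub 𝔄 := x.2.1

lemma orbitTerm_eq_out {𝔞 : FracIdeal F} (s : ℂ) (x : UnitOrbits 𝔄 𝔞) :
    orbitTerm s x = ((|Algebra.norm ℚ (x.out : E)| : ℚ) : ℂ) ^ (-s) := by
  conv_lhs => rw [← Quotient.out_eq x]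
  rfl

/-- The series of the relative partial zeta functions. -/
lemma summable_orbitTerm (C : ClassGroup (𝓞 F)) {s : ℂ} (hs : 1 < s.re) :
    Summable fun p : Σ 𝔟 : AntiIntegralIn C, UnitOrbits 𝔄 𝔟.1 => orbitTerm s p.2 := by
  have hex : ∀ p : Σ 𝔟 : AntiIntegralIn C, UnitOrbits 𝔄 𝔟.1, ∃ I : (Ideal (𝓞 E))⁰,
      ((I : Ideal (𝓞 E)) : FractionalIdeal (𝓞 E)⁰ E) * 𝔄 =
        FractionalIdeal.spanSingleton (𝓞 E)⁰ (p.2.out : E) := fun p =>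
    exists_ideal_mul_eq 𝔄 (mem_fracSub_of_partOf p.2.out) (partOf_ne_zero p.2.out)
  let I : (Σ 𝔟 : AntiIntegralIn C, UnitOrbits 𝔄 𝔟.1) → (Ideal (𝓞 E))⁰ := fun p => (hex p).choose
  have hI : ∀ p, ((I p : Ideal (𝓞 E)) : FractionalIdeal (𝓞 E)⁰ E) * 𝔄 =
    FractionalIdeal.spanSingleton (𝓞 E)⁰ (p.2.out : E) := fun p => (hex p).choose_spec
  -- The ideal `x 𝔄⁻¹` determines `x` up to a unit of `E`, and `x` determines `𝔟` as its coefficient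
  -- ideal, which units of `E` do not change.
  have hinj : Function.Injective I := by
    rintro ⟨𝔟, x⟩ ⟨𝔟', y⟩ h
    have h1 := (hI ⟨𝔟, x⟩).symm.trans ((congrArg (fun J : (Ideal (𝓞 E))⁰ =>
      ((J : Ideal (𝓞 E)) : FractionalIdeal (𝓞 E)⁰ E) * 𝔄) h).trans (hI ⟨𝔟', y⟩))
    obtain ⟨u, hu⟩ := exists_unit_mul_eq h1
    have h2 := unit_smul_mem_partOf 𝔟.2.2 u x.out
    rw [hu] at h2
    have h3 : 𝔟 = 𝔟' := by
      apply Subtype.ext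
      apply Units.ext
      ext c
      exact (((mem_partOf_iff 𝔟.2.2).1 h2).2 c).symm.trans
        (((mem_partOf_iff 𝔟'.2.2).1 y.out.2).2 c)
    subst h3
    have h4 : x = y := by
      rw [← Quotient.out_eq x, ← Quotient.out_eq y]
      exact Quotient.sound ⟨u, hu⟩
    rw [h4]
  refine Summable.of_norm ?_
  have hA : (0 : ℝ) < fracNorm 𝔄 := by exact_mod_cast fracNorm_pos 𝔄
  have h5 := ((summable_absNorm_rpow E hs).comp_injective hinj).mul_right ((fracNorm 𝔄 : ℝ) ^ (-s.re))
  refine h5.congr fun p => ?_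
  have h6 : ((|Algebra.norm ℚ (p.2.out : E)| : ℚ) : ℝ) =
      (Ideal.absNorm (I p : Ideal (𝓞 E)) : ℝ) * (fracNorm 𝔄 : ℝ) := by
    rw [← absNorm_of_mul_eq 𝔄 (hI p)]
    push_cast
    rfl
  have h7 : (0 : ℝ) < ((|Algebra.norm ℚ (p.2.out : E)| : ℚ) : ℝ) := by
    exact_mod_cast norm_pos_of_ne_zero (partOf_ne_zero p.2.out)
  rw [orbitTerm_eq_out, ← Complex.ofReal_ratCast, Complex.norm_cpow_eq_rpow_re_of_pos h7, h6,
    Real.mul_rpow (Nat.cast_nonneg _) hA.le, Complex.neg_re, Function.comp_apply]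

lemma summable_orbitTerm_single {𝔞 : FracIdeal F} (h1 : AntiIntegral 𝔞) {s : ℂ} (hs : 1 < s.re) :
    Summable (orbitTerm (𝔄 := 𝔄) (𝔞 := 𝔞) s) :=
  (summable_orbitTerm (𝔄 := 𝔄) (ClassGroup.mk F 𝔞) hs).sigma_factor ⟨𝔞, rfl, h1⟩

end IdealSums

/-! ### Unfolding -/

section Unfolding

open Filter

/-- By Tonelli the sum of the norms has a finite integral, so it is finite almost everywhere. -/
lemma ae_summable_of_summable_integral {α ι : Type*} [MeasurableSpace α] [Countable ι] {μ : Measure α}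
    {F : ι → α → ℂ} (hF : ∀ i, Integrable (F i) μ) (hs : Summable fun i => ∫ a, ‖F i a‖ ∂μ) :
    ∫⁻ a, ∑' i, ‖F i a‖ₑ ∂μ < ∞ ∧ ∀ᵐ a ∂μ, Summable fun i => F i a := by
  have h1 : ∫⁻ a, ∑' i, ‖F i a‖ₑ ∂μ < ∞ := by
    rw [lintegral_tsum fun i => (hF i).1.enorm]
    have h2 : ∀ i, ∫⁻ a, ‖F i a‖ₑ ∂μ = ENNReal.ofReal (∫ a, ‖F i a‖ ∂μ) := fun i =>
      (ofReal_integral_norm_eq_lintegral_enorm (hF i)).symm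
    simp_rw [h2]
    exact hs.tsum_ofReal_lt_top
  refine ⟨h1, ?_⟩
  filter_upwards [ae_lt_top' (AEMeasurable.tsum fun i => (hF i).1.enorm) h1.ne] with a ha
  refine Summable.of_norm ?_
  exact tsum_enorm_ne_top_iff_summable_norm.1 ha.ne

lemma integrable_tsum_of_summable_integral {α ι : Type*} [MeasurableSpace α] [Countable ι]
    {μ : Measure α} {F : ι → α → ℂ} (hF : ∀ i, Integrable (F i) μ)
    (hs : Summable fun i => ∫ a, ‖F i a‖ ∂μ) : Integrable (fun a => ∑' i, F i a) μ := by
  obtain ⟨h1, h2⟩ := ae_summable_of_summable_integral hF hs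
  refine ⟨?_, ?_⟩
  · refine aestronglyMeasurable_of_tendsto_ae (atTop : Filter (Finset ι))
      (f := fun S a => ∑ i ∈ S, F i a)
      (fun S => Finset.aestronglyMeasurable_fun_sum S fun i _ => (hF i).1) ?_
    filter_upwards [h2] with a ha
    exact ha.hasSum
  · refine lt_of_le_of_lt (lintegral_mono fun a => ?_) h1
    exact enorm_tsum_le_tsum_enorm

variable {G : Type*} [CommGroup G] [MeasurableSpace G] [MeasurableMul G] {A : Type*} [CommGroup A]
  [Countable A] {ρ : A →* G} {D : Set G} {N : ℕ} {μ : Measure G} [μ.IsMulLeftInvariant]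

/-- If the translates of `D` by `A` cover `G` exactly `N` times, then the integrals over them of a
function sum up to `N` times its integral over `G`. -/
lemma hasSum_setIntegral_translates {V : Type*} [NormedAddCommGroup V] [NormedSpace ℝ V]
    (hD : MeasurableSet D)
    (hN : ∀ x, ∑' a : A, D.indicator (1 : G → ℝ≥0∞) (ρ a * x) = N) {f : G → V}
    (hf : Integrable f μ) (g : G) :
    (∀ a : A, IntegrableOn (fun t => f (ρ a * (g * t))) D μ) ∧
    HasSum (fun a : A => ∫ t in D, f (ρ a * (g * t)) ∂μ) ((N : ℝ) • ∫ t, f t ∂μ) := by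
  have h1 : Integrable (fun t => f (g * t)) μ := hf.comp_mul_left g
  have h2 : Integrable (fun t => f (g * t))
      (Measure.sum fun a : A => (μ.restrict D).map fun x => ρ a * x) := by
    rw [measure_sum_map ρ hD N hN μ]
    exact h1.smul_measure (ENNReal.natCast_ne_top N)
  have h3 : ∀ a, Integrable (fun t => f (g * t)) ((μ.restrict D).map fun x => ρ a * x) := fun a =>
    h2.mono_measure (Measure.le_sum _ a)
  have hm : ∀ a : A, AEMeasurable (fun x => ρ a * x) (μ.restrict D) := fun a =>
    (measurable_const_mul _).aemeasurable
  constructor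
  · intro a
    have := (integrable_map_measure (h3 a).1 (hm a)).1 (h3 a)
    refine this.congr (ae_of_all _ fun t => ?_)
    simp only [Function.comp_apply]
    rw [mul_left_comm]
  · have h4 := hasSum_integral_measure h2
    rw [measure_sum_map ρ hD N hN μ, integral_smul_measure, integral_mul_left_eq_self f g,
      ENNReal.toReal_natCast] at h4
    refine h4.congr_fun ?_
    intro a
    rw [integral_map (hm a) (h3 a).1]
    refine integral_congr_ae (ae_of_all _ fun t => ?_)
    simp only
    rw [mul_left_comm]

/-- The unfolding of a series over `ι × A`. -/
lemma unfolding {ι : Type*} (hD : MeasurableSet D)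
    (hN : ∀ x, ∑' a : A, D.indicator (1 : G → ℝ≥0∞) (ρ a * x) = N) {f : G → ℂ}
    (hf : Integrable f μ) {b : ι → ℂ} (hb : Summable b) (g : ι → G) :
    (∀ p : ι × A, IntegrableOn (fun t => b p.1 * f (ρ p.2 * (g p.1 * t))) D μ) ∧
    (Summable fun p : ι × A => ∫ t in D, ‖b p.1 * f (ρ p.2 * (g p.1 * t))‖ ∂μ) ∧
    ∑' p : ι × A, ∫ t in D, b p.1 * f (ρ p.2 * (g p.1 * t)) ∂μ = (∑' i, b i) * (N * ∫ t, f t ∂μ) := by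
  have h1 : ∀ p : ι × A, IntegrableOn (fun t => b p.1 * f (ρ p.2 * (g p.1 * t))) D μ := fun p =>
    ((hasSum_setIntegral_translates hD hN hf (g p.1)).1 p.2).const_mul _
  have h2 : ∀ i, HasSum (fun a : A => ∫ t in D, ‖b i * f (ρ a * (g i * t))‖ ∂μ)
      (‖b i‖ * (N * ∫ t, ‖f t‖ ∂μ)) := by
    intro i
    simp_rw [norm_mul, integral_const_mul]
    exact (hasSum_setIntegral_translates hD hN hf.norm (g i)).2.mul_left _
  have h3 : ∀ i, HasSum (fun a : A => ∫ t in D, b i * f (ρ a * (g i * t)) ∂μ)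
      (b i * (N * ∫ t, f t ∂μ)) := by
    intro i
    simp_rw [integral_const_mul]
    have := (hasSum_setIntegral_translates hD hN hf (g i)).2.mul_left (b i)
    rwa [Complex.real_smul, Complex.ofReal_natCast] at this
  have h4 : Summable fun p : ι × A => ∫ t in D, ‖b p.1 * f (ρ p.2 * (g p.1 * t))‖ ∂μ := by
    rw [summable_prod_of_nonneg fun p => integral_nonneg fun t => norm_nonneg _]
    refine ⟨fun i => (h2 i).summable, ?_⟩
    simp_rw [(h2 _).tsum_eq]
    exact hb.norm.mul_right _
  refine ⟨h1, h4, ?_⟩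
  have h5 : Summable fun p : ι × A => ∫ t in D, b p.1 * f (ρ p.2 * (g p.1 * t)) ∂μ :=
    h4.of_norm_bounded fun p => norm_integral_le_integral_norm _
  rw [h5.tsum_prod]
  simp_rw [(h3 _).tsum_eq]
  rw [tsum_mul_right]

/-- The unfolding of a series over `ι × B / K`. -/
lemma unfolding_quotient {B : Type*} [CommGroup B] (ρ : B →* G) (K : Subgroup B) (hK : K ≤ ρ.ker)
    [Countable B] {ι : Type*} (hD : MeasurableSet D) (hN : ∀ x, ∑' c : B ⧸ K,
      D.indicator (1 : G → ℝ≥0∞) (QuotientGroup.lift K ρ hK c * x) = N) {f : G → ℂ}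
    (hf : Integrable f μ) {b : ι → ℂ} (hb : Summable b) (g : ι → G) :
    (∀ p : ι × (B ⧸ K),
      IntegrableOn (fun t => b p.1 * f (QuotientGroup.lift K ρ hK p.2 * (g p.1 * t))) D μ) ∧
    (Summable fun p : ι × (B ⧸ K) =>
      ∫ t in D, ‖b p.1 * f (QuotientGroup.lift K ρ hK p.2 * (g p.1 * t))‖ ∂μ) ∧
    ∑' p : ι × (B ⧸ K), ∫ t in D, b p.1 * f (QuotientGroup.lift K ρ hK p.2 * (g p.1 * t)) ∂μ =
      (∑' i, b i) * (N * ∫ t, f t ∂μ) := by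
  have := (QuotientGroup.mk_surjective (s := K)).countable
  exact unfolding hD hN hf hb g

end Unfolding

/-! ### Convergence of the Eisenstein series -/

section Convergence

variable {F : Type*} [Field F] {n : ℕ}

lemma locNorm_nonneg {ψ : F →+* ℂ} (x : Fin n → locField ψ) : 0 ≤ locNorm x := norm_nonneg _

lemma exists_locNorm_vecMul_le {ψ : F →+* ℂ} (M : Matrix (Fin n) (Fin n) (locField ψ)) :
    ∃ C : ℝ, ∀ x : Fin n → locField ψ, locNorm (x ᵥ* M) ≤ C * locNorm x := by
  let A : Matrix (Fin n) (Fin n) ℂ := (M.map (locField ψ).subtype)ᵀ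
  refine ⟨‖Matrix.toEuclideanCLM (𝕜 := ℂ) A‖, fun x => ?_⟩
  have h := (Matrix.toEuclideanCLM (𝕜 := ℂ) A).le_opNorm (WithLp.toLp 2 fun i => (x i : ℂ))
  refine Eq.trans_le ?_ h
  unfold locNorm
  congr 1
  ext i
  simp [A, Matrix.vecMul, Matrix.mulVec, dotProduct, mul_comm]

lemma exists_locNorm_le {ψ : F →+* ℂ} (g h : GL (Fin n) (locField ψ)) :
    ∃ C : ℝ, ∀ x : Fin n → locField ψ, locNorm (x ᵥ* h.1) ≤ C * locNorm (x ᵥ* g.1) := by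
  obtain ⟨C, hC⟩ := exists_locNorm_vecMul_le (g⁻¹ * h).1
  refine ⟨C, fun x => ?_⟩
  have := hC (x ᵥ* g.1)
  rwa [Matrix.vecMul_vecMul, ← Units.val_mul, mul_inv_cancel_left] at this

/-- The norms pulled back by two invertible matrices are equivalent, with constants independent of
the vector. -/
lemma exists_inv_locNorm_pow_le {ψ : F →+* ℂ} (g h : GL (Fin n) (locField ψ)) (m : ℕ) :
    ∃ C : ℝ, 0 ≤ C ∧ ∀ x : Fin n → locField ψ,
      (locNorm (x ᵥ* g.1) ^ m)⁻¹ ≤ C * (locNorm (x ᵥ* h.1) ^ m)⁻¹ := by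
  obtain ⟨A, hA⟩ := exists_locNorm_le g h
  obtain ⟨B, hB⟩ := exists_locNorm_le h g
  -- Enlarging the constant to at least `1` makes it positive and also settles the zero vector,
  -- where both sides are inverses of powers of `0`.
  have hA' : ∀ x, locNorm (x ᵥ* h.1) ≤ max A 1 * locNorm (x ᵥ* g.1) := fun x =>
    (hA x).trans (mul_le_mul_of_nonneg_right (le_max_left _ _) (locNorm_nonneg _))
  have h1 : (1 : ℝ) ≤ max A 1 := le_max_right _ _
  refine ⟨max A 1 ^ m, by positivity, fun x => ?_⟩
  rcases (locNorm_nonneg (x ᵥ* h.1)).eq_or_lt with h0 | h0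
  · have h2 : locNorm (x ᵥ* g.1) = 0 := by
      have := hB x
      rw [← h0, mul_zero] at this
      exact le_antisymm this (locNorm_nonneg _)
    rw [← h0, h2]
    exact le_mul_of_one_le_left (by positivity) (one_le_pow₀ h1)
  · have h2 : 0 < locNorm (x ᵥ* g.1) := by
      have := h0.trans_le (hA' x)
      exact (pos_iff_pos_of_mul_pos this).1 (by positivity)
    rw [← div_eq_mul_inv, le_div_iff₀ (pow_pos h0 m), inv_mul_le_iff₀ (pow_pos h2 m), mul_comm, ← mul_pow]
    exact pow_le_pow_left₀ h0.le (hA' x) m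

variable [NumberField F] (φ : InfinitePlace F → (F →+* ℂ)) (hφ : ∀ σ, InfinitePlace.mk (φ σ) = σ)

lemma detFun_toGInf_mul (e : Fin n → F) (γ : Matrix.SpecialLinearGroup (Fin n) F) (g : GInf φ n) :
    detFun φ e (toGInf φ γ * g) = detFun φ (e ᵥ* γ.1) g := by
  refine Finset.prod_congr rfl fun σ _ => ?_
  have h1 : ((toGInf φ γ * g) σ).1 = ((toLoc (φ σ)).mapMatrix γ.1) * (g σ).1 := rfl
  have h2 : (toLoc (φ σ) ∘ e) ᵥ* (toLoc (φ σ)).mapMatrix γ.1 = toLoc (φ σ) ∘ (e ᵥ* γ.1) := by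
    funext i
    exact (RingHom.map_vecMul (toLoc (φ σ)) γ.1 e i).symm
  rw [h1, ← Matrix.vecMul_vecMul, h2, Matrix.det_mul, ← RingHom.map_det, γ.2, map_one, one_mul]

lemma detFun_nonneg (e : Fin n → F) (g : GInf φ n) : 0 ≤ detFun φ e g :=
  Finset.prod_nonneg fun _ _ => div_nonneg (pow_nonneg (norm_nonneg _) _)
    (pow_nonneg (locNorm_nonneg _) _)

/-- The uniformity in `e` is the point: applied to all `eγ`, it compares every term of the
Eisenstein series at two points with one constant. -/
lemma exists_detFun_le (g h : GInf φ n) :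
    ∃ C : ℝ, 0 ≤ C ∧ ∀ e : Fin n → F, detFun φ e g ≤ C * detFun φ e h := by
  choose C hC0 hC using fun σ => exists_inv_locNorm_pow_le (g σ) (h σ) (n * σ.mult)
  refine ⟨∏ σ : InfinitePlace F, (‖((g σ).1.det : ℂ)‖ ^ σ.mult / ‖((h σ).1.det : ℂ)‖ ^ σ.mult * C σ),
    Finset.prod_nonneg fun σ _ => mul_nonneg (by positivity) (hC0 σ), fun e => ?_⟩
  unfold detFun
  rw [← Finset.prod_mul_distrib]
  refine Finset.prod_le_prod (fun σ _ => div_nonneg (pow_nonneg (norm_nonneg _) _)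
    (pow_nonneg (locNorm_nonneg _) _)) fun σ _ => ?_
  have hd : ‖((h σ).1.det : ℂ)‖ ^ σ.mult ≠ 0 := by
    refine pow_ne_zero _ (norm_ne_zero_iff.2 ?_)
    have := ((Matrix.isUnit_iff_isUnit_det _).1 (h σ).isUnit).ne_zero
    exact_mod_cast this
  rw [div_eq_mul_inv]
  refine (mul_le_mul_of_nonneg_left (hC σ _) (pow_nonneg (norm_nonneg _) _)).trans_eq ?_
  field_simp

lemma summable_eisTerm_of_summable {L : Submodule (𝓞 F) (Fin n → F)} (D : ParabolicDatum L)
    {z₀ : UpperSpace φ n} {s : ℂ} (hs : 0 < s.re) (h : Summable (eisTerm φ hφ D z₀ s))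
    (z : UpperSpace φ n) : Summable (eisTerm φ hφ D z s) := by
  obtain ⟨g₀, rfl⟩ := QuotientGroup.mk_surjective z₀
  obtain ⟨g, rfl⟩ := QuotientGroup.mk_surjective z
  obtain ⟨C, hC0, hC⟩ := exists_detFun_le φ g g₀
  refine Summable.of_norm_bounded (h.norm.mul_left (C ^ s.re)) fun q => ?_
  induction q using Quotient.inductionOn with | h γ => ?_
  change ‖((detFun φ D.e (toGInf φ γ.1 * g) : ℝ) : ℂ) ^ s‖ ≤
    C ^ s.re * ‖((detFun φ D.e (toGInf φ γ.1 * g₀) : ℝ) : ℂ) ^ s‖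
  rw [Complex.norm_cpow_eq_rpow_re_of_nonneg (detFun_nonneg φ _ _) hs.ne',
    Complex.norm_cpow_eq_rpow_re_of_nonneg (detFun_nonneg φ _ _) hs.ne',
    ← Real.mul_rpow hC0 (detFun_nonneg φ _ _), detFun_toGInf_mul, detFun_toGInf_mul]
  exact Real.rpow_le_rpow (detFun_nonneg φ _ _) (hC _) hs.le

end Convergence

/-! ### The integral of the Eisenstein series -/

section Integral

open Filter

variable {F E : Type*} [Field F] [NumberField F] [Field E] [NumberField E] [Algebra F E] {n : ℕ}

lemma measurable_gammaFun (s : ℂ) : Measurable (gammaFun F E s) := by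
  unfold gammaFun
  refine Finset.measurable_prod _ fun σ _ => ?_
  refine Measurable.pow_const (Complex.measurable_ofReal.comp ?_) _
  unfold sqSum
  exact Finset.measurable_sum _ fun τ _ =>
    (measurable_subtype_coe.comp (measurable_pi_apply τ.1)).pow_const 2

lemma countable_quotient_baseUnits : Countable ((𝓞 E)ˣ ⧸ baseUnits F E) :=
  (QuotientGroup.mk_surjective (s := baseUnits F E)).countable

variable (fr : Frame F E n) (w : Module.Basis (Fin n) F E) {𝔄 : FracIdeal E}
  (D : ParabolicDatum (latticeOf w 𝔄)) {s : ℂ}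

/-- The index set of the Eisenstein series, split into orbits. -/
def orbitIndex : UnitOrbits 𝔄 D.ideal × ((𝓞 E)ˣ ⧸ baseUnits F E) ≃
    Quotient (QuotientGroup.rightRel D.parabolic) :=
  (orbitSplitEquiv D.one_mem).trans (orbitEquiv D).symm

/-- The Eisenstein series on the torus, term by term. -/
def torusTerm (s : ℂ) (p : UnitOrbits 𝔄 D.ideal × ((𝓞 E)ˣ ⧸ baseUnits F E)) (t : TRel F E) : ℂ :=
  eisTerm fr.embF fr.mk_embF D (fr.heegner w t) s (orbitIndex w D p)

lemma torusTerm_eq (s : ℂ) (p : UnitOrbits 𝔄 D.ideal × ((𝓞 E)ˣ ⧸ baseUnits F E)) (t : TRel F E) :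
    torusTerm fr w D s p t = (((|discW fr w| : ℝ) : ℂ) ^ (s / 2) * orbitTerm s p.1) *
        gammaFun F E s ((quotProj F E p.2 * (orbitProj p.1 * t) : TRel F E) : T E) := by
  rw [mul_assoc]
  exact eisTerm_heegner_orbit fr w D s t p

/-- The unfolding is applied with coefficients `|Δ_w|^{s/2} |N x|^{-s}` on the unit orbits, the
group `𝓞_E^× / 𝓞_F^×` and the integrand of `Γ_{E/F}(s)`; the resulting `coverNumber * relGamma` is
the Hecke factor. -/
lemma unfolding_torus (hs : 1 < s.re) {Δ : Set (TRel F E)}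
    (hΔ : IsStrictDomain (relUnitLattice F E) Δ) :
    (∀ p, IntegrableOn (torusTerm fr w D s p) Δ (haarTRel F E)) ∧
    (Summable fun p => ∫ t in Δ, ‖torusTerm fr w D s p t‖ ∂haarTRel F E) ∧
    ∑' p, ∫ t in Δ, torusTerm fr w D s p t ∂haarTRel F E =
      ((|discW fr w| : ℝ) : ℂ) ^ (s / 2) * heckeFactor F E s *
        ∑' x : UnitOrbits 𝔄 D.ideal, orbitTerm s x := by
  have hs0 : 0 < s.re := zero_lt_one.trans hs
  have h := unfolding_quotient (unitProj F E) (baseUnits F E) (baseUnits_le_ker F E) hΔ.measurableSet (tsum_indicator_relUnitLattice F E hΔ)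
    (integral_gammaFun F E hs0).1
    ((summable_orbitTerm_single (𝔄 := 𝔄) D.one_mem hs).mul_left
      (((|discW fr w| : ℝ) : ℂ) ^ (s / 2))) orbitProj
  have h1 : ∀ p, torusTerm fr w D s p = fun t =>
      (((|discW fr w| : ℝ) : ℂ) ^ (s / 2) * orbitTerm s p.1) *
        gammaFun F E s ((quotProj F E p.2 * (orbitProj p.1 * t) : TRel F E) : T E) := fun p =>
    funext fun t => torusTerm_eq fr w D s p t
  simp_rw [h1]
  refine ⟨h.1, h.2.1, Eq.trans h.2.2 ?_⟩
  rw [tsum_mul_left, heckeFactor_eq F E hs0]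
  change _ * _ * (_ * relGamma F E s) = _
  ring

end Integral

/-! ### Convergence, measurability and the integral on the quotient torus. -/

section HeckeIntegral

open Filter

variable {F E : Type*} [Field F] [NumberField F] [Field E] [NumberField E] [Algebra F E] {n : ℕ}
  (fr : Frame F E n) (w : Module.Basis (Fin n) F E) {𝔄 : FracIdeal E}
  (D : ParabolicDatum (latticeOf w 𝔄)) {s : ℂ}

lemma countable_orbitIndex :
    Countable (UnitOrbits 𝔄 D.ideal × ((𝓞 E)ˣ ⧸ baseUnits F E)) := by
  have := countable_quotient_baseUnits (F := F) (E := E)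
  infer_instance

lemma exists_isStrictDomain_relUnitLattice :
    ∃ Δ : Set (TRel F E), IsStrictDomain (relUnitLattice F E) Δ :=
  exists_isStrictDomain_of_le_range F E (coe_mem_range_of_mem_relUnitLattice F E)

/-- Absolute convergence of the Eisenstein series. -/
theorem summable_eisTerm (hs : 1 < s.re) (z : UpperSpace fr.embF n) :
    Summable (eisTerm fr.embF fr.mk_embF D z s) := by
  obtain ⟨Δ, hΔ⟩ := exists_isStrictDomain_relUnitLattice (F := F) (E := E)
  obtain ⟨h1, h2, -⟩ := unfolding_torus fr w D hs hΔ
  have := countable_orbitIndex w D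
  -- The series converges at almost every point of `Δ`, which has positive measure, hence at some
  -- Heegner point; comparison of terms then carries convergence to `z`.
  have h3 := (ae_summable_of_summable_integral h1 h2).2
  have h4 : NeBot (ae ((haarTRel F E).restrict Δ)) := by
    rw [ae_neBot, Ne, Measure.restrict_eq_zero]
    exact hΔ.measure_ne_zero (haarTRel_ne_zero F E)
  obtain ⟨t, ht⟩ := h3.exists
  exact summable_eisTerm_of_summable fr.embF fr.mk_embF D (zero_lt_one.trans hs)
    ((orbitIndex w D).summable_iff.1 ht) z

lemma eisMod_heegnerMod (t : TRel F E) :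
    eisMod fr.embF fr.mk_embF D (heegnerMod fr w 𝔄 (QuotientGroup.mk t)) s =
      ∑' p, torusTerm fr w D s p t :=
  ((orbitIndex w D).tsum_eq (eisTerm fr.embF fr.mk_embF D (fr.heegner w t) s)).symm

lemma measurable_torusTerm (p : UnitOrbits 𝔄 D.ideal × ((𝓞 E)ˣ ⧸ baseUnits F E)) :
    Measurable (torusTerm fr w D s p) := by
  have h1 : torusTerm fr w D s p = _ := funext fun t => torusTerm_eq fr w D s p t
  rw [h1]
  refine Measurable.const_mul ((measurable_gammaFun s).comp (measurable_subtype_coe.comp ?_)) _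
  exact (measurable_const_mul (quotProj F E p.2)).comp (measurable_const_mul (orbitProj p.1))

/-- The series converges at every Heegner point, so the sum is a pointwise limit of measurable
partial sums; this allows the integral to be pulled back to the torus. -/
lemma measurable_eisMod_heegnerMod (hs : 1 < s.re) :
    Measurable fun t => eisMod fr.embF fr.mk_embF D (heegnerMod fr w 𝔄 t) s := by
  have := countable_orbitIndex w D
  refine measurable_from_quotient.2 ?_
  refine measurable_of_tendsto_metrizable' (atTop : Filter (Finset _))
    (f := fun S t => ∑ p ∈ S, torusTerm fr w D s p t)
    (fun S => Finset.measurable_sum S fun p _ => measurable_torusTerm fr w D p) ?_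
  rw [tendsto_pi_nhds]
  intro t
  change Tendsto _ _ (nhds (eisMod fr.embF fr.mk_embF D (heegnerMod fr w 𝔄 (QuotientGroup.mk t)) s))
  rw [eisMod_heegnerMod]
  exact ((orbitIndex w D).summable_iff.2 (summable_eisTerm fr w D hs (fr.heegner w t))).hasSum

/-- The integral of the Eisenstein series along the Heegner object. -/
theorem integral_eisMod (hs : 1 < s.re) :
    Integrable (fun t => eisMod fr.embF fr.mk_embF D (heegnerMod fr w 𝔄 t) s)
      (quotMeasure (relUnitLattice F E) (haarTRel F E)) ∧
    heckeIntegral fr w 𝔄 D s =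
      ((|discW fr w| : ℝ) : ℂ) ^ (s / 2) * heckeFactor F E s *
        ∑' x : UnitOrbits 𝔄 D.ideal, orbitTerm s x := by
  obtain ⟨Δ, hΔ⟩ := exists_isStrictDomain_relUnitLattice (F := F) (E := E)
  obtain ⟨h1, h2, h3⟩ := unfolding_torus fr w D hs hΔ
  have := countable_orbitIndex w D
  have hm := measurable_eisMod_heegnerMod fr w D hs
  have hmk : Measurable (QuotientGroup.mk : TRel F E → TRel F E ⧸ relUnitLattice F E) :=
    measurable_quotient_mk''
  unfold heckeIntegral
  rw [quotMeasure_eq hΔ]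
  constructor
  · rw [integrable_map_measure hm.aestronglyMeasurable hmk.aemeasurable]
    exact (integrable_tsum_of_summable_integral h1 h2).congr
      (ae_of_all _ fun t => (eisMod_heegnerMod fr w D t).symm)
  · rw [integral_map hmk.aemeasurable hm.aestronglyMeasurable, ← h3,
      integral_tsum_of_summable_integral_norm h1 h2]
    exact integral_congr_ae (ae_of_all _ fun t => eisMod_heegnerMod fr w D t)

end HeckeIntegral

/-! ### The relative partial zeta function -/

section RelativeZeta

variable {F E : Type*} [Field F] [NumberField F] [Field E] [NumberField E] [Algebra F E]
  {𝔄 : FracIdeal E} {𝔞 𝔟 : FracIdeal F}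

lemma exists_eq_spanSingleton_mul (h : ClassGroup.mk F 𝔟 = ClassGroup.mk F 𝔞) :
    ∃ c : F, c ≠ 0 ∧ (𝔟 : FractionalIdeal (𝓞 F)⁰ F) =
      FractionalIdeal.spanSingleton (𝓞 F)⁰ c * 𝔞 := by
  have h1 : ClassGroup.mk F (𝔟 * 𝔞⁻¹) = 1 := by rw [map_mul, map_inv, h, mul_inv_cancel]
  obtain ⟨c, hc⟩ := (FractionalIdeal.isPrincipal_iff _).1 (ClassGroup.mk_eq_one_iff.1 h1)
  refine ⟨c, ?_, ?_⟩
  · rintro rfl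
    rw [FractionalIdeal.spanSingleton_zero] at hc
    exact (𝔟 * 𝔞⁻¹).ne_zero hc
  · rw [← hc, Units.val_mul, Units.inv_mul_cancel_right]

lemma fracNorm_spanSingleton_mul {c : F} (h : (𝔟 : FractionalIdeal (𝓞 F)⁰ F) =
      FractionalIdeal.spanSingleton (𝓞 F)⁰ c * 𝔞) :
    fracNorm 𝔟 = |Algebra.norm ℚ c| * fracNorm 𝔞 := by
  unfold fracNorm
  rw [h, map_mul, FractionalIdeal.absNorm_span_singleton]

/-- The multiplication by `c` maps `𝔄_{c𝔞}` onto `𝔄_𝔞`. -/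
def scalePart (h1 : AntiIntegral 𝔞) (h2 : AntiIntegral 𝔟) {c : F} (hc : c ≠ 0)
    (h : (𝔟 : FractionalIdeal (𝓞 F)⁰ F) = FractionalIdeal.spanSingleton (𝓞 F)⁰ c * 𝔞) :
    partOf 𝔄 𝔟 ≃ partOf 𝔄 𝔞 :=
  have hmem : ∀ d : F, d * c ∈ fracSub 𝔟 ↔ d ∈ fracSub 𝔞 := fun d => by
    change d * c ∈ (𝔟 : FractionalIdeal (𝓞 F)⁰ F) ↔ d ∈ (𝔞 : FractionalIdeal (𝓞 F)⁰ F)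
    rw [h, FractionalIdeal.mem_singleton_mul]
    constructor
    · rintro ⟨a, ha, had⟩
      rw [mul_comm] at had
      rwa [mul_left_cancel₀ hc had]
    · exact fun hd => ⟨d, hd, mul_comm _ _⟩
  { toFun := fun x => ⟨c • (x : E), (mem_partOf_iff h1).2 ⟨smul_ne_zero hc (partOf_ne_zero x),
      fun d => by rw [smul_smul, ((mem_partOf_iff h2).1 x.2).2, hmem]⟩⟩
    invFun := fun x => ⟨c⁻¹ • (x : E), (mem_partOf_iff h2).2
      ⟨smul_ne_zero (inv_ne_zero hc) (partOf_ne_zero x), fun d => by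
        rw [smul_smul, ((mem_partOf_iff h1).1 x.2).2, ← hmem, inv_mul_cancel_right₀ hc]⟩⟩
    left_inv := fun x => Subtype.ext (inv_smul_smul₀ hc (x : E))
    right_inv := fun x => Subtype.ext (smul_inv_smul₀ hc (x : E)) }

/-- The bijection between the orbits of `𝔄_{c𝔞}` and those of `𝔄_𝔞`. -/
def scaleOrbits (h1 : AntiIntegral 𝔞) (h2 : AntiIntegral 𝔟) {c : F} (hc : c ≠ 0)
    (h : (𝔟 : FractionalIdeal (𝓞 F)⁰ F) = FractionalIdeal.spanSingleton (𝓞 F)⁰ c * 𝔞) :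
    UnitOrbits 𝔄 𝔟 ≃ UnitOrbits 𝔄 𝔞 :=
  Quotient.congr (scalePart h1 h2 hc h) fun x y => by
    change (∃ u : (𝓞 E)ˣ, (u : E) * x = y) ↔ ∃ u : (𝓞 E)ˣ, (u : E) * (c • (x : E)) = c • (y : E)
    refine exists_congr fun u => ?_
    rw [mul_smul_comm]
    exact (smul_right_injective E hc).eq_iff.symm

/-- From `𝔟 = c𝔞` one gets `|N c| = N𝔟 / N𝔞`, and the norm from `E` of an element `c` of `F` is the
power of order `[E:F]` of its norm from `F`. -/
lemma orbitTerm_scaleOrbits (h1 : AntiIntegral 𝔞) (h2 : AntiIntegral 𝔟) {c : F} (hc : c ≠ 0)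
    (h : (𝔟 : FractionalIdeal (𝓞 F)⁰ F) = FractionalIdeal.spanSingleton (𝓞 F)⁰ c * 𝔞) (s : ℂ)
    (x : UnitOrbits 𝔄 𝔟) :
    orbitTerm s x = ((fracNorm 𝔟 : ℂ) ^ (Module.finrank F E * s) *
      (fracNorm 𝔞 : ℂ) ^ (-(Module.finrank F E * s))) * orbitTerm s (scaleOrbits h1 h2 hc h x) := by
  induction x using Quotient.inductionOn with | h x => ?_
  change ((|Algebra.norm ℚ (x : E)| : ℚ) : ℂ) ^ (-s) =
    _ * ((|Algebra.norm ℚ (c • (x : E))| : ℚ) : ℂ) ^ (-s)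
  have hx : (0 : ℝ) < (|Algebra.norm ℚ (x : E)| : ℚ) := by
    exact_mod_cast norm_pos_of_ne_zero (partOf_ne_zero x)
  have hc0 : (0 : ℝ) < (|Algebra.norm ℚ c| : ℚ) := by exact_mod_cast norm_pos_of_ne_zero hc
  have ha : (0 : ℝ) < (fracNorm 𝔞 : ℚ) := by exact_mod_cast fracNorm_pos 𝔞
  have hN : Algebra.norm ℚ (c • (x : E)) =
      Algebra.norm ℚ c ^ Module.finrank F E * Algebra.norm ℚ (x : E) := by
    rw [Algebra.smul_def, map_mul, ← Algebra.norm_norm (S := F), Algebra.norm_algebraMap, map_pow]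
  have e1 : ((fracNorm 𝔟 : ℚ) : ℝ) = (|Algebra.norm ℚ c| : ℚ) * (fracNorm 𝔞 : ℚ) := by
    rw [fracNorm_spanSingleton_mul h]
    push_cast
    rfl
  have e2 : ((|Algebra.norm ℚ (c • (x : E))| : ℚ) : ℝ) =
      ((|Algebra.norm ℚ c| : ℚ) : ℝ) ^ Module.finrank F E * (|Algebra.norm ℚ (x : E)| : ℚ) := by
    rw [hN, abs_mul, abs_pow]
    push_cast
    rfl
  rw [← Complex.ofReal_ratCast, ← Complex.ofReal_ratCast, ← Complex.ofReal_ratCast,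
    ← Complex.ofReal_ratCast, e1, e2, ofReal_mul_cpow hc0 ha, ofReal_mul_cpow (pow_pos hc0 _) hx,
    ofReal_pow_cpow hc0]
  have hc1 : (((|Algebra.norm ℚ c| : ℚ) : ℝ) : ℂ) ≠ 0 := by exact_mod_cast hc0.ne'
  have ha1 : (((fracNorm 𝔞 : ℚ) : ℝ) : ℂ) ≠ 0 := by exact_mod_cast ha.ne'
  rw [mul_neg, Complex.cpow_neg (((|Algebra.norm ℚ c| : ℚ) : ℝ) : ℂ),
    Complex.cpow_neg (((fracNorm 𝔞 : ℚ) : ℝ) : ℂ)]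
  have h4 : (((|Algebra.norm ℚ c| : ℚ) : ℝ) : ℂ) ^ (Module.finrank F E * s) ≠ 0 := by
    rw [Complex.cpow_def_of_ne_zero hc1]
    exact Complex.exp_ne_zero _
  have h5 : (((fracNorm 𝔞 : ℚ) : ℝ) : ℂ) ^ (Module.finrank F E * s) ≠ 0 := by
    rw [Complex.cpow_def_of_ne_zero ha1]
    exact Complex.exp_ne_zero _
  generalize (((fracNorm 𝔞 : ℚ) : ℝ) : ℂ) ^ (Module.finrank F E * s) = A at h5 ⊢
  generalize (((|Algebra.norm ℚ c| : ℚ) : ℝ) : ℂ) ^ (Module.finrank F E * s) = B at h4 ⊢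
  field_simp

/-- The inverses of the integral ideals in the class of `𝔞⁻¹` are the anti-integral ideals in the
class of `𝔞`. -/
def invIdeal (I : IntegralIdealsIn (ClassGroup.mk F 𝔞⁻¹)) : AntiIntegralIn (ClassGroup.mk F 𝔞) :=
  ⟨(FractionalIdeal.mk0 F I.1)⁻¹, by
    rw [map_inv, ClassGroup.mk_mk0, I.2, map_inv, inv_inv], by
    have h1 : ((I.1 : Ideal (𝓞 F)) : FractionalIdeal (𝓞 F)⁰ F) ≤ 1 := FractionalIdeal.coeIdeal_le_one
    have h2 := mul_le_mul_left h1 (((FractionalIdeal.mk0 F I.1)⁻¹ : FracIdeal F) :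
      FractionalIdeal (𝓞 F)⁰ F)
    rw [← FractionalIdeal.coe_mk0, Units.mul_inv, one_mul] at h2
    exact h2 (FractionalIdeal.one_mem_one _)⟩

lemma invIdeal_bijective : Function.Bijective (invIdeal (𝔞 := 𝔞)) := by
  constructor
  · intro I J h
    have h1 : FractionalIdeal.mk0 F I.1 = FractionalIdeal.mk0 F J.1 :=
      inv_injective (congrArg Subtype.val h)
    have h2 := congrArg (fun u : FracIdeal F => (u : FractionalIdeal (𝓞 F)⁰ F)) h1
    exact Subtype.ext (Subtype.ext (FractionalIdeal.coeIdeal_injective h2))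
  · rintro ⟨𝔟, hb, hb1⟩
    have h1 : (1 : FractionalIdeal (𝓞 F)⁰ F) ≤ 𝔟 := FractionalIdeal.one_le.2 hb1
    have h2 := mul_le_mul_left h1 ((𝔟⁻¹ : FracIdeal F) : FractionalIdeal (𝓞 F)⁰ F)
    rw [one_mul, Units.mul_inv] at h2
    obtain ⟨I, hI⟩ := FractionalIdeal.le_one_iff_exists_coeIdeal.1 h2
    have hI0 : I ≠ 0 := by
      rintro rfl
      rw [Submodule.zero_eq_bot, FractionalIdeal.coeIdeal_bot] at hI
      exact (𝔟⁻¹).ne_zero hI.symm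
    let J : (Ideal (𝓞 F))⁰ := ⟨I, mem_nonZeroDivisors_of_ne_zero hI0⟩
    have hJ : FractionalIdeal.mk0 F J = 𝔟⁻¹ := Units.ext hI
    refine ⟨⟨J, ?_⟩, ?_⟩
    · rw [← ClassGroup.mk_mk0 F, hJ, map_inv, map_inv, hb]
    · exact Subtype.ext (by change (FractionalIdeal.mk0 F J)⁻¹ = 𝔟; rw [hJ, inv_inv])

lemma fracNorm_inv (𝔞 : FracIdeal F) : fracNorm 𝔞⁻¹ = (fracNorm 𝔞)⁻¹ := by
  refine eq_inv_of_mul_eq_one_left ?_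
  unfold fracNorm
  rw [← map_mul, Units.inv_mul, map_one]

lemma fracNorm_mk0 (I : (Ideal (𝓞 F))⁰) :
    fracNorm (FractionalIdeal.mk0 F I) = (Ideal.absNorm (I : Ideal (𝓞 F)) : ℕ) := by
  unfold fracNorm
  rw [FractionalIdeal.coe_mk0, FractionalIdeal.coeIdeal_absNorm]

lemma fracNorm_invIdeal (s : ℂ) (I : IntegralIdealsIn (ClassGroup.mk F 𝔞⁻¹)) :
    (fracNorm (invIdeal I).1 : ℂ) ^ s = zetaTerm s I := by
  have h1 : fracNorm (invIdeal I).1 = ((Ideal.absNorm (I.1 : Ideal (𝓞 F)) : ℕ) : ℚ)⁻¹ := by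
    have h := fracNorm_inv (FractionalIdeal.mk0 F I.1)
    rwa [fracNorm_mk0] at h
  have h2 : (0 : ℝ) < Ideal.absNorm (I.1 : Ideal (𝓞 F)) := by
    exact_mod_cast Nat.pos_of_ne_zero (Ideal.absNorm_ne_zero_of_nonZeroDivisors I.1)
  have h3 := ofReal_inv_cpow h2 s
  rw [h1, zetaTerm]
  push_cast at h3 ⊢
  exact h3

/-- The relative partial zeta function in terms of a single sum over orbits. -/
theorem relPartialZeta_eq (h1 : AntiIntegral 𝔞) (s : ℂ) :
    relPartialZeta (ClassGroup.mk F 𝔞) 𝔄 s = (fracNorm 𝔄 : ℂ) ^ s *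
      ((fracNorm 𝔞 : ℂ) ^ (-(Module.finrank F E * s)) *
        partialZeta 𝔞⁻¹ (Module.finrank F E * s) * ∑' x : UnitOrbits 𝔄 𝔞, orbitTerm s x) := by
  have h2 : ∀ 𝔟 : AntiIntegralIn (ClassGroup.mk F 𝔞), ∑' x : UnitOrbits 𝔄 𝔟.1, orbitTerm s x =
      (fracNorm 𝔟.1 : ℂ) ^ (Module.finrank F E * s) *
        ((fracNorm 𝔞 : ℂ) ^ (-(Module.finrank F E * s)) * ∑' x : UnitOrbits 𝔄 𝔞, orbitTerm s x) := by
    intro 𝔟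
    obtain ⟨c, hc, h⟩ := exists_eq_spanSingleton_mul 𝔟.2.1
    rw [← mul_assoc, ← tsum_mul_left, ← (scaleOrbits h1 𝔟.2.2 hc h).tsum_eq]
    exact tsum_congr (orbitTerm_scaleOrbits h1 𝔟.2.2 hc h s)
  unfold relPartialZeta partialZeta
  simp_rw [h2]
  -- The remaining sum of `N(𝔟)^{ns}` becomes a partial zeta function on putting `𝔟 = 𝔠⁻¹`. Only
  -- constants are moved out of the sums, so no convergence is required.
  rw [tsum_mul_right, ← (Equiv.ofBijective _ invIdeal_bijective).tsum_eq]
  simp_rw [Equiv.ofBijective_apply, fracNorm_invIdeal]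
  ring

end RelativeZeta

end

end RelHecke

/-! ### The theorem. -/

theorem mainTheorem1 {F E : Type*} [Field F] [NumberField F] [Field E] [NumberField E]
    [Algebra F E] {n : ℕ} (fr : Frame F E n) (w : Module.Basis (Fin n) F E) (𝔄 : FracIdeal E)
    (D : ParabolicDatum (latticeOf w 𝔄)) (s : ℂ) (hs : 1 < s.re) :
    -- convergence of all the series and of the integral
    (∀ z : UpperSpace fr.embF n, Summable (eisTerm fr.embF fr.mk_embF D z s)) ∧
    Integrable (fun t => eisMod fr.embF fr.mk_embF D (heegnerMod fr w 𝔄 t) s)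
      (quotMeasure (relUnitLattice F E) (haarTRel F E)) ∧
    Summable (fun p : Σ 𝔟 : AntiIntegralIn (ClassGroup.mk F D.ideal), UnitOrbits 𝔄 𝔟.1 =>
      orbitTerm s p.2) ∧
    Summable (fun 𝔟 : IntegralIdealsIn (ClassGroup.mk F D.ideal⁻¹) => zetaTerm (n * s) 𝔟) ∧
    -- the unnormalized formula
    heckeIntegral fr w 𝔄 D s =
      ((|discW fr w| : ℝ) : ℂ) ^ (s / 2) * heckeFactor F E s *
        ∑' x : UnitOrbits 𝔄 D.ideal, orbitTerm s x ∧
    -- the normalized formula, without and with the denominator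
    partialZeta D.ideal⁻¹ (n * s) * heckeIntegral fr w 𝔄 D s =
      ((|discW fr w| : ℝ) : ℂ) ^ (s / 2) * heckeFactor F E s *
        ((fracNorm 𝔄 : ℂ) ^ (-s) / (fracNorm D.ideal : ℂ) ^ (-(n * s))) *
        relPartialZeta (ClassGroup.mk F D.ideal) 𝔄 s ∧
    (partialZeta D.ideal⁻¹ (n * s) ≠ 0 →
      heckeIntegral fr w 𝔄 D s =
        ((|discW fr w| : ℝ) : ℂ) ^ (s / 2) * heckeFactor F E s *
          ((fracNorm 𝔄 : ℂ) ^ (-s) / (fracNorm D.ideal : ℂ) ^ (-(n * s))) *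
          (relPartialZeta (ClassGroup.mk F D.ideal) 𝔄 s / partialZeta D.ideal⁻¹ (n * s))) := by
  have hn : Module.finrank F E = n := by simpa using Module.finrank_eq_card_basis w
  have hn1 : 1 ≤ n := hn ▸ finrank_pos' F E
  -- Since `n ≥ 1`, the point `n s` is again in the region of absolute convergence.
  have hns : 1 < ((n : ℂ) * s).re := by
    rw [← Complex.ofReal_natCast, Complex.re_ofReal_mul]
    have : (1 : ℝ) ≤ n := by exact_mod_cast hn1
    nlinarith
  obtain ⟨hint, hmain⟩ := integral_eisMod fr w D hs
  have hA : (fracNorm 𝔄 : ℂ) ≠ 0 := by exact_mod_cast (fracNorm_pos 𝔄).ne'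
  have ha : (fracNorm D.ideal : ℂ) ≠ 0 := by exact_mod_cast (fracNorm_pos D.ideal).ne'
  have hz : partialZeta D.ideal⁻¹ (n * s) * heckeIntegral fr w 𝔄 D s =
      ((|discW fr w| : ℝ) : ℂ) ^ (s / 2) * heckeFactor F E s *
        ((fracNorm 𝔄 : ℂ) ^ (-s) / (fracNorm D.ideal : ℂ) ^ (-(n * s))) *
        relPartialZeta (ClassGroup.mk F D.ideal) 𝔄 s := by
    rw [hmain, relPartialZeta_eq D.one_mem, hn, Complex.cpow_neg (fracNorm 𝔄 : ℂ)]
    have h1 : (fracNorm 𝔄 : ℂ) ^ s ≠ 0 := by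
      rw [Complex.cpow_def_of_ne_zero hA]
      exact Complex.exp_ne_zero _
    have h2 : (fracNorm D.ideal : ℂ) ^ (-(n * s)) ≠ 0 := by
      rw [Complex.cpow_def_of_ne_zero ha]
      exact Complex.exp_ne_zero _
    generalize (fracNorm 𝔄 : ℂ) ^ s = A at h1 ⊢
    generalize (fracNorm D.ideal : ℂ) ^ (-(n * s)) = B at h2 ⊢
    field_simp
  refine ⟨summable_eisTerm fr w D hs, hint, summable_orbitTerm _ hs, summable_zetaTerm F hns, hmain,
    hz, fun h0 => ?_⟩
  rw [← mul_div_assoc, eq_div_iff h0, mul_comm, hz]
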